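/- Let $C_r$ ($r\ge 3$) be the cycle with $r$ vertices and $r$ edges. A loop of length $r$ in a simplicial complex $X$ is a simplicial map $\gamma:C_r\to X$ (simplicial maps may collapse simplices). A filling of $\gamma$ consists of a finite simplicial complex $D$ and simplicial maps $b:C_r\to D$ and $\pi:D\to X$ such that $\gamma=\pi\circ b$ and the mapping cylinder of $b$ is a disk with boundary $C_r\times\{0\}$. The area $A(\gamma)\in\{0,1,2,\dots\}\cup\{\infty\}$ is the least number of triangles ($2$-dimensional faces) of $D$ over all fillings of $\gamma$; it is $\infty$ if $\gamma$ has no filling, that is, if $\gamma$ is not contractible. Theorem. Let $X$ be a finite simplicial complex and let $\rho>0$ be a real number with $44\rho^2>1$. Suppose that for every $r\ge 3$ every loop $\gamma:C_r\to X$ satisfies $$A(\gamma)\ge 44\rho^2\qquad\text{or}\qquad A(\gamma)\le\frac{\rho}{44}\,r .$$ Then for every $r\ge 3$ every loop $\gamma:C_r\to X$ satisfies $$A(\gamma)=\infty\qquad\text{or}\qquad A(\gamma)\le\rho\, r .$$ -/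

import Mathlib

namespace SimplicialFilling

/-- The faces of dimension `k` of a simplicial complex. -/
def facesOfDim {W : Type*} (K : AbstractSimplicialComplex W) (k : ℕ) : Set (Finset W) :=
  {s | s ∈ K.faces ∧ s.card = k + 1}

/-- The number `f_k(K)` of `k`-dimensional faces (used only for complexes on finitely many
vertices). -/
noncomputable def faceCount {W : Type*} (K : AbstractSimplicialComplex W) (k : ℕ) : ℕ :=
  (facesOfDim K k).ncard

/-- Simplicial maps, given on vertices: the image of a face is a face. A face may be mapped to a
face of smaller dimension. -/
def IsSimplicialMap {W V : Type*} (K : AbstractSimplicialComplex W)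
    (L : AbstractSimplicialComplex V) (f : W → V) : Prop :=
  ∀ s ∈ K.faces, ∃ t ∈ L.faces, (t : Set V) = f '' (s : Set W)

/-- The cycle `C_r` of length `r` (for `r ≥ 3`): its vertices are the residues modulo `r`, its
edges are the pairs `{i, i + 1}`. -/
def cycleComplex (r : ℕ) : AbstractSimplicialComplex (ZMod r) where
  faces := {s | s.Nonempty ∧ ∃ i : ZMod r, (s : Set (ZMod r)) ⊆ {i, i + 1}}
  isRelLowerSet_faces := fun _ h => ⟨h.1, fun _ hts ht =>
    ⟨ht, h.2.imp fun _ hi => (Finset.coe_subset.mpr hts).trans hi⟩⟩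
  singleton_mem := fun v => ⟨Finset.singleton_nonempty v, v, by simp⟩

/-- The simplicial mapping cylinder `Cyl(b)` of `b : C_r → D`. Its vertices are those of `C_r`
(the copy `C_r × 0`) and those of `D`; the square `{i, i + 1} × [0, 1]` over an edge of `C_r` is
divided into the triangles `{i, i + 1, b (i + 1)}` and `{i, b i, b (i + 1)}`, the latter
degenerating to the edge `{i, b i}` if `b` collapses the edge. -/
def mappingCylinder {r : ℕ} {W : Type*} (D : AbstractSimplicialComplex W) (b : ZMod r → W) :
    AbstractSimplicialComplex (ZMod r ⊕ W) where
  faces := {s | s.Nonempty ∧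
    ((∃ t ∈ D.faces, (s : Set (ZMod r ⊕ W)) ⊆ Sum.inr '' (t : Set W)) ∨
      ∃ i : ZMod r,
        (s : Set (ZMod r ⊕ W)) ⊆ {Sum.inl i, Sum.inl (i + 1), Sum.inr (b (i + 1))} ∨
        (s : Set (ZMod r ⊕ W)) ⊆ {Sum.inl i, Sum.inr (b i), Sum.inr (b (i + 1))})}
  isRelLowerSet_faces := fun _ h => ⟨h.1, fun _ hts ht =>
    ⟨ht, h.2.imp
      (fun ⟨t, htD, hst⟩ => ⟨t, htD, (Finset.coe_subset.mpr hts).trans hst⟩)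
      (fun ⟨i, hi⟩ => ⟨i, hi.imp (fun hi => (Finset.coe_subset.mpr hts).trans hi)
        (fun hi => (Finset.coe_subset.mpr hts).trans hi)⟩)⟩⟩
  singleton_mem := fun v => ⟨Finset.singleton_nonempty v, by
    rcases v with i | w
    · exact Or.inr ⟨i, Or.inl (by simp)⟩
    · exact Or.inl ⟨{w}, D.singleton_mem w, by simp⟩⟩

/-- The `1`-skeleton, as a graph. -/
def oneSkeleton {W : Type*} (K : AbstractSimplicialComplex W) : SimpleGraph W where
  Adj x y := x ≠ y ∧ ∃ s ∈ K.faces, x ∈ s ∧ y ∈ s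
  symm := ⟨fun _ _ h => ⟨h.1.symm, h.2.imp fun _ hs => ⟨hs.1, hs.2.2, hs.2.1⟩⟩⟩
  loopless := ⟨fun _ h => h.1 rfl⟩

/-- The edges of the link of the vertex `v`: `x` and `y` are joined if `{v, x, y}` is a
triangle. -/
def linkGraph {W : Type*} (K : AbstractSimplicialComplex W) (v : W) : SimpleGraph W where
  Adj x y := x ≠ y ∧ x ≠ v ∧ y ≠ v ∧ ∃ s ∈ K.faces, v ∈ s ∧ x ∈ s ∧ y ∈ s
  symm := ⟨fun _ _ h => ⟨h.1.symm, h.2.2.1, h.2.1,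
    h.2.2.2.imp fun _ hs => ⟨hs.1, hs.2.1, hs.2.2.2, hs.2.2.1⟩⟩⟩
  loopless := ⟨fun _ h => h.1 rfl⟩

/-- The triangles that contain the edge `e`. -/
def trianglesAt {W : Type*} (K : AbstractSimplicialComplex W) (e : Finset W) :
    Set (Finset W) :=
  {t | t ∈ facesOfDim K 2 ∧ e ⊆ t}

/-- The edges that lie in exactly one triangle. In a triangulated surface these are the edges of
the boundary. -/
def boundaryEdges {W : Type*} (K : AbstractSimplicialComplex W) : Set (Finset W) :=
  {e | e ∈ facesOfDim K 1 ∧ (trianglesAt K e).ncard = 1}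

/-- A finite simplicial complex triangulates a closed disk. By the classification of surfaces the
closed disk is the compact connected surface with non-empty boundary of Euler characteristic `1`;
a finite complex triangulates a compact surface with boundary if it is purely `2`-dimensional,
every edge lies in one or two triangles, and every vertex link is connected (hence a path or
a cycle). -/
structure IsDisk {W : Type*} (K : AbstractSimplicialComplex W) : Prop where
  finite : Finite W
  connected : (oneSkeleton K).Connected
  pure_two : ∀ s ∈ K.faces, ∃ t ∈ facesOfDim K 2, s ⊆ t
  edge : ∀ e ∈ facesOfDim K 1, (trianglesAt K e).ncard = 1 ∨ (trianglesAt K e).ncard = 2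
  link : ∀ v x y : W, (oneSkeleton K).Adj v x → (oneSkeleton K).Adj v y →
    (linkGraph K v).Reachable x y
  boundary : (boundaryEdges K).Nonempty
  euler : faceCount K 0 + faceCount K 2 = faceCount K 1 + 1

/-- `C_r → D → X` (by `b` and `π`) is a filling of `γ : C_r → X`: `b` and `π` are simplicial maps
with `γ = π b`, and the mapping cylinder of `b` is a disk with boundary `C_r × 0`. -/
structure IsFilling {V W : Type*} {r : ℕ} (X : AbstractSimplicialComplex V) (γ : ZMod r → V)
    (D : AbstractSimplicialComplex W) (b : ZMod r → W) (π : W → V) : Prop where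
  simplicial_left : IsSimplicialMap (cycleComplex r) D b
  simplicial_right : IsSimplicialMap D X π
  comp : ∀ i, π (b i) = γ i
  disk : IsDisk (mappingCylinder D b)
  boundary : boundaryEdges (mappingCylinder D b) =
    {e : Finset (ZMod r ⊕ W) | ∃ i : ZMod r,
      (e : Set (ZMod r ⊕ W)) = {Sum.inl i, Sum.inl (i + 1)}}

/-- The area `A(γ)`: the least number `f_2(D)` of triangles in a filling of `γ`. It is `∞` if `γ`
has no filling, that is, if `γ` is not contractible. -/
noncomputable def area {V : Type*} {r : ℕ} (X : AbstractSimplicialComplex V) (γ : ZMod r → V) :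
    ℕ∞ :=
  sInf {a | ∃ (W : Type) (D : AbstractSimplicialComplex W) (b : ZMod r → W) (π : W → V),
    IsFilling X γ D b π ∧ a = (faceCount D 2 : ℕ∞)}

end SimplicialFilling

/-!
# Loops with a gap in their areas satisfy a linear isoperimetric inequality

The argument is a subdivision argument for minimal fillings, in the style of Gromov's theorem that a
subquadratic isoperimetric inequality is linear. A minimal filling of a loop of length `ℓ` with
`n` triangles is regarded as a square with sides of length `ℓ / 4`. By the combinatorial
Besicovitch inequality `IsDiagram.exists_short_walk`, two opposite sides are joined by a path of
length at most `√n`, and this path cuts the filling into minimal fillings of two shorter loops, with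
`n₁ + n₂ = n`. If `n` is at most of order `ρ * ℓ` and at least `44 * ρ ^ 2`, then the path is short
compared with `ℓ`, and the bound `areaBound ρ ℓ = ρ * ℓ / 8 - ρ * √(ρ * ℓ) / 2` for the two
pieces implies the same bound for `n` (`areaBound_add_le`). That `n` is at most of order `ρ * ℓ`
comes from an induction on the area: removing a triangle at the boundary of a minimal filling gives a
loop of length `ℓ + 1` and area `n - 1` (`exists_peel_of_isLeast`). The induction runs through
`lt_or_le_areaBound`; the loops whose area lies below the gap `44 * ρ ^ 2` are covered by the
hypothesis.

Fillings are handled through two combinatorial models. `NullWalk X x l n` is an inductive predicate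
that derives the closed walk `x, l` of `X` with `n` triangles, peeling a planar diagram from the
first boundary step. `IsDiagram` describes such a diagram by two conditions only: each edge
is traversed twice by the triangles and the boundary walk together, and the first cohomology modulo
`2` vanishes. The latter replaces the Jordan curve theorem, as a cocycle that is supported on an edge
or a path has a primitive, which tells the two sides apart. It makes it possible to peel a
diagram (`IsDiagram.nullWalk`) and to cut it along a path (`IsDiagram.cut`). Conversely, every
derivation yields a diagram that is a disk once a collar is attached
(`NullWalk.exists_isFilled`). For connected surfaces with boundary, the condition on the Euler
characteristic in the definition of a disk is equivalent to the vanishing of the cohomology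
(`euler_iff_isExact`). Hence the area of a loop is the least `n` for which its word has a derivation
(`area_le_iff`). Gluing derivations along a path (`NullWithin.theta`) shows that the area of a loop
is at most the sum of the areas of the pieces into which a path cuts it.
-/

namespace SimplicialFilling

/-! ### Closed walks and planar diagrams -/

section Walks

variable {W : Type*}

/-- A walk is encoded by its first vertex `x` and the list `l` of the vertices visited afterwards,
so that it ends at `l.getLastD x`. This is the list of the unordered pairs of consecutive
vertices; a stationary step contributes a diagonal element of `Sym2 W`. -/
def steps : W → List W → List (Sym2 W)
  | _, [] => []
  | x, y :: l => s(x, y) :: steps y l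

@[simp] lemma steps_nil (x : W) : steps x [] = [] := rfl

@[simp] lemma steps_cons (x y : W) (l : List W) : steps x (y :: l) = s(x, y) :: steps y l := rfl

@[simp] lemma getLastD_append (x : W) (l l' : List W) :
    (l ++ l').getLastD x = l'.getLastD (l.getLastD x) := by
  induction l generalizing x with
  | nil => simp
  | cons y l ih => rw [List.cons_append, List.getLastD_cons, List.getLastD_cons, ih]

lemma steps_append (x : W) (l l' : List W) :
    steps x (l ++ l') = steps x l ++ steps (l.getLastD x) l' := by
  induction l generalizing x with
  | nil => simp
  | cons y l ih => simp only [List.cons_append, steps_cons, List.getLastD_cons, ih]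

lemma exists_step_split {e : Sym2 W} (x : W) (l : List W) (he : e ∈ steps x l) :
    ∃ l₁ a l₂, l = l₁ ++ a :: l₂ ∧ s(l₁.getLastD x, a) = e ∧ e ∉ steps x l₁ := by
  induction l generalizing x with
  | nil => simp at he
  | cons y l ih =>
    by_cases h : s(x, y) = e
    · exact ⟨[], y, l, rfl, by simpa using h, by simp⟩
    · have he' : e ∈ steps y l := by
        rcases List.mem_cons.1 he with h' | h'
        · exact absurd h'.symm h
        · exact h'
      obtain ⟨l₁, a, l₂, rfl, h₁, h₂⟩ := ih y he'
      refine ⟨y :: l₁, a, l₂, rfl, by rw [List.getLastD_cons]; exact h₁, ?_⟩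
      simp only [steps_cons, List.mem_cons, not_or]
      exact ⟨fun h' => h h'.symm, h₂⟩

/-- A property that is inherited along every step holds on the whole walk. -/
lemma forall_mem_walk {P : W → Prop} {x : W} {l : List W}
    (hP : ∀ a b, s(a, b) ∈ steps x l → P a → P b) (hx : P x) : ∀ v ∈ x :: l, P v := by
  induction l generalizing x with
  | nil => simpa using hx
  | cons y l ih =>
    have hy : P y := hP x y (by simp) hx
    intro v hv
    rcases List.mem_cons.1 hv with rfl | hv
    · exact hx
    · exact ih (fun a b h => hP a b (by simp [h])) hy v hv

lemma getLastD_mem_cons (x : W) (l : List W) : l.getLastD x ∈ x :: l := by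
  induction l generalizing x with
  | nil => simp
  | cons y l ih =>
    rw [List.getLastD_cons]
    exact List.mem_cons_of_mem _ (ih y)

lemma mem_walk_of_mem_steps {x : W} {l : List W} {e : Sym2 W} (he : e ∈ steps x l) :
    ∀ v ∈ e, v ∈ x :: l := by
  induction l generalizing x with
  | nil => simp at he
  | cons y l ih =>
    rcases List.mem_cons.1 he with rfl | he
    · intro v hv
      rcases Sym2.mem_iff.1 hv with rfl | rfl <;> simp
    · intro v hv
      exact List.mem_cons_of_mem _ (ih he v hv)

end Walks

/-- `NullWalk X x l n`: the closed walk `x, l` of `X` is null-homotopic across `n` triangles. The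
derivation peels a planar diagram at the first step of the walk: that step is stationary, or it
is a bridge of the diagram and is traversed backwards later on, or it lies on a triangle. The
triangles `{x, y, z}` may be degenerate. -/
inductive NullWalk {V : Type*} (X : AbstractSimplicialComplex V) : V → List V → ℕ → Prop
  | nil (x : V) : NullWalk X x [] 0
  | stutter {x : V} {l : List V} {n : ℕ} : NullWalk X x l n → NullWalk X x (x :: l) n
  | bridge {x y : V} {l l' : List V} {n m : ℕ} : (∃ s ∈ X.faces, x ∈ s ∧ y ∈ s) →
      NullWalk X y l n → NullWalk X x l' m → NullWalk X x (y :: (l ++ x :: l')) (n + m)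
  | triangle {x y z : V} {l : List V} {n : ℕ} : (∃ s ∈ X.faces, x ∈ s ∧ y ∈ s ∧ z ∈ s) →
      NullWalk X x (z :: y :: l) n → NullWalk X x (y :: l) (n + 1)

section Diagrams

variable {W : Type*}

open Classical in
/-- The number of triangles of `S` that contain the edge `e`. -/
noncomputable def triangleDegree (S : Finset (Finset W)) (e : Sym2 W) : ℕ :=
  (S.filter fun t => ∀ v ∈ e, v ∈ t).card

open Classical in
/-- The number of times a walk traverses the edge `e`, in either direction. -/
noncomputable def stepCount (x : W) (l : List W) (e : Sym2 W) : ℕ :=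
  (steps x l).count e

/-- A `1`-cochain modulo `2` that vanishes on the boundaries of the triangles of `S`. -/
def IsCocycle (S : Finset (Finset W)) (f : Sym2 W → ZMod 2) : Prop :=
  ∀ t ∈ S, ∀ x ∈ t, ∀ y ∈ t, ∀ z ∈ t, x ≠ y → y ≠ z → x ≠ z →
    f s(x, y) + f s(y, z) + f s(x, z) = 0

/-- A planar diagram with edges `E`, triangles `S` and boundary walk `x, l`: the boundary walk and
the boundaries of the triangles together traverse each edge twice, and the first cohomology
group modulo `2` vanishes. Neither connectedness nor conditions on vertex links are needed to
take such a diagram apart. -/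
structure IsDiagram (E : Finset (Sym2 W)) (S : Finset (Finset W)) (x : W) (l : List W) :
    Prop where
  not_isDiag : ∀ e ∈ E, ¬ e.IsDiag
  card_eq_three : ∀ t ∈ S, t.card = 3
  edge_mem : ∀ t ∈ S, ∀ a ∈ t, ∀ b ∈ t, a ≠ b → s(a, b) ∈ E
  step_mem : ∀ e ∈ steps x l, ¬ e.IsDiag → e ∈ E
  closed : l.getLastD x = x
  degree : ∀ e ∈ E, triangleDegree S e + stepCount x l e = 2
  exact : ∀ f, IsCocycle S f → ∃ h : W → ZMod 2, ∀ a b, s(a, b) ∈ E → f s(a, b) = h a + h b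

open Classical in
/-- The cocycle condition for a triangle need only be checked for one order of its vertices. -/
lemma sum_triple_eq_zero {x y z : W} (f : Sym2 W → ZMod 2)
    (h : f s(x, y) + f s(y, z) + f s(x, z) = 0) {a b c : W} (ha : a ∈ ({x, y, z} : Finset W))
    (hb : b ∈ ({x, y, z} : Finset W)) (hc : c ∈ ({x, y, z} : Finset W)) (hab : a ≠ b)
    (hbc : b ≠ c) (hac : a ≠ c) : f s(a, b) + f s(b, c) + f s(a, c) = 0 := by
  simp only [Finset.mem_insert, Finset.mem_singleton] at ha hb hc
  rcases ha with ha | ha | ha <;> rcases hb with hb | hb | hb <;>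
    rcases hc with hc | hc | hc <;> first
      | exact absurd (ha.trans hb.symm) hab
      | exact absurd (hb.trans hc.symm) hbc
      | exact absurd (ha.trans hc.symm) hac
      | (rw [ha, hb, hc]
         try simp only [Sym2.eq_swap (a := y) (b := x), Sym2.eq_swap (a := z) (b := x),
           Sym2.eq_swap (a := z) (b := y)]
         linear_combination h)

lemma stepCount_cons (x y : W) (l : List W) (e : Sym2 W) [Decidable (s(x, y) = e)] :
    stepCount x (y :: l) e = stepCount y l e + if s(x, y) = e then 1 else 0 := by
  classical
  unfold stepCount
  rw [steps_cons, List.count_cons]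
  congr 1
  by_cases h : s(x, y) = e <;> simp [h]

lemma stepCount_append (x : W) (l l' : List W) (e : Sym2 W) :
    stepCount x (l ++ l') e = stepCount x l e + stepCount (l.getLastD x) l' e := by
  classical
  unfold stepCount
  rw [steps_append, List.count_append]

lemma stepCount_eq_zero {x : W} {l : List W} {e : Sym2 W} (h : e ∉ steps x l) :
    stepCount x l e = 0 := by
  classical
  exact List.count_eq_zero.2 h

@[simp] lemma stepCount_nil (x : W) (e : Sym2 W) : stepCount x [] e = 0 :=
  stepCount_eq_zero (by simp)

lemma stepCount_pos {x : W} {l : List W} {e : Sym2 W} : 0 < stepCount x l e ↔ e ∈ steps x l := by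
  classical
  exact List.count_pos_iff

lemma triangleDegree_eq_zero {S : Finset (Finset W)} {e : Sym2 W} :
    triangleDegree S e = 0 ↔ ∀ t ∈ S, ¬ ∀ v ∈ e, v ∈ t := by
  classical
  simp [triangleDegree, Finset.filter_eq_empty_iff]

variable {E : Finset (Sym2 W)} {S : Finset (Finset W)} {x y : W} {l : List W}

lemma IsDiagram.of_stutter (hd : IsDiagram E S x (x :: l)) : IsDiagram E S x l where
  not_isDiag := hd.not_isDiag
  card_eq_three := hd.card_eq_three
  edge_mem := hd.edge_mem
  step_mem e he := hd.step_mem e (by simp [he])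
  closed := by simpa only [List.getLastD_cons] using hd.closed
  degree e he := by
    classical
    have h := hd.degree e he
    rw [stepCount_cons, if_neg] at h
    · exact h
    · rintro rfl
      exact hd.not_isDiag _ he (by simp)
  exact := hd.exact

lemma IsDiagram.of_perm {y : W} {l' : List W} (hd : IsDiagram E S x l)
    (hp : (steps x l).Perm (steps y l')) (hcl : l'.getLastD y = y) : IsDiagram E S y l' where
  not_isDiag := hd.not_isDiag
  card_eq_three := hd.card_eq_three
  edge_mem := hd.edge_mem
  step_mem e he := hd.step_mem e (hp.mem_iff.2 he)
  closed := hcl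
  degree e he := by
    classical
    rw [← hd.degree e he]
    unfold stepCount
    rw [hp.count_eq]
  exact := hd.exact

lemma steps_rotate_perm (hcl : l.getLastD y = x) :
    (steps x (y :: l)).Perm (steps y (l ++ [y])) := by
  rw [steps_append, hcl]
  exact (List.perm_append_singleton _ _).symm

lemma IsDiagram.rotate (hd : IsDiagram E S x (y :: l)) : IsDiagram E S y (l ++ [y]) :=
  hd.of_perm (steps_rotate_perm (by simpa only [List.getLastD_cons] using hd.closed))
    (by simp only [getLastD_append, List.getLastD_cons, List.getLastD_nil])

lemma IsDiagram.of_rotate (hd : IsDiagram E S y (l ++ [y])) (hcl : l.getLastD y = x) :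
    IsDiagram E S x (y :: l) :=
  hd.of_perm (steps_rotate_perm hcl).symm (by rw [List.getLastD_cons, hcl])

open Classical in
/-- If all edges but the bridge `e` respect the function `h`, then the part of a diagram on which
`h` takes the value `c` is a diagram for a closed walk that collects all the boundary steps of
that part. -/
lemma IsDiagram.part (hd : IsDiagram E S x l) {e : Sym2 W} (he : triangleDegree S e = 0)
    {h : W → ZMod 2} (hh : ∀ a b, s(a, b) ∈ E → s(a, b) ≠ e → h a = h b) {c : ZMod 2}
    {y : W} {l' : List W} (hcl : l'.getLastD y = y) (hl' : ∀ e' ∈ steps y l', e' ∈ steps x l)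
    (hc : ∀ v ∈ y :: l', h v = c) (hne : e ∉ steps y l')
    (hcount : ∀ e' ∈ E, e' ≠ e → (∀ v ∈ e', h v = c) → stepCount y l' e' = stepCount x l e') :
    IsDiagram (E.filter fun e' => e' ≠ e ∧ ∀ v ∈ e', h v = c)
      (S.filter fun t => ∀ v ∈ t, h v = c) y l' := by
  have htri : ∀ t ∈ S, ∀ a ∈ t, ∀ b ∈ t, a ≠ b → s(a, b) ≠ e := by
    rintro t ht a ha b hb - rfl
    refine triangleDegree_eq_zero.1 he t ht ?_
    intro v hv
    rcases Sym2.mem_iff.1 hv with rfl | rfl <;> assumption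
  have hconst : ∀ t ∈ S, ∀ a ∈ t, ∀ b ∈ t, h a = h b := by
    intro t ht a ha b hb
    by_cases hab : a = b
    · rw [hab]
    · exact hh a b (hd.edge_mem t ht a ha b hb hab) (htri t ht a ha b hb hab)
  refine ⟨?_, ?_, ?_, ?_, hcl, ?_, ?_⟩
  · intro e' he'
    exact hd.not_isDiag e' (Finset.mem_filter.1 he').1
  · intro t ht
    exact hd.card_eq_three t (Finset.mem_filter.1 ht).1
  · intro t ht a ha b hb hab
    obtain ⟨ht, htc⟩ := Finset.mem_filter.1 ht
    refine Finset.mem_filter.2 ⟨hd.edge_mem t ht a ha b hb hab, htri t ht a ha b hb hab, ?_⟩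
    intro v hv
    rcases Sym2.mem_iff.1 hv with rfl | rfl
    · exact htc _ ha
    · exact htc _ hb
  · intro e' he' hdiag
    refine Finset.mem_filter.2 ⟨hd.step_mem e' (hl' e' he') hdiag, ?_, ?_⟩
    · rintro rfl
      exact hne he'
    · intro v hv
      exact hc v (mem_walk_of_mem_steps he' v hv)
  · intro e' he'
    obtain ⟨he'E, hne', hec⟩ := Finset.mem_filter.1 he'
    rw [hcount e' he'E hne' hec]
    refine Eq.trans ?_ (hd.degree e' he'E)
    congr 1
    unfold triangleDegree
    congr 1
    ext t
    simp only [Finset.mem_filter]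
    constructor
    · rintro ⟨⟨h₁, -⟩, h₂⟩
      exact ⟨h₁, h₂⟩
    · rintro ⟨h₁, h₂⟩
      refine ⟨⟨h₁, ?_⟩, h₂⟩
      intro v hv
      have ha : (Quot.out e').1 ∈ e' := Sym2.out_fst_mem e'
      rw [hconst t h₁ v hv _ (h₂ _ ha), hec _ ha]
  · intro f hf
    have hext : IsCocycle S
        (fun e' => if e' ∈ E.filter (fun e' => e' ≠ e ∧ ∀ v ∈ e', h v = c) then f e' else 0) := by
      intro t ht a ha b hb d hd' hab hbd had
      by_cases hac : h a = c
      · have hall : ∀ v ∈ t, h v = c := fun v hv => by rw [hconst t ht v hv a ha, hac]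
        have key : ∀ u ∈ t, ∀ w ∈ t, u ≠ w →
            s(u, w) ∈ E.filter (fun e' => e' ≠ e ∧ ∀ v ∈ e', h v = c) := by
          intro u hu w hw huw
          refine Finset.mem_filter.2 ⟨hd.edge_mem t ht u hu w hw huw, htri t ht u hu w hw huw, ?_⟩
          intro v hv
          rcases Sym2.mem_iff.1 hv with rfl | rfl
          · exact hall _ hu
          · exact hall _ hw
        simp only [if_pos (key a ha b hb hab), if_pos (key b hb d hd' hbd),
          if_pos (key a ha d hd' had)]
        exact hf t (Finset.mem_filter.2 ⟨ht, hall⟩) a ha b hb d hd' hab hbd had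
      · have key : ∀ u ∈ t, ∀ w ∈ t,
            s(u, w) ∉ E.filter (fun e' => e' ≠ e ∧ ∀ v ∈ e', h v = c) := by
          intro u hu w hw hmem
          refine hac ?_
          rw [hconst t ht a ha u hu]
          exact (Finset.mem_filter.1 hmem).2.2 u (by simp)
        simp only [if_neg (key a ha b hb), if_neg (key b hb d hd'), if_neg (key a ha d hd'),
          add_zero]
    obtain ⟨k, hk⟩ := hd.exact _ hext
    refine ⟨k, fun a b hab => ?_⟩
    rw [← hk a b (Finset.mem_filter.1 hab).1, if_pos hab]

/-- A diagram whose boundary walk starts with a bridge falls apart into two diagrams. -/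
lemma IsDiagram.exists_bridge (hd : IsDiagram E S x (y :: l)) (hxy : x ≠ y)
    (h0 : triangleDegree S s(x, y) = 0) :
    ∃ (l₁ l₂ : List W) (h : W → ZMod 2) (E₁ E₂ : Finset (Sym2 W)) (S₁ S₂ : Finset (Finset W)),
      l = l₁ ++ x :: l₂ ∧ IsDiagram E₁ S₁ y l₁ ∧ IsDiagram E₂ S₂ x l₂ ∧
      E₁ ⊆ E ∧ E₂ ⊆ E ∧ E₁.card < E.card ∧ E₂.card < E.card ∧ S₁ ⊆ S ∧ S₂ ⊆ S ∧
      S₁.card + S₂.card ≤ S.card ∧ h x ≠ h y ∧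
      (∀ a b, s(a, b) ∈ E → s(a, b) ≠ s(x, y) → h a = h b) ∧
      (∀ v ∈ y :: l₁, h v = h y) ∧
      (∀ a b, s(a, b) ∈ E → s(a, b) ≠ s(x, y) → h a = h x → s(a, b) ∈ E₂) := by
  classical
  set e : Sym2 W := s(x, y) with he
  have heE : e ∈ E := hd.step_mem e (by simp [he]) (by simpa [he] using hxy)
  have hcnt : stepCount y l e = 1 := by
    have := hd.degree e heE
    rw [h0, stepCount_cons, if_pos rfl] at this
    omega
  -- The indicator function of the bridge is a cocycle, so it separates the vertices.
  obtain ⟨h, hh⟩ := hd.exact (fun e' => if e' = e then 1 else 0) (by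
    intro t ht a ha b hb d hd' hab hbd had
    have key : ∀ u ∈ t, ∀ w ∈ t, s(u, w) ≠ e := by
      intro u hu w hw huw
      refine triangleDegree_eq_zero.1 h0 t ht ?_
      rw [← huw]
      intro v hv
      rcases Sym2.mem_iff.1 hv with rfl | rfl <;> assumption
    simp [key a ha b hb, key b hb d hd', key a ha d hd'])
  have hne : h x ≠ h y := by
    intro hxy'
    have := hh x y heE
    rw [if_pos rfl, hxy', CharTwo.add_self_eq_zero] at this
    exact one_ne_zero this
  have hcross : ∀ a b, s(a, b) ∈ E → s(a, b) ≠ e → h a = h b := by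
    intro a b hab hne'
    have := hh a b hab
    rw [if_neg hne'] at this
    exact (CharTwo.add_eq_zero.1 this.symm)
  obtain ⟨l₁, a, l₂, rfl, hs, hnot⟩ := exists_step_split y l
    (stepCount_pos.1 (hcnt ▸ Nat.one_pos))
  have hconst : ∀ z (m : List W), (∀ e' ∈ steps z m, e' ∈ steps x (y :: (l₁ ++ a :: l₂))) →
      e ∉ steps z m → ∀ v ∈ z :: m, h v = h z := by
    intro z m hsub hem
    refine forall_mem_walk (P := fun v => h v = h z) ?_ rfl
    intro u w huw hu
    by_cases huw' : u = w
    · rw [← huw', hu]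
    · rw [← hu]
      refine (hcross u w (hd.step_mem _ (hsub _ huw) (by simpa using huw')) ?_).symm
      intro h'
      exact hem (h' ▸ huw)
  have hsub₁ : ∀ e' ∈ steps y l₁, e' ∈ steps x (y :: (l₁ ++ a :: l₂)) := by
    intro e' he'
    simp [steps_append, he']
  have hsub₂ : ∀ e' ∈ steps a l₂, e' ∈ steps x (y :: (l₁ ++ a :: l₂)) := by
    intro e' he'
    simp [steps_append, he']
  have hlast : h (l₁.getLastD y) = h y := hconst y l₁ hsub₁ hnot _ (getLastD_mem_cons _ _)
  -- The first walk stays on its side, so the bridge is traversed backwards the second time.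
  have hya : l₁.getLastD y = y ∧ a = x := by
    rcases Sym2.eq_iff.1 hs with ⟨h₁, h₂⟩ | ⟨h₁, h₂⟩
    · rw [h₁] at hlast
      exact absurd hlast hne
    · exact ⟨h₁, h₂⟩
  obtain ⟨hcl₁, rfl⟩ := hya
  have hnot₂ : e ∉ steps a l₂ := by
    intro hmem
    have h₁ := hcnt
    rw [stepCount_append, hcl₁, stepCount_cons, if_pos (by rw [he, Sym2.eq_swap])] at h₁
    have := stepCount_pos.2 hmem
    omega
  have hc₁ := hconst y l₁ hsub₁ hnot
  have hc₂ := hconst a l₂ hsub₂ hnot₂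
  have hcl₂ : l₂.getLastD a = a := by
    simpa only [List.getLastD_cons, getLastD_append] using hd.closed
  have htotal : ∀ e' ≠ e, stepCount a (y :: (l₁ ++ a :: l₂)) e' =
      stepCount y l₁ e' + stepCount a l₂ e' := by
    intro e' he'
    rw [stepCount_cons, stepCount_append, hcl₁, stepCount_cons,
      if_neg (fun h' => he' (h'.symm.trans Sym2.eq_swap)), if_neg (fun h' => he' h'.symm),
      add_zero, add_zero]
  have hz : ∀ z (m : List W) (c : ZMod 2) (e' : Sym2 W), (∀ v ∈ z :: m, h v ≠ c) →
      (∀ v ∈ e', h v = c) → stepCount z m e' = 0 := by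
    intro z m c e' hzm he'
    refine stepCount_eq_zero fun hmem => ?_
    have hout := Sym2.out_fst_mem e'
    exact hzm _ (mem_walk_of_mem_steps hmem _ hout) (he' _ hout)
  refine ⟨l₁, l₂, h, _, _, _, _, rfl,
    hd.part h0 hcross (c := h y) hcl₁ hsub₁ hc₁ hnot ?_,
    hd.part h0 hcross (c := h a) hcl₂ hsub₂ hc₂ hnot₂ ?_,
    Finset.filter_subset _ _, Finset.filter_subset _ _, ?_, ?_, Finset.filter_subset _ _,
    Finset.filter_subset _ _, ?_, hne, hcross, hc₁, ?_⟩
  · intro e' _ hne' hec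
    rw [htotal e' hne', hz a l₂ (h y) e' (fun v hv => by rw [hc₂ v hv]; exact hne) hec, add_zero]
  · intro e' _ hne' hec
    rw [htotal e' hne', hz y l₁ (h a) e' (fun v hv => by rw [hc₁ v hv]; exact hne.symm) hec,
      zero_add]
  · exact Finset.card_lt_card (Finset.filter_ssubset.2 ⟨e, heE, by simp⟩)
  · exact Finset.card_lt_card (Finset.filter_ssubset.2 ⟨e, heE, by simp⟩)
  · rw [← Finset.card_union_of_disjoint]
    · exact Finset.card_le_card (Finset.union_subset (Finset.filter_subset _ _)
        (Finset.filter_subset _ _))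
    · rw [Finset.disjoint_left]
      intro t ht₁ ht₂
      obtain ⟨htS, h₁⟩ := Finset.mem_filter.1 ht₁
      have h₂ := (Finset.mem_filter.1 ht₂).2
      have : t.Nonempty := by
        rw [← Finset.card_pos, hd.card_eq_three t htS]
        norm_num
      obtain ⟨v, hv⟩ := this
      exact hne ((h₂ v hv).symm.trans (h₁ v hv))
  · intro u w huw hne' hu
    refine Finset.mem_filter.2 ⟨huw, hne', ?_⟩
    intro v hv
    rcases Sym2.mem_iff.1 hv with rfl | rfl
    · exact hu
    · rw [← hcross _ _ huw hne', hu]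

open Classical in
/-- If the first boundary step of a diagram lies on a triangle, then that triangle and the edge can
be removed. -/
lemma IsDiagram.exists_triangle (hd : IsDiagram E S x (y :: l)) (hxy : x ≠ y)
    (h0 : triangleDegree S s(x, y) ≠ 0) :
    ∃ z, ({x, y, z} : Finset W) ∈ S ∧ z ≠ x ∧ z ≠ y ∧
      IsDiagram (E.erase s(x, y)) (S.erase {x, y, z}) x (z :: y :: l) := by
  have heE : s(x, y) ∈ E := hd.step_mem _ (by simp) (by simpa using hxy)
  have hdeg := hd.degree _ heE
  rw [stepCount_cons, if_pos rfl] at hdeg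
  have h1 : triangleDegree S s(x, y) = 1 := by omega
  have h2 : stepCount y l s(x, y) = 0 := by omega
  obtain ⟨t, ht⟩ := Finset.card_eq_one.1 h1
  have hmem : ∀ t', (t' ∈ S ∧ x ∈ t' ∧ y ∈ t') ↔ t' = t := by
    intro t'
    rw [← Finset.mem_singleton, ← ht, Finset.mem_filter]
    simp [Sym2.mem_iff]
  obtain ⟨htS, hxt, hyt⟩ := (hmem t).2 rfl
  have hcard := hd.card_eq_three t htS
  obtain ⟨z, hz⟩ : ∃ z, z ∈ (t.erase x).erase y := by
    rw [← Finset.Nonempty, ← Finset.card_pos, Finset.card_erase_of_mem, Finset.card_erase_of_mem hxt]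
    · omega
    · simp [hyt, hxy.symm]
  simp only [Finset.mem_erase] at hz
  obtain ⟨hzy, hzx, hzt⟩ := hz
  have hteq : t = {x, y, z} := by
    refine (Finset.eq_of_subset_of_card_le ?_ ?_).symm
    · intro v hv
      simp only [Finset.mem_insert, Finset.mem_singleton] at hv
      rcases hv with rfl | rfl | rfl <;> assumption
    · rw [hcard, Finset.card_eq_three.2 ⟨x, y, z, hxy, hzx.symm, hzy.symm, rfl⟩]
  subst hteq
  have hother : ∀ t' ∈ S.erase {x, y, z}, ¬ (x ∈ t' ∧ y ∈ t') := by
    intro t' ht' h'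
    obtain ⟨hne, htS'⟩ := Finset.mem_erase.1 ht'
    exact hne ((hmem t').1 ⟨htS', h'⟩)
  refine ⟨z, htS, hzx, hzy, ?_, ?_, ?_, ?_, ?_, ?_, ?_⟩
  · intro e he
    exact hd.not_isDiag e (Finset.mem_of_mem_erase he)
  · intro t' ht'
    exact hd.card_eq_three t' (Finset.mem_of_mem_erase ht')
  · intro t' ht' a ha b hb hab
    refine Finset.mem_erase.2 ⟨?_, hd.edge_mem t' (Finset.mem_of_mem_erase ht') a ha b hb hab⟩
    intro h'
    refine hother t' ht' ?_
    rcases Sym2.eq_iff.1 h' with ⟨rfl, rfl⟩ | ⟨rfl, rfl⟩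
    · exact ⟨ha, hb⟩
    · exact ⟨hb, ha⟩
  · intro e he hdiag
    simp only [steps_cons, List.mem_cons] at he
    rcases he with rfl | rfl | he
    · refine Finset.mem_erase.2 ⟨?_, hd.edge_mem _ htS x (by simp) z (by simp) hzx.symm⟩
      simp [hzy, hzx, hxy]
    · refine Finset.mem_erase.2 ⟨?_, hd.edge_mem _ htS z (by simp) y (by simp) hzy⟩
      simp [hzy, hzx]
    · refine Finset.mem_erase.2 ⟨?_, hd.step_mem e (by simp [he]) hdiag⟩
      rintro rfl
      have := stepCount_pos.2 he
      omega
  · simpa using hd.closed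
  · intro e he
    obtain ⟨hne, heE'⟩ := Finset.mem_erase.1 he
    have hdeg' := hd.degree e heE'
    rw [stepCount_cons, if_neg (fun h' => hne h'.symm)] at hdeg'
    rw [← hdeg', stepCount_cons, stepCount_cons]
    have hT : triangleDegree S e = triangleDegree (S.erase {x, y, z}) e +
        if ∀ v ∈ e, v ∈ ({x, y, z} : Finset W) then 1 else 0 := by
      unfold triangleDegree
      rw [Finset.filter_erase]
      split_ifs with h'
      · rw [Finset.card_erase_add_one]
        exact Finset.mem_filter.2 ⟨htS, h'⟩
      · rw [Finset.erase_eq_of_notMem, add_zero]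
        exact fun hc => h' (Finset.mem_filter.1 hc).2
    have hE : (if ∀ v ∈ e, v ∈ ({x, y, z} : Finset W) then 1 else 0) =
        (if s(z, y) = e then 1 else 0) + if s(x, z) = e then 1 else 0 := by
      have hdg := hd.not_isDiag e heE'
      induction e using Sym2.ind with
      | _ a b =>
        have hab : a ≠ b := by simpa using hdg
        by_cases hin : ∀ v ∈ s(a, b), v ∈ ({x, y, z} : Finset W)
        · rw [if_pos hin]
          have ha := hin a (by simp)
          have hb := hin b (by simp)
          simp only [Finset.mem_insert, Finset.mem_singleton] at ha hb
          rcases ha with rfl | rfl | rfl <;> rcases hb with rfl | rfl | rfl <;>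
            simp_all [eq_comm]
        · rw [if_neg hin, if_neg, if_neg]
          · intro h'
            rw [← h'] at hin
            simp at hin
          · intro h'
            rw [← h'] at hin
            simp at hin
    rw [hT, hE]
    ring
  · intro f hf
    -- The value on the removed edge is forced by the removed triangle.
    obtain ⟨h, hh⟩ := hd.exact
      (fun e => if e = s(x, y) then f s(x, z) + f s(y, z) else f e) (by
        intro t' ht' a ha b hb c hc hab hbc hac
        by_cases htt : t' = {x, y, z}
        · subst htt
          refine sum_triple_eq_zero (fun e => if e = s(x, y) then f s(x, z) + f s(y, z) else f e)
            ?_ ha hb hc hab hbc hac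
          have h₁ : s(y, z) ≠ s(x, y) := by simp [hzx, hzy]
          have h₂ : s(x, z) ≠ s(x, y) := by simp [hxy, hzy]
          have h₃ : ∀ p q : ZMod 2, p + q + q + p = 0 := by decide
          rw [if_pos rfl, if_neg h₁, if_neg h₂]
          exact h₃ _ _
        · have hmem' := Finset.mem_erase.2 ⟨htt, ht'⟩
          have key : ∀ u ∈ t', ∀ w ∈ t', s(u, w) ≠ s(x, y) := by
            intro u hu w hw h'
            refine hother t' hmem' ?_
            rcases Sym2.eq_iff.1 h' with ⟨rfl, rfl⟩ | ⟨rfl, rfl⟩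
            · exact ⟨hu, hw⟩
            · exact ⟨hw, hu⟩
          simp only [if_neg (key a ha b hb), if_neg (key b hb c hc), if_neg (key a ha c hc)]
          exact hf t' hmem' a ha b hb c hc hab hbc hac)
    refine ⟨h, fun a b hab => ?_⟩
    obtain ⟨hne, hmem'⟩ := Finset.mem_erase.1 hab
    rw [← hh a b hmem', if_neg hne]

end Diagrams
end SimplicialFilling

namespace SimplicialFilling

/-! ### Peeling and cutting diagrams -/

section Labels

variable {V W : Type*} {X : AbstractSimplicialComplex V} {E E' : Finset (Sym2 W)}
  {S S' : Finset (Finset W)} {x : W} {l : List W}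

/-- A labelling of the vertices of a diagram that maps its edges and triangles into faces
of `X`. -/
structure IsLabelling (X : AbstractSimplicialComplex V) (E : Finset (Sym2 W))
    (S : Finset (Finset W)) (π : W → V) : Prop where
  edge : ∀ a b, s(a, b) ∈ E → ∃ s ∈ X.faces, π a ∈ s ∧ π b ∈ s
  triangle : ∀ t ∈ S, ∃ s ∈ X.faces, ∀ a ∈ t, π a ∈ s

lemma IsLabelling.mono {π : W → V} (h : IsLabelling X E S π) (hE : E' ⊆ E) (hS : S' ⊆ S) :
    IsLabelling X E' S' π :=
  ⟨fun a b hab => h.edge a b (hE hab), fun t ht => h.triangle t (hS ht)⟩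

/-- The label of the boundary walk of a diagram is null-homotopic across the triangles of the
diagram. -/
theorem IsDiagram.nullWalk {π : W → V} (hd : IsDiagram E S x l) (hπ : IsLabelling X E S π) :
    ∃ n ≤ S.card, NullWalk X (π x) (l.map π) n := by
  classical
  induction hN : E.card using Nat.strong_induction_on generalizing E S x l with
  | _ N ih =>
  induction l generalizing x with
  | nil => exact ⟨0, Nat.zero_le _, .nil _⟩
  | cons y l ihl =>
    by_cases hxy : x = y
    · subst hxy
      obtain ⟨n, hn, hw⟩ := ihl hd.of_stutter
      exact ⟨n, hn, .stutter hw⟩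
    have heE : s(x, y) ∈ E := hd.step_mem _ (by simp) (by simpa using hxy)
    by_cases h0 : triangleDegree S s(x, y) = 0
    · obtain ⟨l₁, l₂, h, E₁, E₂, S₁, S₂, rfl, hd₁, hd₂, hE₁, hE₂, hc₁, hc₂, hS₁, hS₂, hc, -⟩ :=
        hd.exists_bridge hxy h0
      obtain ⟨n, hn, hw⟩ := ih _ (hN ▸ hc₁) hd₁ (hπ.mono hE₁ hS₁) rfl
      obtain ⟨m, hm, hw'⟩ := ih _ (hN ▸ hc₂) hd₂ (hπ.mono hE₂ hS₂) rfl
      refine ⟨n + m, by omega, ?_⟩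
      simpa using NullWalk.bridge (hπ.edge _ _ heE) hw hw'
    · obtain ⟨z, hz, -, -, hd'⟩ := hd.exists_triangle hxy h0
      obtain ⟨n, hn, hw⟩ := ih _ (hN ▸ Finset.card_erase_lt_of_mem heE) hd'
        (hπ.mono (Finset.erase_subset _ _) (Finset.erase_subset _ _)) rfl
      rw [Finset.card_erase_of_mem hz] at hn
      have : 0 < S.card := Finset.card_pos.2 ⟨_, hz⟩
      obtain ⟨s, hs, hmem⟩ := hπ.triangle _ hz
      refine ⟨n + 1, by omega, .triangle ⟨s, hs, hmem x (by simp), hmem y (by simp),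
        hmem z (by simp)⟩ ?_⟩
      simpa using hw

/-- A simple path `x, p` through a diagram that joins two vertices of the boundary walk `α β`
cuts the diagram into two, and every triangle is used for at most one of the pieces. -/
theorem IsDiagram.cut {π : W → V} {α β p : List W} (hd : IsDiagram E S x (α ++ β))
    (hπ : IsLabelling X E S π) (hp : (x :: p).Nodup) (hpE : ∀ e ∈ steps x p, e ∈ E)
    (hend : p.getLastD x = α.getLastD x) :
    ∃ n m, n + m ≤ S.card ∧ NullWalk X (π x) ((α ++ (x :: p).reverse.tail).map π) n ∧
      NullWalk X (π (α.getLastD x)) ((β ++ p).map π) m := by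
  classical
  induction hN : E.card using Nat.strong_induction_on generalizing E S x α β p with
  | _ N ih =>
  induction α generalizing x β p with
  | nil =>
    have hp' : p = [] := by
      cases p with
      | nil => rfl
      | cons y p =>
        have h₁ := getLastD_mem_cons y p
        rw [List.getLastD_cons, List.getLastD_nil] at hend
        rw [hend] at h₁
        exact absurd h₁ (List.nodup_cons.1 hp).1
    subst hp'
    obtain ⟨n, hn, hw⟩ := hd.nullWalk hπ
    exact ⟨0, n, by omega, by simpa using NullWalk.nil _, by simpa using hw⟩
  | cons y α ihα =>
    rw [List.getLastD_cons] at hend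
    rw [List.cons_append] at hd
    by_cases hxy : x = y
    · subst hxy
      obtain ⟨n, m, hnm, hw, hw'⟩ := ihα hd.of_stutter hp hpE hend
      refine ⟨n, m, hnm, ?_, by rwa [List.getLastD_cons]⟩
      simpa using NullWalk.stutter hw
    have heE : s(x, y) ∈ E := hd.step_mem _ (by simp) (by simpa using hxy)
    by_cases hpy : ∃ p', p = y :: p'
    · -- The path and the boundary walk share their first edge, which can be stripped from both.
      obtain ⟨p, rfl⟩ := hpy
      rw [List.getLastD_cons] at hend
      have hrot : IsDiagram E S y (α ++ (β ++ [y])) := by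
        rw [← List.append_assoc]
        exact hd.rotate
      obtain ⟨n, m, hnm, hw, hw'⟩ := ihα (β := β ++ [y]) hrot (List.nodup_cons.1 hp).2
        (fun e he => hpE e (by simp [he])) hend
      refine ⟨n, m, hnm, ?_, by rw [List.getLastD_cons]; simpa [-List.getLastD_eq_getLast?] using hw'⟩
      have := NullWalk.bridge (hπ.edge _ _ heE) hw (NullWalk.nil _)
      rw [List.reverse_cons, List.tail_append_of_ne_nil (by simp)]
      simpa using this
    have havoid : ∀ e ∈ steps x p, e ≠ s(x, y) := by
      rintro e he rfl
      cases p with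
      | nil => simp at he
      | cons w p =>
        rcases List.mem_cons.1 he with he | he
        · rcases Sym2.eq_iff.1 he with ⟨-, rfl⟩ | ⟨rfl, h⟩
          · exact hpy ⟨p, rfl⟩
          · exact hxy h.symm
        · exact (List.nodup_cons.1 hp).1 (mem_walk_of_mem_steps he x (by simp))
    by_cases h0 : triangleDegree S s(x, y) = 0
    · obtain ⟨l₁, l₂, h, E₁, E₂, S₁, S₂, hl, hd₁, hd₂, hE₁, hE₂, hc₁, hc₂, hS₁, hS₂, hc, hxy',
        hcross, hconst, hmem⟩ := hd.exists_bridge hxy h0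
      have hpx : ∀ v ∈ x :: p, h v = h x := by
        refine forall_mem_walk (P := fun v => h v = h x) (fun a b hab ha => ?_) rfl
        rw [← hcross a b (hpE _ hab) (havoid _ hab), ha]
      have hside : h (α.getLastD y) = h x := by
        rw [← hend]
        exact hpx _ (getLastD_mem_cons _ _)
      rcases List.append_eq_append_iff.1 hl with ⟨γ, rfl, hβ⟩ | ⟨γ, hα, hβ⟩
      · -- The bridge is traversed backwards by `β`: then the end of `α` is on its far side.
        refine absurd ?_ hxy'
        rw [← hside]
        have := getLastD_mem_cons y α
        refine hconst _ ?_
        simp only [List.mem_cons, List.mem_append] at this ⊢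
        tauto
      · cases γ with
        | nil =>
          refine absurd ?_ hxy'
          rw [← hside, hα, List.append_nil]
          exact hconst _ (getLastD_mem_cons _ _)
        | cons w γ =>
          rw [List.cons_append] at hβ
          obtain ⟨rfl, rfl⟩ := List.cons_eq_cons.1 hβ
          subst hα
          simp only [getLastD_append, List.getLastD_cons] at hend ⊢
          have hpE₂ : ∀ e ∈ steps x p, e ∈ E₂ := by
            intro e he
            induction e using Sym2.ind with
            | _ a b => exact hmem a b (hpE _ he) (havoid _ he)
                        (hpx _ (mem_walk_of_mem_steps he a (by simp)))
          obtain ⟨n, hn, hw⟩ := hd₁.nullWalk (hπ.mono hE₁ hS₁)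
          obtain ⟨m, k, hmk, hw₂, hw₃⟩ := ih _ (hN ▸ hc₂) hd₂ (hπ.mono hE₂ hS₂) hp hpE₂ hend rfl
          refine ⟨n + m, k, by omega, ?_, hw₃⟩
          simpa using NullWalk.bridge (hπ.edge _ _ heE) hw hw₂
    · obtain ⟨z, hz, -, -, hd'⟩ := hd.exists_triangle hxy h0
      have hd' : IsDiagram (E.erase s(x, y)) (S.erase {x, y, z}) x ((z :: y :: α) ++ β) := hd'
      obtain ⟨n, m, hnm, hw, hw'⟩ := ih _ (hN ▸ Finset.card_erase_lt_of_mem heE) hd'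
        (hπ.mono (Finset.erase_subset _ _) (Finset.erase_subset _ _)) hp
        (fun e he => Finset.mem_erase.2 ⟨havoid e he, hpE e he⟩)
        (by simpa only [List.getLastD_cons] using hend) rfl
      rw [Finset.card_erase_of_mem hz] at hnm
      have : 0 < S.card := Finset.card_pos.2 ⟨_, hz⟩
      obtain ⟨s, hs, hmem⟩ := hπ.triangle _ hz
      refine ⟨n + 1, m, by omega, ?_, by simpa only [List.getLastD_cons] using hw'⟩
      have := NullWalk.triangle (X := X) (x := π x) (y := π y) (z := π z)
        (l := (α ++ (x :: p).reverse.tail).map π) (n := n)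
        ⟨s, hs, hmem x (by simp), hmem y (by simp), hmem z (by simp)⟩ (by simpa using hw)
      simpa using this

end Labels
end SimplicialFilling

namespace SimplicialFilling

/-! ### Disk diagrams -/

section Filled

variable {W : Type*}

/-- The compatibility of the colours of two consecutive corners of a boundary walk with a colouring
`g` of the directed edges: `g a b` is the colour that the edge towards `b` has in the link
of `a`. A corner has the colour of both edges that bound it. -/
def CornerRel (g : W → W → Prop) (p q : W × Prop) : Prop :=
  (p.1 = q.1 → p.2 = q.2) ∧ (p.1 ≠ q.1 → p.2 = g p.1 q.1 ∧ q.2 = g q.1 p.1)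

/-- A diagram that is a disk once a collar is attached along its boundary walk. Connectedness of
the diagram and of the links of its vertices is expressed through colourings: every colouring
that respects adjacency is constant. The link of a vertex `v` contains the neighbours of `v` and
the corners of the boundary walk at `v`. -/
structure IsFilled (E : Finset (Sym2 W)) (S : Finset (Finset W)) (x : W) (l : List W) : Prop
    extends IsDiagram E S x l where
  connected : ∀ h : W → Prop, (∀ a b, s(a, b) ∈ E → h a = h b) → ∀ a b, h a = h b
  link : ∀ (g : W → W → Prop) (k : Prop) (P : List (W × Prop)), P.map Prod.fst = l →
    List.IsChain (CornerRel g) ((x, k) :: P) → P.getLastD (x, k) = (x, k) →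
    (∀ t ∈ S, ∀ a ∈ t, ∀ b ∈ t, ∀ c ∈ t, a ≠ b → a ≠ c → b ≠ c → g a b = g a c) →
    ∃ c : W → Prop, (∀ a b, s(a, b) ∈ E → g a b = c a) ∧ ∀ q ∈ (x, k) :: P, q.2 = c q.1

variable {E : Finset (Sym2 W)} {S : Finset (Finset W)} {x y z : W} {l : List W}

lemma isFilled_point : IsFilled (∅ : Finset (Sym2 Unit)) ∅ () [] where
  not_isDiag := by simp
  card_eq_three := by simp
  edge_mem := by simp
  step_mem := by simp
  closed := rfl
  degree := by simp
  exact f _ := ⟨0, by simp⟩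
  connected h _ a b := rfl
  link g k P hP _ _ _ := by
    obtain rfl : P = [] := by simpa using hP
    exact ⟨fun _ => k, by simp, by simp⟩

lemma IsFilled.stutter (hd : IsFilled E S x l) : IsFilled E S x (x :: l) where
  not_isDiag := hd.not_isDiag
  card_eq_three := hd.card_eq_three
  edge_mem := hd.edge_mem
  step_mem e he hdiag := by
    rcases List.mem_cons.1 he with rfl | he
    · simp at hdiag
    · exact hd.step_mem e he hdiag
  closed := by rw [List.getLastD_cons, hd.closed]
  degree e he := by
    classical
    rw [stepCount_cons, if_neg]
    · exact hd.degree e he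
    · rintro rfl
      exact hd.not_isDiag _ he (by simp)
  exact := hd.exact
  connected := hd.connected
  link g k P hP hchain hlast hg := by
    obtain ⟨⟨x', k'⟩, P, rfl, rfl, rfl⟩ := List.map_eq_cons_iff.1 hP
    rw [List.isChain_cons_cons] at hchain
    obtain rfl : k = k' := hchain.1.1 rfl
    obtain ⟨c, hc, hc'⟩ := hd.link g k P rfl hchain.2 (by rwa [List.getLastD_cons] at hlast) hg
    exact ⟨c, hc, List.forall_mem_cons.2 ⟨hc' _ (by simp), hc'⟩⟩

lemma getLastD_map {α β : Type*} (f : α → β) (a : α) (l : List α) :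
    (l.map f).getLastD (f a) = f (l.getLastD a) := by
  induction l generalizing a with
  | nil => rfl
  | cons b l ih => rw [List.map_cons, List.getLastD_cons, List.getLastD_cons, ih]

lemma isChain_cons_append {α : Type*} {R : α → α → Prop} {a : α} {l l' : List α} :
    List.IsChain R (a :: (l ++ l')) ↔
      List.IsChain R (a :: l) ∧ List.IsChain R (l.getLastD a :: l') := by
  induction l generalizing a with
  | nil => simp
  | cons b l ih =>
    rw [List.cons_append, List.isChain_cons_cons, ih, List.isChain_cons_cons, List.getLastD_cons]
    tauto

lemma IsFilled.of_rotate (hd : IsFilled E S y (l ++ [y])) (hcl : l.getLastD y = x) :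
    IsFilled E S x (y :: l) where
  toIsDiagram := hd.toIsDiagram.of_rotate hcl
  connected := hd.connected
  link g k P hP hchain hlast hg := by
    obtain ⟨⟨y', k'⟩, P, rfl, rfl, rfl⟩ := List.map_eq_cons_iff.1 hP
    rw [List.getLastD_cons] at hlast
    rw [List.isChain_cons_cons] at hchain
    obtain ⟨c, hc, hc'⟩ := hd.link g k' (P ++ [(y', k')]) (by simp)
      (by
        rw [isChain_cons_append, hlast]
        exact ⟨hchain.2, by simpa using hchain.1⟩)
      (by simp only [getLastD_append, List.getLastD_cons, List.getLastD_nil]) hg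
    refine ⟨c, hc, ?_⟩
    have hmem := getLastD_mem_cons (y', k') P
    rw [hlast] at hmem
    simp only [List.mem_cons, List.mem_append] at hc' hmem ⊢
    rintro q (rfl | rfl | hq)
    · exact hc' _ (by tauto)
    · exact hc' _ (by tauto)
    · exact hc' _ (by tauto)

open Classical in
/-- A triangle can be attached to two consecutive boundary steps whose ends are not adjacent. -/
lemma IsFilled.triangle (hd : IsFilled E S x (z :: y :: l)) (hxy : x ≠ y) (hE : s(x, y) ∉ E) :
    IsFilled (insert s(x, y) E) (insert {x, y, z} S) x (y :: l) := by
  have hzx : x ≠ z := by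
    rintro rfl
    exact hE (hd.step_mem _ (by simp) (by simpa using hxy))
  have hzy : z ≠ y := by
    rintro rfl
    exact hE (hd.step_mem _ (by simp) (by simpa using hxy))
  have hxz : s(x, z) ∈ E := hd.step_mem _ (by simp) (by simpa using hzx)
  have hyz : s(z, y) ∈ E := hd.step_mem _ (by simp) (by simpa using hzy)
  have htS : ∀ t ∈ S, ¬ (x ∈ t ∧ y ∈ t) := fun t ht h' =>
    hE (hd.edge_mem t ht x h'.1 y h'.2 hxy)
  have hcount0 : stepCount y l s(x, y) = 0 := stepCount_eq_zero fun hmem =>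
    hE (hd.step_mem _ (by simp [hmem]) (by simpa using hxy))
  have hnot : ({x, y, z} : Finset W) ∉ S := fun h' => htS _ h' (by simp)
  have hdeg : ∀ e, triangleDegree (insert {x, y, z} S) e = triangleDegree S e +
      if ∀ v ∈ e, v ∈ ({x, y, z} : Finset W) then 1 else 0 := by
    intro e
    unfold triangleDegree
    rw [Finset.filter_insert]
    split_ifs with h'
    · rw [Finset.card_insert_of_notMem]
      exact fun hc => hnot (Finset.mem_filter.1 hc).1
    · simp
  refine ⟨⟨?_, ?_, ?_, ?_, ?_, ?_, ?_⟩, ?_, ?_⟩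
  · intro e he
    rcases Finset.mem_insert.1 he with rfl | he
    · simpa using hxy
    · exact hd.not_isDiag e he
  · intro t ht
    rcases Finset.mem_insert.1 ht with rfl | ht
    · exact Finset.card_eq_three.2 ⟨x, y, z, hxy, hzx, hzy.symm, rfl⟩
    · exact hd.card_eq_three t ht
  · intro t ht a ha b hb hab
    rcases Finset.mem_insert.1 ht with rfl | ht
    · simp only [Finset.mem_insert, Finset.mem_singleton] at ha hb
      have h₁ : s(z, x) ∈ E := Sym2.eq_swap ▸ hxz
      have h₂ : s(y, z) ∈ E := Sym2.eq_swap ▸ hyz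
      rcases ha with rfl | rfl | rfl <;> rcases hb with rfl | rfl | rfl <;>
        first
          | exact absurd rfl hab
          | exact Finset.mem_insert_self _ _
          | exact Finset.mem_insert.2 (Or.inl Sym2.eq_swap)
          | (refine Finset.mem_insert_of_mem ?_; assumption)
    · exact Finset.mem_insert_of_mem (hd.edge_mem t ht a ha b hb hab)
  · intro e he hdiag
    rcases List.mem_cons.1 he with rfl | he
    · exact Finset.mem_insert_self _ _
    · exact Finset.mem_insert_of_mem (hd.step_mem e (by simp [he]) hdiag)
  · simpa only [List.getLastD_cons] using hd.closed
  · intro e he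
    rw [hdeg, stepCount_cons]
    rcases Finset.mem_insert.1 he with rfl | he
    · have h0 : triangleDegree S s(x, y) = 0 := by
        rw [triangleDegree_eq_zero]
        intro t ht h'
        exact htS t ht ⟨h' x (by simp), h' y (by simp)⟩
      rw [h0, hcount0, if_pos rfl, if_pos]
      intro v hv
      rcases Sym2.mem_iff.1 hv with rfl | rfl <;> simp
    · have hne : s(x, y) ≠ e := by
        rintro rfl
        exact hE he
      have hold := hd.degree e he
      rw [stepCount_cons, stepCount_cons] at hold
      rw [if_neg hne, ← hold]
      have hdg := hd.not_isDiag e he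
      have hsum : (if ∀ v ∈ e, v ∈ ({x, y, z} : Finset W) then 1 else 0) =
          (if s(z, y) = e then 1 else 0) + if s(x, z) = e then 1 else 0 := by
        induction e using Sym2.ind with
        | _ a b =>
          have hab : a ≠ b := by simpa using hdg
          by_cases hin : ∀ v ∈ s(a, b), v ∈ ({x, y, z} : Finset W)
          · rw [if_pos hin]
            have ha := hin a (by simp)
            have hb := hin b (by simp)
            simp only [Finset.mem_insert, Finset.mem_singleton] at ha hb
            rcases ha with rfl | rfl | rfl <;> rcases hb with rfl | rfl | rfl <;>
              simp_all [eq_comm]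
          · rw [if_neg hin, if_neg, if_neg]
            · intro h'
              rw [← h'] at hin
              simp at hin
            · intro h'
              rw [← h'] at hin
              simp at hin
      rw [hsum]
      ring
  · intro f hf
    obtain ⟨h, hh⟩ := hd.exact f (fun t ht => hf t (Finset.mem_insert_of_mem ht))
    have hbd := hf _ (Finset.mem_insert_self _ _) x (by simp) y (by simp) z (by simp) hxy hzy.symm
      hzx
    have key : f s(x, y) = h x + h y := by
      have h₁ := hh x z hxz
      have h₂ := hh z y hyz
      rw [Sym2.eq_swap] at h₂
      rw [h₁, h₂] at hbd
      have : ∀ p a b c : ZMod 2, p + (c + b) + (a + c) = 0 → p = a + b := by decide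
      exact this _ _ _ _ hbd
    refine ⟨h, fun a b hab => ?_⟩
    rcases Finset.mem_insert.1 hab with heq | hab
    · rw [heq, key]
      rcases Sym2.eq_iff.1 heq with ⟨rfl, rfl⟩ | ⟨rfl, rfl⟩
      · rfl
      · rw [add_comm]
    · exact hh a b hab
  · intro h hh
    exact hd.connected h fun a b hab => hh a b (Finset.mem_insert_of_mem hab)
  · intro g k P hP hchain hlast hg
    obtain ⟨⟨y', k'⟩, P, rfl, rfl, rfl⟩ := List.map_eq_cons_iff.1 hP
    rw [List.isChain_cons_cons] at hchain
    rw [List.getLastD_cons] at hlast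
    have ht := hg _ (Finset.mem_insert_self _ _)
    have hgx : g x y' = g x z := ht x (by simp) y' (by simp) z (by simp) hxy hzx hzy.symm
    have hgy : g y' x = g y' z := ht y' (by simp) x (by simp) z (by simp) hxy.symm hzy.symm hzx
    have hgz : g z x = g z y' := ht z (by simp) x (by simp) y' (by simp) hzx.symm hzy hxy
    obtain ⟨hk, hk'⟩ := hchain.1.2 hxy
    simp only at hk hk'
    obtain ⟨c, hc, hc'⟩ := hd.link g k ((z, g z x) :: (y', k') :: P) (by simp)
      (by
        refine List.isChain_cons_cons.2 ⟨⟨fun h => absurd h hzx, fun _ => ⟨hk.trans hgx, rfl⟩⟩,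
          List.isChain_cons_cons.2 ⟨⟨fun h => absurd h hzy, fun _ => ⟨hgz, hk'.trans hgy⟩⟩,
            hchain.2⟩⟩)
      (by simpa only [List.getLastD_cons] using hlast)
      (fun t ht => hg t (Finset.mem_insert_of_mem ht))
    refine ⟨c, fun a b hab => ?_, fun q hq => hc' q ?_⟩
    · rcases Finset.mem_insert.1 hab with heq | hab
      · rcases Sym2.eq_iff.1 heq with ⟨rfl, rfl⟩ | ⟨rfl, rfl⟩
        · rw [hgx, hc _ _ hxz]
        · rw [hgy, hc _ _ (Sym2.eq_swap ▸ hyz)]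
      · exact hc a b hab
    · simp only [List.mem_cons] at hq ⊢
      tauto

end Filled
end SimplicialFilling

namespace SimplicialFilling

/-! ### Disk diagrams of null-homotopic walks -/

section Bridge

variable {W W' : Type*}

lemma steps_map (f : W → W') (x : W) (l : List W) :
    steps (f x) (l.map f) = (steps x l).map (Sym2.map f) := by
  induction l generalizing x with
  | nil => rfl
  | cons y l ih => simp only [List.map_cons, steps_cons, ih, Sym2.map_mk]

lemma stepCount_map (f : W ↪ W') (x : W) (l : List W) (e : Sym2 W) :
    stepCount (f x) (l.map f) (Sym2.map f e) = stepCount x l e := by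
  classical
  unfold stepCount
  rw [steps_map]
  exact List.count_map_of_injective _ _ (Sym2.map.injective f.injective) _

lemma triangleDegree_image [DecidableEq (Finset W')] (f : W ↪ W') (S : Finset (Finset W)) (e : Sym2 W) :
    triangleDegree (S.image (Finset.map f)) (Sym2.map f e) = triangleDegree S e := by
  classical
  unfold triangleDegree
  rw [Finset.filter_image, Finset.card_image_of_injective _ (Finset.map_injective f)]
  congr 1
  ext t
  simp [Sym2.mem_map]

lemma triangleDegree_union_left [DecidableEq (Finset W)] {S T : Finset (Finset W)} {e : Sym2 W}
    (h : triangleDegree T e = 0) : triangleDegree (S ∪ T) e = triangleDegree S e := by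
  unfold triangleDegree at *
  rw [Finset.filter_union, Finset.card_eq_zero.1 h, Finset.union_empty]

lemma exists_lift_coloring (f : W → W') {P : List (W' × Prop)} {l : List W}
    (h : P.map Prod.fst = l.map f) :
    ∃ Q : List (W × Prop), Q.map Prod.fst = l ∧ P = Q.map (Prod.map f id) := by
  induction l generalizing P with
  | nil => exact ⟨[], rfl, by simpa using h⟩
  | cons y l ih =>
    rw [List.map_cons] at h
    obtain ⟨⟨y', k⟩, P, rfl, rfl, hP⟩ := List.map_eq_cons_iff.1 h
    obtain ⟨Q, rfl, rfl⟩ := ih hP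
    exact ⟨(y, k) :: Q, rfl, rfl⟩

lemma isChain_cornerRel_map {f : W → W'} (hf : Function.Injective f) {g : W' → W' → Prop}
    {Q : List (W × Prop)} (h : List.IsChain (CornerRel g) (Q.map (Prod.map f id))) :
    List.IsChain (CornerRel fun a b => g (f a) (f b)) Q := by
  rw [List.isChain_map] at h
  refine h.imp fun p q hpq => ?_
  exact ⟨fun h' => hpq.1 (congrArg f h'), fun h' => hpq.2 fun h'' => h' (hf h'')⟩

variable {E : Finset (Sym2 W)} {S : Finset (Finset W)} {y : W} {l : List W}
  {E' : Finset (Sym2 W')} {S' : Finset (Finset W')} {x : W'} {l' : List W'}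

open Classical in
/-- The edges of the disjoint union of two diagrams, joined by a bridge. -/
noncomputable def bridgeEdges (E : Finset (Sym2 W)) (E' : Finset (Sym2 W')) (y : W) (x : W') :
    Finset (Sym2 (W ⊕ W')) :=
  insert s(Sum.inr x, Sum.inl y) (E.image (Sym2.map Sum.inl) ∪ E'.image (Sym2.map Sum.inr))

open Classical in
/-- The triangles of the disjoint union of two diagrams. -/
noncomputable def bridgeTriangles (S : Finset (Finset W)) (S' : Finset (Finset W')) :
    Finset (Finset (W ⊕ W')) :=
  S.image (Finset.map Function.Embedding.inl) ∪ S'.image (Finset.map Function.Embedding.inr)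

lemma mem_bridgeEdges {e : Sym2 (W ⊕ W')} :
    e ∈ bridgeEdges E E' y x ↔ e = s(Sum.inr x, Sum.inl y) ∨
      (∃ d ∈ E, Sym2.map Sum.inl d = e) ∨ ∃ d ∈ E', Sym2.map Sum.inr d = e := by
  simp [bridgeEdges]

lemma mem_bridgeTriangles {t : Finset (W ⊕ W')} :
    t ∈ bridgeTriangles S S' ↔ (∃ u ∈ S, Finset.map Function.Embedding.inl u = t) ∨
      ∃ u ∈ S', Finset.map Function.Embedding.inr u = t := by
  simp [bridgeTriangles]

lemma inl_mem_bridgeEdges {a b : W} :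
    s(Sum.inl a, Sum.inl b) ∈ bridgeEdges E E' y x ↔ s(a, b) ∈ E := by
  rw [mem_bridgeEdges]
  constructor
  · rintro (h | ⟨d, hd, h⟩ | ⟨d, hd, h⟩)
    · simp at h
    · rw [← Sym2.map_mk] at h
      rwa [← Sym2.map.injective Sum.inl_injective h]
    · induction d using Sym2.ind with
      | _ u v => simp at h
  · exact fun h => Or.inr (Or.inl ⟨_, h, rfl⟩)

lemma inr_mem_bridgeEdges {a b : W'} :
    s(Sum.inr a, Sum.inr b) ∈ bridgeEdges E E' y x ↔ s(a, b) ∈ E' := by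
  rw [mem_bridgeEdges]
  constructor
  · rintro (h | ⟨d, hd, h⟩ | ⟨d, hd, h⟩)
    · simp at h
    · induction d using Sym2.ind with
      | _ u v => simp at h
    · rw [← Sym2.map_mk] at h
      rwa [← Sym2.map.injective Sum.inr_injective h]
  · exact fun h => Or.inr (Or.inr ⟨_, h, rfl⟩)

lemma inl_inr_mem_bridgeEdges {a : W} {b : W'} :
    s(Sum.inl a, Sum.inr b) ∈ bridgeEdges E E' y x ↔ a = y ∧ b = x := by
  rw [mem_bridgeEdges]
  constructor
  · rintro (h | ⟨d, hd, h⟩ | ⟨d, hd, h⟩)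
    · simpa using h
    · induction d using Sym2.ind with
      | _ u v => simp at h
    · induction d using Sym2.ind with
      | _ u v => simp at h
  · rintro ⟨rfl, rfl⟩
    exact Or.inl Sym2.eq_swap

lemma inr_inl_mem_bridgeEdges {a : W} {b : W'} :
    s(Sum.inr b, Sum.inl a) ∈ bridgeEdges E E' y x ↔ a = y ∧ b = x := by
  rw [Sym2.eq_swap, inl_inr_mem_bridgeEdges]

open Classical in
lemma card_bridgeTriangles_le : (bridgeTriangles S S').card ≤ S.card + S'.card :=
  (Finset.card_union_le _ _).trans (Nat.add_le_add Finset.card_image_le Finset.card_image_le)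

lemma IsDiagram.bridge (hd : IsDiagram E S y l) (hd' : IsDiagram E' S' x l') :
    IsDiagram (bridgeEdges E E' y x) (bridgeTriangles S S') (Sum.inr x)
      (Sum.inl y :: (l.map Sum.inl ++ Sum.inr x :: l'.map Sum.inr)) := by
  classical
  have hcl : (l.map (Sum.inl (β := W'))).getLastD (Sum.inl y) = Sum.inl y := by
    rw [getLastD_map, hd.closed]
  have hcl' : (l'.map (Sum.inr (α := W))).getLastD (Sum.inr x) = Sum.inr x := by
    rw [getLastD_map, hd'.closed]
  have hinl : ∀ e : Sym2 W', stepCount (Sum.inl y) (l.map Sum.inl) (Sym2.map Sum.inr e) = 0 := by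
    intro e
    refine stepCount_eq_zero fun hmem => ?_
    rw [steps_map, List.mem_map] at hmem
    obtain ⟨d, -, hd⟩ := hmem
    induction d using Sym2.ind with
    | _ u v => induction e using Sym2.ind with
      | _ a b => simp at hd
  have hinr : ∀ e : Sym2 W, stepCount (Sum.inr x) (l'.map Sum.inr) (Sym2.map Sum.inl e) = 0 := by
    intro e
    refine stepCount_eq_zero fun hmem => ?_
    rw [steps_map, List.mem_map] at hmem
    obtain ⟨d, -, hd⟩ := hmem
    induction d using Sym2.ind with
    | _ u v => induction e using Sym2.ind with
      | _ a b => simp at hd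
  have hTinl : ∀ e : Sym2 W', triangleDegree (S.image (Finset.map Function.Embedding.inl))
      (Sym2.map Sum.inr e) = 0 := by
    intro e
    rw [triangleDegree_eq_zero]
    intro t ht h'
    obtain ⟨u, -, rfl⟩ := Finset.mem_image.1 ht
    have := h' _ (Sym2.mem_map.2 ⟨_, Sym2.out_fst_mem e, rfl⟩)
    simp at this
  have hTinr : ∀ e : Sym2 W, triangleDegree (S'.image (Finset.map Function.Embedding.inr))
      (Sym2.map Sum.inl e) = 0 := by
    intro e
    rw [triangleDegree_eq_zero]
    intro t ht h'
    obtain ⟨u, -, rfl⟩ := Finset.mem_image.1 ht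
    have := h' _ (Sym2.mem_map.2 ⟨_, Sym2.out_fst_mem e, rfl⟩)
    simp at this
  refine ⟨?_, ?_, ?_, ?_, ?_, ?_, ?_⟩
  · intro e he
    rcases mem_bridgeEdges.1 he with rfl | ⟨d, hdE, rfl⟩ | ⟨d, hdE, rfl⟩
    · simp
    · have := hd.not_isDiag d hdE
      induction d using Sym2.ind with
      | _ u v => simpa using this
    · have := hd'.not_isDiag d hdE
      induction d using Sym2.ind with
      | _ u v => simpa using this
  · intro t ht
    rcases mem_bridgeTriangles.1 ht with ⟨u, hu, rfl⟩ | ⟨u, hu, rfl⟩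
    · rw [Finset.card_map, hd.card_eq_three u hu]
    · rw [Finset.card_map, hd'.card_eq_three u hu]
  · intro t ht a ha b hb hab
    rcases mem_bridgeTriangles.1 ht with ⟨u, hu, rfl⟩ | ⟨u, hu, rfl⟩
    · obtain ⟨a, ha', rfl⟩ := Finset.mem_map.1 ha
      obtain ⟨b, hb', rfl⟩ := Finset.mem_map.1 hb
      exact inl_mem_bridgeEdges.2 (hd.edge_mem u hu a ha' b hb' fun h => hab (congrArg _ h))
    · obtain ⟨a, ha', rfl⟩ := Finset.mem_map.1 ha
      obtain ⟨b, hb', rfl⟩ := Finset.mem_map.1 hb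
      exact inr_mem_bridgeEdges.2 (hd'.edge_mem u hu a ha' b hb' fun h => hab (congrArg _ h))
  · intro e he hdiag
    rw [steps_cons, steps_append, hcl, steps_cons, steps_map, steps_map] at he
    simp only [List.mem_cons, List.mem_append, List.mem_map] at he
    rcases he with rfl | ⟨d, hdm, rfl⟩ | rfl | ⟨d, hdm, rfl⟩
    · exact mem_bridgeEdges.2 (Or.inl rfl)
    · refine mem_bridgeEdges.2 (Or.inr (Or.inl ⟨d, hd.step_mem d hdm ?_, rfl⟩))
      induction d using Sym2.ind with
      | _ u v => simpa using hdiag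
    · exact mem_bridgeEdges.2 (Or.inl Sym2.eq_swap)
    · refine mem_bridgeEdges.2 (Or.inr (Or.inr ⟨d, hd'.step_mem d hdm ?_, rfl⟩))
      induction d using Sym2.ind with
      | _ u v => simpa using hdiag
  · rw [List.getLastD_cons, getLastD_append, List.getLastD_cons, hcl']
  · intro e he
    rw [stepCount_cons, stepCount_append, hcl, stepCount_cons]
    rcases mem_bridgeEdges.1 he with rfl | ⟨d, hdE, rfl⟩ | ⟨d, hdE, rfl⟩
    · rw [if_pos rfl, if_pos Sym2.eq_swap, triangleDegree_eq_zero.2, stepCount_eq_zero,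
        stepCount_eq_zero]
      · intro hmem
        rw [steps_map, List.mem_map] at hmem
        obtain ⟨d, -, hd⟩ := hmem
        induction d using Sym2.ind with
        | _ u v => simp at hd
      · intro hmem
        rw [steps_map, List.mem_map] at hmem
        obtain ⟨d, -, hd⟩ := hmem
        induction d using Sym2.ind with
        | _ u v => simp at hd
      · intro t ht h'
        have h₁ := h' (Sum.inr x) (by simp)
        have h₂ := h' (Sum.inl y) (by simp)
        rcases mem_bridgeTriangles.1 ht with ⟨u, hu, rfl⟩ | ⟨u, hu, rfl⟩
        · simp at h₁
        · simp at h₂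
    · have h₁ : ∀ p : W ⊕ W', ∀ q : W', s(p, Sum.inr q) ≠ Sym2.map Sum.inl d := by
        intro p q h
        have : Sum.inr q ∈ Sym2.map Sum.inl d := h ▸ Sym2.mem_mk_right _ _
        simp [Sym2.mem_map] at this
      rw [if_neg (h₁ _ _), if_neg (fun h => h₁ _ _ (Sym2.eq_swap.trans h)), hinr, bridgeTriangles,
        triangleDegree_union_left (hTinr d)]
      have h₂ := triangleDegree_image (Function.Embedding.inl (β := W')) S d
      have h₃ := stepCount_map (Function.Embedding.inl (β := W')) y l d
      simp only [Function.Embedding.inl_apply] at h₂ h₃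
      rw [← hd.degree d hdE, ← h₂, ← h₃]
      rfl
    · have h₁ : ∀ p : W ⊕ W', ∀ q : W, s(p, Sum.inl q) ≠ Sym2.map Sum.inr d := by
        intro p q h
        have : Sum.inl q ∈ Sym2.map Sum.inr d := h ▸ Sym2.mem_mk_right _ _
        simp [Sym2.mem_map] at this
      rw [if_neg (h₁ _ _), if_neg (fun h => h₁ _ _ (Sym2.eq_swap.trans h)), hinl, bridgeTriangles,
        Finset.union_comm, triangleDegree_union_left (hTinl d)]
      have h₂ := triangleDegree_image (Function.Embedding.inr (α := W)) S' d
      have h₃ := stepCount_map (Function.Embedding.inr (α := W)) x l' d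
      simp only [Function.Embedding.inr_apply] at h₂ h₃
      rw [← hd'.degree d hdE, ← h₂, ← h₃, zero_add]
      rfl
  · intro f hf
    obtain ⟨h, hh⟩ := hd.exact (fun e => f (Sym2.map Sum.inl e)) (by
      intro t ht a ha b hb c hc hab hbc hac
      exact hf _ (mem_bridgeTriangles.2 (Or.inl ⟨t, ht, rfl⟩)) _ (by simpa using ha) _
        (by simpa using hb) _ (by simpa using hc) (by simpa using hab) (by simpa using hbc)
        (by simpa using hac))
    obtain ⟨h', hh'⟩ := hd'.exact (fun e => f (Sym2.map Sum.inr e)) (by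
      intro t ht a ha b hb c hc hab hbc hac
      exact hf _ (mem_bridgeTriangles.2 (Or.inr ⟨t, ht, rfl⟩)) _ (by simpa using ha) _
        (by simpa using hb) _ (by simpa using hc) (by simpa using hab) (by simpa using hbc)
        (by simpa using hac))
    -- A constant is added on one side to match the value on the bridge.
    set c := f s(Sum.inr x, Sum.inl y) + h y + h' x with hc
    have hcc : f s(Sum.inr x, Sum.inl y) = h y + c + h' x := by
      rw [hc]
      generalize f s(Sum.inr x, Sum.inl y) = p
      generalize h y = q
      generalize h' x = r
      revert p q r
      decide
    refine ⟨Sum.elim (fun a => h a + c) h', ?_⟩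
    rintro (a | a) (b | b) hab
    · have h₁ := hh a b (inl_mem_bridgeEdges.1 hab)
      simp only [Sum.elim_inl]
      rw [add_add_add_comm, CharTwo.add_self_eq_zero, add_zero, ← h₁, Sym2.map_mk]
    · obtain ⟨rfl, rfl⟩ := inl_inr_mem_bridgeEdges.1 hab
      rw [Sym2.eq_swap, hcc]
      rfl
    · obtain ⟨rfl, rfl⟩ := inr_inl_mem_bridgeEdges.1 hab
      rw [hcc, add_comm]
      rfl
    · exact hh' a b (inr_mem_bridgeEdges.1 hab)

/-- Two disjoint diagrams can be joined by a bridge between the first vertices of their boundary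
walks. -/
lemma IsFilled.bridge (hd : IsFilled E S y l) (hd' : IsFilled E' S' x l') :
    IsFilled (bridgeEdges E E' y x) (bridgeTriangles S S') (Sum.inr x)
      (Sum.inl y :: (l.map Sum.inl ++ Sum.inr x :: l'.map Sum.inr)) where
  toIsDiagram := hd.toIsDiagram.bridge hd'.toIsDiagram
  connected h hh := by
    have h₁ := hd.connected (fun a => h (Sum.inl a)) fun a b hab =>
      hh _ _ (inl_mem_bridgeEdges.2 hab)
    have h₂ := hd'.connected (fun a => h (Sum.inr a)) fun a b hab =>
      hh _ _ (inr_mem_bridgeEdges.2 hab)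
    have h₃ : h (Sum.inl y) = h (Sum.inr x) :=
      hh _ _ (inl_inr_mem_bridgeEdges.2 ⟨rfl, rfl⟩)
    have h₄ : ∀ a, h a = h (Sum.inr x) := by
      rintro (a | a)
      · exact (h₁ a y).trans h₃
      · exact h₂ a x
    exact fun a b => (h₄ a).trans (h₄ b).symm
  link g k P hP hchain hlast hg := by
    obtain ⟨⟨y', k₁⟩, P, rfl, rfl, hPP⟩ := List.map_eq_cons_iff.1 hP
    obtain ⟨P₁, P', rfl, hP₁, hP'⟩ := List.map_eq_append_iff.1 hPP
    obtain ⟨⟨x', k₂⟩, P₂, rfl, rfl, hP₂⟩ := List.map_eq_cons_iff.1 hP'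
    obtain ⟨Q₁, hQ₁, rfl⟩ := exists_lift_coloring _ hP₁
    obtain ⟨Q₂, hQ₂, rfl⟩ := exists_lift_coloring _ hP₂
    have e₁ : ∀ q : Prop, ((Sum.inl y : W ⊕ W'), q) = Prod.map Sum.inl id (y, q) := fun _ => rfl
    have e₂ : ∀ q : Prop, ((Sum.inr x : W ⊕ W'), q) = Prod.map Sum.inr id (x, q) := fun _ => rfl
    rw [List.isChain_cons_cons, isChain_cons_append, List.isChain_cons_cons] at hchain
    obtain ⟨hr, hc₁, hr', hc₂⟩ := hchain
    obtain ⟨hk, hk₁⟩ := hr.2 (by simp)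
    simp only at hk hk₁
    have hfst : (Q₁.getLastD (y, k₁)).1 = y := by
      rw [← getLastD_map Prod.fst, hQ₁]
      exact hd.closed
    rw [e₁, getLastD_map] at hr'
    obtain ⟨hk₃, hk₂⟩ := hr'.2 (by simp)
    simp only [Prod.map_fst, Prod.map_snd, id, hfst] at hk₃ hk₂
    have hlast₁ : Q₁.getLastD (y, k₁) = (y, k₁) :=
      Prod.ext hfst (hk₃.trans hk₁.symm)
    have hkk : k₂ = k := hk₂.trans hk.symm
    subst hkk
    have hlast₂ : Q₂.getLastD (x, k₂) = (x, k₂) := by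
      rw [List.getLastD_cons, getLastD_append, List.getLastD_cons, e₂, getLastD_map] at hlast
      exact (Function.Injective.prodMap Sum.inr_injective Function.injective_id) hlast
    obtain ⟨c, hc, hc'⟩ := hd.link (fun a b => g (Sum.inl a) (Sum.inl b)) k₁ Q₁ hQ₁
      (isChain_cornerRel_map Sum.inl_injective hc₁) hlast₁
      (fun t ht a ha b hb d hd' hab had hbd =>
        hg _ (mem_bridgeTriangles.2 (Or.inl ⟨t, ht, rfl⟩)) _ (by simpa using ha) _
          (by simpa using hb) _ (by simpa using hd') (by simpa using hab) (by simpa using had)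
          (by simpa using hbd))
    obtain ⟨d, hd, hd₁⟩ := hd'.link (fun a b => g (Sum.inr a) (Sum.inr b)) k₂ Q₂ hQ₂
      (isChain_cornerRel_map Sum.inr_injective hc₂) hlast₂
      (fun t ht a ha b hb d hd' hab had hbd =>
        hg _ (mem_bridgeTriangles.2 (Or.inr ⟨t, ht, rfl⟩)) _ (by simpa using ha) _
          (by simpa using hb) _ (by simpa using hd') (by simpa using hab) (by simpa using had)
          (by simpa using hbd))
    refine ⟨Sum.elim c d, ?_, ?_⟩
    · rintro (a | a) (b | b) hab
      · exact hc a b (inl_mem_bridgeEdges.1 hab)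
      · obtain ⟨rfl, rfl⟩ := inl_inr_mem_bridgeEdges.1 hab
        exact hk₁.symm.trans (hc' (_, k₁) (by simp))
      · obtain ⟨rfl, rfl⟩ := inr_inl_mem_bridgeEdges.1 hab
        exact hk.symm.trans (hd₁ (_, k₂) (by simp))
      · exact hd a b (inr_mem_bridgeEdges.1 hab)
    · intro q hq
      simp only [List.mem_cons, List.mem_append, List.mem_map] at hq hc' hd₁
      rcases hq with rfl | rfl | ⟨q, hq, rfl⟩ | rfl | ⟨q, hq, rfl⟩
      · exact hd₁ (x, k₂) (by simp)
      · exact hc' (y, k₁) (by simp)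
      · exact hc' q (by simp [hq])
      · exact hd₁ (x, k₂) (by simp)
      · exact hd₁ q (by simp [hq])

end Bridge

/-- Every null-homotopic walk bounds a disk diagram with at most the prescribed number of
triangles. If the last edge of a new triangle is already present in the diagram, then cutting
along that edge yields a smaller diagram for the required walk. -/
theorem NullWalk.exists_isFilled {V : Type*} {X : AbstractSimplicialComplex V} {x : V}
    {l : List V} {n : ℕ} (hw : NullWalk X x l n) :
    ∃ (W : Type) (_ : Finite W) (E : Finset (Sym2 W)) (S : Finset (Finset W)) (x' : W)
      (l' : List W) (π : W → V), IsFilled E S x' l' ∧ IsLabelling X E S π ∧ π x' = x ∧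
      l'.map π = l ∧ S.card ≤ n := by
  classical
  suffices H : ∀ N, ∀ {x : V} {l : List V} {n : ℕ}, NullWalk X x l n → n ≤ N →
    ∃ (W : Type) (_ : Finite W) (E : Finset (Sym2 W)) (S : Finset (Finset W)) (x' : W)
      (l' : List W) (π : W → V), IsFilled E S x' l' ∧ IsLabelling X E S π ∧ π x' = x ∧
      l'.map π = l ∧ S.card ≤ n from H n hw le_rfl
  intro N
  induction N using Nat.strong_induction_on with
  | _ N ih =>
  intro x l n hw hn
  induction hw with
  | nil x =>
    exact ⟨Unit, inferInstance, ∅, ∅, (), [], fun _ => x, isFilled_point,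
      ⟨fun a b h => absurd h (Finset.notMem_empty _), fun t h => absurd h (Finset.notMem_empty _)⟩,
      rfl, rfl, Nat.zero_le _⟩
  | stutter hw ihw =>
    obtain ⟨W, hW, E, S, x', l', π, hd, hπ, rfl, rfl, hS⟩ := ihw hn
    exact ⟨W, hW, E, S, x', x' :: l', π, hd.stutter, hπ, rfl, rfl, hS⟩
  | bridge hxy hw hw' ihw ihw' =>
    obtain ⟨W, hW, E, S, y', l', π, hd, hπ, rfl, rfl, hS⟩ := ihw (by omega)
    obtain ⟨W', hW', E', S', x', l'', π', hd', hπ', rfl, rfl, hS'⟩ := ihw' (by omega)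
    refine ⟨W ⊕ W', inferInstance, _, _, _, _, Sum.elim π π', hd.bridge hd', ⟨?_, ?_⟩, rfl, ?_,
      card_bridgeTriangles_le.trans (by omega)⟩
    · rintro (a | a) (b | b) hab
      · exact hπ.edge a b (inl_mem_bridgeEdges.1 hab)
      · obtain ⟨rfl, rfl⟩ := inl_inr_mem_bridgeEdges.1 hab
        obtain ⟨s, hs, h₁, h₂⟩ := hxy
        exact ⟨s, hs, h₂, h₁⟩
      · obtain ⟨rfl, rfl⟩ := inr_inl_mem_bridgeEdges.1 hab
        exact hxy
      · exact hπ'.edge a b (inr_mem_bridgeEdges.1 hab)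
    · intro t ht
      rcases mem_bridgeTriangles.1 ht with ⟨u, hu, rfl⟩ | ⟨u, hu, rfl⟩
      · obtain ⟨s, hs, h⟩ := hπ.triangle u hu
        refine ⟨s, hs, fun a ha => ?_⟩
        obtain ⟨a, ha', rfl⟩ := Finset.mem_map.1 ha
        exact h a ha'
      · obtain ⟨s, hs, h⟩ := hπ'.triangle u hu
        refine ⟨s, hs, fun a ha => ?_⟩
        obtain ⟨a, ha', rfl⟩ := Finset.mem_map.1 ha
        exact h a ha'
    · simp
  | @triangle x y z l n hxyz hw ihw =>
    obtain ⟨W, hW, E, S, x', l', π, hd, hπ, rfl, hl, hS⟩ := ihw (by omega)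
    obtain ⟨z', l', rfl, rfl, hl'⟩ := List.map_eq_cons_iff.1 hl
    obtain ⟨y', l', rfl, rfl, rfl⟩ := List.map_eq_cons_iff.1 hl'
    have hcl : l'.getLastD y' = x' := by
      simpa only [List.getLastD_cons] using hd.closed
    by_cases hxy : x' = y'
    · subst hxy
      obtain ⟨p, m, hpm, -, hw'⟩ := hd.toIsDiagram.cut (α := [z', x']) (β := l') (p := []) hπ
        (by simp) (by simp) rfl
      obtain ⟨W, hW, E, S, x'', l'', π', hd', hπ', hx, hl, hS'⟩ :=
        ih m (by omega) hw' le_rfl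
      refine ⟨W, hW, E, S, x'', x'' :: l'', π', hd'.stutter, hπ', ?_, ?_, by omega⟩
      · simpa using hx
      · simpa [hl] using hx
    by_cases hE : s(x', y') ∈ E
    · obtain ⟨p, m, hpm, -, hw'⟩ := hd.toIsDiagram.cut (α := [z', y']) (β := l') (p := [y']) hπ
        (by simpa using hxy) (by simpa using hE) rfl
      obtain ⟨W, hW, E, S, x'', l'', π', hd', hπ', hx, hl, hS'⟩ :=
        ih m (by omega) hw' le_rfl
      rw [List.map_append] at hl
      obtain ⟨L, L', rfl, hL, hL'⟩ := List.map_eq_append_iff.1 hl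
      obtain ⟨y'', rfl, -⟩ := List.map_eq_singleton_iff.1 hL'
      have hy : y'' = x'' := by
        simpa only [getLastD_append, List.getLastD_cons, List.getLastD_nil] using hd'.closed
      subst hy
      have hx' : π' y'' = π y' := hx
      refine ⟨W, hW, E, S, L.getLastD y'', y'' :: L, π', hd'.of_rotate rfl, hπ', ?_, ?_, by omega⟩
      · rw [← getLastD_map π', hx', hL, getLastD_map, hcl]
      · rw [List.map_cons, hx', hL]
    · refine ⟨W, hW, _, _, x', y' :: l', π, hd.triangle hxy hE, ⟨?_, ?_⟩, rfl, rfl, ?_⟩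
      · obtain ⟨s, hs, h₁, h₂, h₃⟩ := hxyz
        intro a b hab
        rcases Finset.mem_insert.1 hab with heq | hab
        · rcases Sym2.eq_iff.1 heq with ⟨rfl, rfl⟩ | ⟨rfl, rfl⟩
          · exact ⟨s, hs, h₁, h₂⟩
          · exact ⟨s, hs, h₂, h₁⟩
        · exact hπ.edge a b hab
      · obtain ⟨s, hs, h₁, h₂, h₃⟩ := hxyz
        intro t ht
        rcases Finset.mem_insert.1 ht with rfl | ht
        · exact ⟨s, hs, by simp [h₁, h₂, h₃]⟩
        · exact hπ.triangle t ht
      · exact (Finset.card_insert_le _ _).trans (by omega)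

end SimplicialFilling

namespace SimplicialFilling

/-! ### Operations on null-homotopic walks -/

section Words

variable {V : Type*} {X : AbstractSimplicialComplex V} {x y : V} {l l' : List V} {n m : ℕ}

/-- The closed walk `x, l` is null-homotopic across at most `n` triangles. -/
def NullWithin (X : AbstractSimplicialComplex V) (x : V) (l : List V) (n : ℕ) : Prop :=
  ∃ m ≤ n, NullWalk X x l m

lemma NullWalk.nullWithin (h : NullWalk X x l n) : NullWithin X x l n := ⟨n, le_rfl, h⟩

lemma NullWithin.mono (h : NullWithin X x l n) (hnm : n ≤ m) : NullWithin X x l m :=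
  h.imp fun _ hk => ⟨hk.1.trans hnm, hk.2⟩

lemma NullWalk.closed (h : NullWalk X x l n) : l.getLastD x = x := by
  induction h with
  | nil x => rfl
  | stutter _ ih => rw [List.getLastD_cons, ih]
  | bridge _ _ _ _ ih => rw [List.getLastD_cons, getLastD_append, List.getLastD_cons, ih]
  | triangle _ _ ih => simpa only [List.getLastD_cons] using ih

lemma NullWithin.closed (h : NullWithin X x l n) : l.getLastD x = x :=
  h.choose_spec.2.closed

lemma NullWithin.stutter (h : NullWithin X x l n) : NullWithin X x (x :: l) n :=
  h.imp fun _ hk => ⟨hk.1, hk.2.stutter⟩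

lemma NullWithin.bridge (hxy : ∃ s ∈ X.faces, x ∈ s ∧ y ∈ s) (h : NullWithin X y l n)
    (h' : NullWithin X x l' m) : NullWithin X x (y :: (l ++ x :: l')) (n + m) := by
  obtain ⟨k, hk, hw⟩ := h
  obtain ⟨k', hk', hw'⟩ := h'
  exact ⟨k + k', by omega, .bridge hxy hw hw'⟩

lemma NullWithin.triangle {z : V} (hxyz : ∃ s ∈ X.faces, x ∈ s ∧ y ∈ s ∧ z ∈ s)
    (h : NullWithin X x (z :: y :: l) n) : NullWithin X x (y :: l) (n + 1) := by
  obtain ⟨k, hk, hw⟩ := h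
  exact ⟨k + 1, by omega, .triangle hxyz hw⟩

lemma NullWalk.append (h : NullWalk X x l n) (h' : NullWalk X x l' m) :
    NullWalk X x (l ++ l') (n + m) := by
  induction h with
  | nil x => simpa using h'
  | stutter _ ih => exact .stutter (ih h')
  | @bridge x y l₁ l₂ n₁ n₂ hxy h₁ h₂ ih₁ ih₂ =>
    have := NullWalk.bridge hxy h₁ (ih₂ h')
    simpa [add_assoc] using this
  | @triangle x y z l n hxyz h ih =>
    have := NullWalk.triangle hxyz (ih h')
    rw [show n + 1 + m = n + m + 1 by ring]
    exact this

lemma NullWithin.append (h : NullWithin X x l n) (h' : NullWithin X x l' m) :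
    NullWithin X x (l ++ l') (n + m) := by
  obtain ⟨k, hk, hw⟩ := h
  obtain ⟨k', hk', hw'⟩ := h'
  exact ⟨k + k', by omega, hw.append hw'⟩

/-- The first vertex of a null-homotopic walk is immaterial, because a disk diagram can be taken
apart from any of its boundary steps. -/
lemma NullWithin.rotate_one (h : NullWithin X x (y :: l) n) : NullWithin X y (l ++ [y]) n := by
  obtain ⟨k, hk, hw⟩ := h
  obtain ⟨W, _, E, S, x', l', π, hd, hπ, rfl, hl, hS⟩ := hw.exists_isFilled
  obtain ⟨y', l', rfl, rfl, rfl⟩ := List.map_eq_cons_iff.1 hl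
  obtain ⟨j, hj, hw'⟩ := hd.toIsDiagram.rotate.nullWalk hπ
  exact ⟨j, by omega, by simpa using hw'⟩

lemma NullWithin.rotate (h : NullWithin X x (l ++ l') n) :
    NullWithin X (l.getLastD x) (l' ++ l) n := by
  induction l generalizing x l' with
  | nil => simpa using h
  | cons y l ih =>
    have h' : NullWithin X y (l ++ l' ++ [y]) n := h.rotate_one
    rw [List.append_assoc] at h'
    have := ih h'
    rw [List.getLastD_cons]
    simpa [-List.getLastD_eq_getLast?] using this

lemma NullWithin.of_rotate_one (h : NullWithin X y (l ++ [y]) n) (hcl : l.getLastD y = x) :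
    NullWithin X x (y :: l) n := by
  have := h.rotate
  rwa [hcl] at this

/-- A suffix `q` of a null-homotopic walk can be erased if this is possible whenever a step of `q`
closes a bridge that starts at the first step of the walk. The derivation is taken apart from the
first step, so that no other step of `q` is ever peeled. -/
lemma NullWithin.erase_suffix {q : List V}
    (hq : ∀ y l q₁ q₂ n m, q = q₁ ++ x :: q₂ → NullWalk X y (l ++ q₁) n → NullWalk X x q₂ m →
      l.getLastD y = x → NullWithin X x (y :: l) (n + m))
    (h : NullWithin X x (l ++ q) n) (hcl : l.getLastD x = x) : NullWithin X x l n := by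
  induction hN : 2 * n + l.length using Nat.strong_induction_on generalizing l n with
  | _ N ih =>
  cases l with
  | nil => exact ⟨0, Nat.zero_le _, .nil _⟩
  | cons y l =>
    rw [List.getLastD_cons] at hcl
    rw [List.length_cons] at hN
    obtain ⟨k, hk, hw⟩ := h
    rw [List.cons_append] at hw
    generalize hL : l ++ q = L at hw
    cases hw with
    | stutter hw =>
      subst hL
      exact (ih _ (by omega) ⟨k, hk, hw⟩ hcl rfl).stutter
    | @triangle _ _ z _ k hxyz hw =>
      subst hL
      have := ih (2 * k + (z :: y :: l).length) (by simp only [List.length_cons]; omega)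
        (l := z :: y :: l) ⟨k, le_rfl, by simpa using hw⟩
        (by simpa only [List.getLastD_cons] using hcl) rfl
      exact (this.triangle hxyz).mono hk
    | @bridge _ _ l₁ l₂ n₁ n₂ hxy hw₁ hw₂ =>
      rcases List.append_eq_append_iff.1 hL with ⟨γ, rfl, hβ⟩ | ⟨γ, hα, hβ⟩
      · exact (hq y l γ l₂ n₁ n₂ hβ hw₁ hw₂ hcl).mono hk
      · cases γ with
        | nil =>
          rw [List.append_nil] at hα
          subst hα
          exact (hq y l [] l₂ n₁ n₂ hβ.symm (by simpa using hw₁) hw₂ hcl).mono hk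
        | cons a γ =>
          rw [List.cons_append] at hβ
          obtain ⟨rfl, rfl⟩ := List.cons_eq_cons.1 hβ
          subst hα
          simp only [getLastD_append, List.getLastD_cons] at hcl
          rw [List.length_append, List.length_cons] at hN
          have := ih (2 * n₂ + γ.length) (by omega) hw₂.nullWithin hcl rfl
          exact (NullWithin.bridge hxy hw₁.nullWithin this).mono hk

/-- A backtrack at the end of a walk can be removed. -/
lemma NullWithin.erase_backtrack (h : NullWithin X x (l ++ [y, x]) n) (hcl : l.getLastD x = x) :
    NullWithin X x l n := by
  refine h.erase_suffix ?_ hcl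
  intro z l q₁ q₂ n m hq hw hw' hl
  rcases q₁ with _ | ⟨a, _ | ⟨b, q₁⟩⟩
  · rw [List.append_nil] at hw
    obtain rfl := hw.closed.symm.trans hl
    exact (hw.nullWithin.mono (by omega)).stutter
  · obtain rfl : a = z := by
      have := hw.closed
      simpa only [getLastD_append, List.getLastD_cons, List.getLastD_nil] using this
    exact (hw.nullWithin.mono (by omega)).of_rotate_one hl
  · simp at hq

lemma NullWithin.erase_backtrack_inside
    (h : NullWithin X x (l ++ y :: l.getLastD x :: l') n) : NullWithin X x (l ++ l') n := by
  have hcl := h.closed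
  rw [getLastD_append, List.getLastD_cons, List.getLastD_cons] at hcl
  have h₁ : NullWithin X x ((l ++ [y, l.getLastD x]) ++ l') n := by simpa using h
  have h₂ := h₁.rotate
  rw [getLastD_append, List.getLastD_cons, List.getLastD_cons, List.getLastD_nil,
    ← List.append_assoc] at h₂
  have h₃ := (h₂.erase_backtrack (by rw [getLastD_append, hcl])).rotate
  rwa [hcl] at h₃

lemma getLastD_reverse_tail (x : V) (p : List V) :
    (x :: p).reverse.tail.getLastD (p.getLastD x) = x := by
  induction p generalizing x with
  | nil => rfl
  | cons y p ih =>
    rw [List.reverse_cons, List.tail_append_of_ne_nil (by simp), getLastD_append,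
      List.getLastD_cons, List.getLastD_nil]

/-- A path that is traversed backwards and then forwards can be removed. -/
lemma NullWithin.erase_path {p : List V} (hl : l.getLastD x = p.getLastD y)
    (h : NullWithin X x (l ++ ((y :: p).reverse.tail ++ (p ++ l'))) n) :
    NullWithin X x (l ++ l') n := by
  induction p generalizing y with
  | nil => simpa using h
  | cons z p ih =>
    rw [List.getLastD_cons] at hl
    refine ih hl ?_
    rw [List.reverse_cons, List.tail_append_of_ne_nil (by simp)] at h
    have hz : (l ++ (z :: p).reverse.tail).getLastD x = z := by
      rw [getLastD_append, hl, getLastD_reverse_tail]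
    have := NullWithin.erase_backtrack_inside (x := x) (l := l ++ (z :: p).reverse.tail) (y := y)
      (l' := p ++ l') (n := n) (by rw [hz]; simpa using h)
    simpa using this

/-- Two null-homotopic walks that share a path can be glued along it. -/
theorem NullWithin.theta {α β p : List V} (hp : p.getLastD x = α.getLastD x)
    (hβ : β.getLastD (α.getLastD x) = x)
    (h : NullWithin X x (α ++ (x :: p).reverse.tail) n)
    (h' : NullWithin X (α.getLastD x) (β ++ p) m) : NullWithin X x (α ++ β) (n + m) := by
  have h₁ := h'.rotate
  rw [hβ] at h₁
  have h₂ := h.append h₁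
  rw [List.append_assoc] at h₂
  exact NullWithin.erase_path hp.symm h₂

/-- A triangle can be added across any step of a walk. -/
lemma NullWithin.triangle_inside {z : V}
    (hxyz : ∃ s ∈ X.faces, l.getLastD x ∈ s ∧ y ∈ s ∧ z ∈ s)
    (h : NullWithin X x (l ++ z :: y :: l') n) : NullWithin X x (l ++ y :: l') (n + 1) := by
  have hcl := h.closed
  rw [getLastD_append, List.getLastD_cons, List.getLastD_cons] at hcl
  have h₁ := (h.rotate.triangle (l := l' ++ l) hxyz).rotate (l := y :: l')
  rwa [List.getLastD_cons, hcl] at h₁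

/-- A derivation that uses a triangle has one across a step of the boundary walk; removing it
makes the walk longer by one step. -/
lemma NullWalk.exists_peel (h : NullWalk X x l (n + 1)) :
    ∃ u y w z, l = u ++ y :: w ∧ (∃ s ∈ X.faces, u.getLastD x ∈ s ∧ y ∈ s ∧ z ∈ s) ∧
      NullWalk X x (u ++ z :: y :: w) n := by
  generalize hk : n + 1 = k at h
  induction h generalizing n with
  | nil x => omega
  | @stutter x l k h ih =>
    obtain ⟨u, y, w, z, rfl, hf, hw⟩ := ih hk
    exact ⟨x :: u, y, w, z, rfl, by rwa [List.getLastD_cons], hw.stutter⟩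
  | @bridge x y l l' k₁ k₂ hxy h₁ h₂ ih₁ ih₂ =>
    rcases Nat.eq_zero_or_pos k₁ with h0 | hpos
    · obtain ⟨u, b, w, z, rfl, hf, hw⟩ := ih₂ (n := n) (by omega)
      refine ⟨y :: (l ++ x :: u), b, w, z, by simp, ?_, ?_⟩
      · rwa [List.getLastD_cons, getLastD_append, List.getLastD_cons]
      · have := NullWalk.bridge hxy h₁ hw
        rw [h0, zero_add] at this
        simpa using this
    · obtain ⟨j, rfl⟩ := Nat.exists_eq_succ_of_ne_zero hpos.ne'
      obtain ⟨u, b, w, z, rfl, hf, hw⟩ := ih₁ (n := j) rfl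
      refine ⟨y :: u, b, w ++ x :: l', z, by simp, by rwa [List.getLastD_cons], ?_⟩
      have := NullWalk.bridge hxy hw h₂
      rw [show n = j + k₂ by omega]
      simpa using this
  | @triangle x y z l k hxyz h ih =>
    obtain rfl : n = k := by omega
    exact ⟨[], y, l, z, rfl, hxyz, h⟩

end Words
end SimplicialFilling

namespace SimplicialFilling

/-! ### Short paths between opposite sides -/

section Rectangle

variable {W : Type*} {E : Finset (Sym2 W)} {S : Finset (Finset W)} {x : W} {l : List W}

lemma exists_split_of_mem {v : W} (h : v ∈ x :: l) :
    ∃ l₁ l₂, l = l₁ ++ l₂ ∧ l₁.getLastD x = v := by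
  induction l generalizing x with
  | nil => exact ⟨[], [], rfl, (List.mem_singleton.1 h).symm⟩
  | cons y l ih =>
    rcases List.mem_cons.1 h with rfl | h
    · exact ⟨[], y :: l, rfl, rfl⟩
    · obtain ⟨l₁, l₂, rfl, hl⟩ := ih h
      exact ⟨y :: l₁, l₂, rfl, by rwa [List.getLastD_cons]⟩

lemma IsDiagram.rotate_append {l l' : List W} (hd : IsDiagram E S x (l ++ l')) :
    IsDiagram E S (l.getLastD x) (l' ++ l) := by
  have hcl := hd.closed
  rw [getLastD_append] at hcl
  refine hd.of_perm ?_ ?_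
  · rw [steps_append, steps_append, hcl]
    exact List.perm_append_comm
  · rw [getLastD_append, hcl]

/-- The graph of the edges of a diagram. -/
def edgeGraph (E : Finset (Sym2 W)) : SimpleGraph W := SimpleGraph.fromEdgeSet (E : Set (Sym2 W))

lemma edgeGraph_adj {a b : W} : (edgeGraph E).Adj a b ↔ s(a, b) ∈ E ∧ a ≠ b := by
  simp [edgeGraph]

lemma exists_list_of_walk {u v : W} (w : (edgeGraph E).Walk u v) :
    ∃ p : List W, (u :: p).Nodup ∧ (∀ e ∈ steps u p, e ∈ E) ∧ p.getLastD u = v ∧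
      p.length ≤ w.length := by
  classical
  have hlist : ∀ {u v : W} (w : (edgeGraph E).Walk u v), ∃ p : List W, w.support = u :: p ∧
      (∀ e ∈ steps u p, e ∈ E) ∧ p.getLastD u = v ∧ p.length = w.length := by
    intro u v w
    induction w with
    | nil => exact ⟨[], rfl, by simp, rfl, rfl⟩
    | @cons u y v h w ih =>
      obtain ⟨p, hp, hE, hv, hlen⟩ := ih
      refine ⟨y :: p, by rw [SimpleGraph.Walk.support_cons, hp], ?_, by rwa [List.getLastD_cons],
        by rw [List.length_cons, SimpleGraph.Walk.length_cons, hlen]⟩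
      intro e he
      rcases List.mem_cons.1 he with rfl | he
      · exact (edgeGraph_adj.1 h).1
      · exact hE e he
  obtain ⟨p, hp, hE, hv, hlen⟩ := hlist w.bypass
  exact ⟨p, hp ▸ w.bypass_isPath.support_nodup, hE, hv, hlen ▸ w.length_bypass_le_length⟩

/-- The vertices at distance at most `k` from the set `A`. -/
def ballAround (E : Finset (Sym2 W)) (A : Set W) (k : ℕ) : Set W :=
  {v | ∃ u ∈ A, ∃ w : (edgeGraph E).Walk u v, w.length ≤ k}

lemma ballAround_mono {A : Set W} {j k : ℕ} (h : j ≤ k) : ballAround E A j ⊆ ballAround E A k := by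
  rintro v ⟨u, hu, w, hw⟩
  exact ⟨u, hu, w, hw.trans h⟩

lemma subset_ballAround {A : Set W} {k : ℕ} : A ⊆ ballAround E A k :=
  fun u hu => ⟨u, hu, .nil, by simp⟩

lemma IsDiagram.mem_ballAround_succ (hd : IsDiagram E S x l) {A : Set W} {j k : ℕ} (hjk : j < k)
    {t : Finset W} (ht : t ∈ S) {a b : W} (ha : a ∈ t) (hb : b ∈ t) (h : a ∈ ballAround E A j) :
    b ∈ ballAround E A k := by
  by_cases hab : a = b
  · exact ballAround_mono hjk.le (hab ▸ h)
  · obtain ⟨u, hu, w, hw⟩ := h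
    refine ⟨u, hu, w.concat (edgeGraph_adj.2 ⟨hd.edge_mem t ht a ha b hb hab, hab⟩), ?_⟩
    rw [SimpleGraph.Walk.length_concat]
    omega

lemma sum_steps_eq (ω : Sym2 W → ZMod 2) (h : W → ZMod 2)
    (hω : ∀ a b, s(a, b) ∈ steps x l → ω s(a, b) = h a + h b) :
    ((steps x l).map ω).sum = h x + h (l.getLastD x) := by
  induction l generalizing x with
  | nil => simp [CharTwo.add_self_eq_zero]
  | cons y l ih =>
    rw [steps_cons, List.map_cons, List.sum_cons, hω x y (by simp),
      ih fun a b hab => hω a b (by simp [hab]), List.getLastD_cons]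
    have hchar : ∀ a b c : ZMod 2, a + b + (b + c) = a + c := by decide
    exact hchar _ _ _

open Classical in
/-- A combinatorial form of Besicovitch's inequality: if the boundary walk of a diagram with fewer
than `d * d` triangles is divided into four sides, then two opposite sides have distance less
than `d`. For `j, k < d`, consider the edges that leave the `k`-ball around the first side from a
vertex of the `j`-ball around the second side. If opposite sides are far apart, then the boundary
walk contains an odd number of them, so they do not form a cocycle, and there is a triangle on
which they vary. Such a triangle determines `j` and `k`. -/
theorem IsDiagram.exists_short_walk {l₁ l₂ l₃ l₄ : List W} {x₂ x₃ x₄ : W} {d : ℕ}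
    (hd : IsDiagram E S x (l₁ ++ (l₂ ++ (l₃ ++ l₄)))) (h₂ : l₁.getLastD x = x₂)
    (h₃ : l₂.getLastD x₂ = x₃) (h₄ : l₃.getLastD x₃ = x₄) (hS : S.card < d * d) :
    (∃ u ∈ x :: l₁, ∃ v ∈ x₃ :: l₃, ∃ w : (edgeGraph E).Walk u v, w.length < d) ∨
      ∃ u ∈ x₂ :: l₂, ∃ v ∈ x₄ :: l₄, ∃ w : (edgeGraph E).Walk u v, w.length < d := by
  by_contra! hcon
  obtain ⟨hfar, hfar'⟩ := hcon
  set B := ballAround E {u | u ∈ x :: l₁} with hB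
  set C := ballAround E {u | u ∈ x₂ :: l₂} with hC
  have hB₃ : ∀ k < d, ∀ v ∈ x₃ :: l₃, v ∉ B k := by
    rintro k hk v hv ⟨u, hu, w, hw⟩
    have := hfar u hu v hv w
    omega
  have hC₄ : ∀ j < d, ∀ v ∈ x₄ :: l₄, v ∉ C j := by
    rintro k hk v hv ⟨u, hu, w, hw⟩
    have := hfar' u hu v hv w
    omega
  have key : ∀ q ∈ Finset.range d ×ˢ Finset.range d, ∃ t ∈ S, (∃ a ∈ t, a ∈ B q.1 ∧ a ∈ C q.2) ∧
      (∃ a ∈ t, a ∉ C q.2) ∧ ∃ a ∈ t, a ∉ B q.1 := by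
    rintro ⟨k, j⟩ hq
    simp only [Finset.mem_product, Finset.mem_range] at hq ⊢
    obtain ⟨hk, hj⟩ := hq
    set ω : Sym2 W → ZMod 2 := fun e =>
      if (∃ u ∈ e, u ∈ B k ∧ u ∈ C j) ∧ ∃ v ∈ e, v ∉ B k then 1 else 0 with hω
    have hωab : ∀ a b, ω s(a, b) =
        if (a ∈ B k ∧ a ∈ C j ∧ b ∉ B k) ∨ (b ∈ B k ∧ b ∈ C j ∧ a ∉ B k) then 1 else 0 := by
      intro a b
      rw [hω]
      refine if_congr ?_ rfl rfl
      simp only [Sym2.mem_iff]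
      constructor
      · rintro ⟨⟨u, rfl | rfl, h⟩, v, rfl | rfl, h'⟩ <;> tauto
      · rintro (h | h)
        · exact ⟨⟨a, by simp, h.1, h.2.1⟩, b, by simp, h.2.2⟩
        · exact ⟨⟨b, by simp, h.1, h.2.1⟩, a, by simp, h.2.2⟩
    by_contra! hno
    have hcoc : IsCocycle S ω := by
      intro t ht a ha b hb c hc hab hbc hac
      have h₁ := hno t ht
      rw [hωab, hωab, hωab]
      have hall : (∃ v ∈ t, v ∈ B k ∧ v ∈ C j) → (∃ v ∈ t, v ∉ C j) → ∀ v ∈ t, v ∈ B k := by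
        rintro ⟨v, hv, hv'⟩ ⟨u, hu, hu'⟩
        exact h₁ ⟨v, hv, hv'⟩ ⟨u, hu, hu'⟩
      by_cases h1 : ∃ v ∈ t, v ∈ B k ∧ v ∈ C j
      · by_cases h2 : ∃ v ∈ t, v ∉ C j
        · have h3 := hall h1 h2
          simp [h3 a ha, h3 b hb, h3 c hc]
        · push Not at h2
          simp only [h2 a ha, h2 b hb, h2 c hc, true_and]
          by_cases ha' : a ∈ B k <;> by_cases hb' : b ∈ B k <;> by_cases hc' : c ∈ B k <;>
            simp [ha', hb', hc'] <;> rfl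
      · push Not at h1
        rw [if_neg, if_neg, if_neg]
        · rfl
        · rintro (h | h)
          · exact h1 a ha h.1 h.2.1
          · exact h1 c hc h.1 h.2.1
        · rintro (h | h)
          · exact h1 b hb h.1 h.2.1
          · exact h1 c hc h.1 h.2.1
        · rintro (h | h)
          · exact h1 a ha h.1 h.2.1
          · exact h1 b hb h.1 h.2.1
    -- The sum of `ω` over the boundary walk is zero, but the second side contributes one, because it
    -- leaves the ball around the first side, and the other sides contribute nothing.
    obtain ⟨h, hh⟩ := hd.exact ω hcoc
    have hdiag : ∀ a, ω s(a, a) = 0 := by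
      intro a
      rw [hωab, if_neg]
      tauto
    have htot : ((steps x (l₁ ++ (l₂ ++ (l₃ ++ l₄)))).map ω).sum = 0 := by
      rw [sum_steps_eq ω h, hd.closed, CharTwo.add_self_eq_zero]
      intro a b hab
      by_cases hab' : a = b
      · rw [hab', hdiag, CharTwo.add_self_eq_zero]
      · exact hh a b (hd.step_mem _ hab (by simpa using hab'))
    have hzero : ∀ z m, (∀ a b, s(a, b) ∈ steps z m → ω s(a, b) = 0) →
        ((steps z m).map ω).sum = 0 := by
      intro z m hz
      rw [sum_steps_eq ω 0]
      · simp
      · intro a b hab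
        simpa using hz a b hab
    rw [steps_append, steps_append, steps_append, h₂, h₃, h₄, List.map_append, List.map_append,
      List.map_append, List.sum_append, List.sum_append, List.sum_append, hzero x l₁, hzero x₃ l₃,
      hzero x₄ l₄, sum_steps_eq ω (fun v => if v ∈ B k then 1 else 0), h₃] at htot
    · have h5 : x₂ ∈ B k := subset_ballAround (h₂ ▸ getLastD_mem_cons x l₁)
      have h6 : x₃ ∉ B k := hB₃ k hk _ (by simp)
      simp [h5, h6] at htot
    · intro a b hab
      have ha : a ∈ C j := subset_ballAround (mem_walk_of_mem_steps hab a (by simp))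
      have hb : b ∈ C j := subset_ballAround (mem_walk_of_mem_steps hab b (by simp))
      rw [hωab]
      by_cases ha' : a ∈ B k <;> by_cases hb' : b ∈ B k <;> simp [ha, hb, ha', hb']
      rfl
    · intro a b hab
      rw [hωab, if_neg]
      have ha := hC₄ j hj a (mem_walk_of_mem_steps hab a (by simp))
      have hb := hC₄ j hj b (mem_walk_of_mem_steps hab b (by simp))
      tauto
    · intro a b hab
      rw [hωab, if_neg]
      have ha := hB₃ k hk a (mem_walk_of_mem_steps hab a (by simp))
      have hb := hB₃ k hk b (mem_walk_of_mem_steps hab b (by simp))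
      tauto
    · intro a b hab
      rw [hωab, if_neg]
      have ha : a ∈ B k := subset_ballAround (mem_walk_of_mem_steps hab a (by simp))
      have hb : b ∈ B k := subset_ballAround (mem_walk_of_mem_steps hab b (by simp))
      tauto
  choose! T hTS hTa hTC hTB using key
  refine absurd hS (not_lt.2 ?_)
  have hcard : (Finset.range d ×ˢ Finset.range d).card = d * d := by simp
  rw [← hcard]
  refine Finset.card_le_card_of_injOn T (fun q hq => hTS q hq) ?_
  intro q hq q' hq' heq
  rw [Finset.mem_coe] at hq hq'
  have hle : ∀ q ∈ Finset.range d ×ˢ Finset.range d, ∀ q' ∈ Finset.range d ×ˢ Finset.range d,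
      T q = T q' → q'.1 ≤ q.1 ∧ q'.2 ≤ q.2 := by
    intro q hq q' hq' heq
    obtain ⟨a, ha, haB, haC⟩ := hTa q hq
    obtain ⟨b, hb, hbC⟩ := hTC q' hq'
    obtain ⟨c, hc, hcB⟩ := hTB q' hq'
    rw [← heq] at hb hc
    constructor
    · by_contra! hlt
      exact hcB (hd.mem_ballAround_succ hlt (hTS q hq) ha hc haB)
    · by_contra! hlt
      exact hbC (hd.mem_ballAround_succ hlt (hTS q hq) ha hb haC)
  exact Prod.ext (le_antisymm (hle q' hq' q hq heq.symm).1 (hle q hq q' hq' heq).1)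
    (le_antisymm (hle q' hq' q hq heq.symm).2 (hle q hq q' hq' heq).2)

end Rectangle

section ShortCut

variable {V : Type*} {X : AbstractSimplicialComplex V} {x : V} {n : ℕ}

/-- The closed walk `x, l` can be cut by a path of length less than `d`: up to rotation it is a
product `α β`, and the path `p` closes both `α` and `β`, which have length at least `s`, to
null-homotopic walks that share `n` triangles. -/
def HasShortCut (X : AbstractSimplicialComplex V) (x : V) (l : List V) (n s d : ℕ) : Prop :=
  ∃ (u : V) (α β p : List V) (a b : ℕ), (∀ m, NullWithin X u (α ++ β) m → NullWithin X x l m) ∧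
    α.length + β.length = l.length ∧ s ≤ α.length ∧ s ≤ β.length ∧ p.length < d ∧
    p.getLastD u = α.getLastD u ∧ β.getLastD (α.getLastD u) = u ∧ a + b ≤ n ∧
    NullWithin X u (α ++ (u :: p).reverse.tail) a ∧
    NullWithin X (α.getLastD u) (β ++ p) b

/-- A null-homotopic walk whose boundary has four sides of length at least `s` can be cut by a path
between opposite sides: each piece contains one of the other two sides. -/
theorem NullWalk.hasShortCut {l l₁ l₂ l₃ l₄ : List V} {s d : ℕ} (hw : NullWalk X x l n)
    (hl : l = l₁ ++ (l₂ ++ (l₃ ++ l₄))) (hs₁ : s ≤ l₁.length) (hs₂ : s ≤ l₂.length)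
    (hs₃ : s ≤ l₃.length) (hs₄ : s ≤ l₄.length) (hn : n < d * d) : HasShortCut X x l n s d := by
  obtain ⟨W, _, E, S, x', l', π, hd, hπ, rfl, rfl, hS⟩ := hw.exists_isFilled
  obtain ⟨m₁, m', rfl, rfl, hl'⟩ := List.map_eq_append_iff.1 hl
  obtain ⟨m₂, m', rfl, rfl, hl''⟩ := List.map_eq_append_iff.1 hl'
  obtain ⟨m₃, m₄, rfl, rfl, rfl⟩ := List.map_eq_append_iff.1 hl''
  simp only [List.length_map] at hs₁ hs₂ hs₃ hs₄
  have hcl := hd.closed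
  have main : ∀ (γ δ α β : List W) (u v : W) (w : (edgeGraph E).Walk u v),
      γ.getLastD x' = u → m₁ ++ (m₂ ++ (m₃ ++ m₄)) = γ ++ δ → δ ++ γ = α ++ β → α.getLastD u = v →
      w.length < d → s ≤ α.length → s ≤ β.length →
      HasShortCut X (π x') ((m₁ ++ (m₂ ++ (m₃ ++ m₄))).map π) n s d := by
    rintro γ δ α β u v w rfl h₁ h₂ hv hwd hα hβ
    rw [h₁] at hd
    have hrot := hd.toIsDiagram.rotate_append
    rw [h₂] at hrot
    obtain ⟨p, hp, hpE, hpv, hplen⟩ := exists_list_of_walk w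
    obtain ⟨a, b, hab, ha, hb⟩ := hrot.cut hπ hp hpE (hpv.trans hv.symm)
    refine ⟨π (γ.getLastD x'), α.map π, β.map π, p.map π, a, b, ?_, ?_, by simpa using hα,
      by simpa using hβ, by rw [List.length_map]; omega, ?_, ?_, by omega, ?_, ?_⟩
    · intro m hm
      rw [← List.map_append, ← h₂, List.map_append] at hm
      have h₃ := hm.rotate
      have h₄ : δ.getLastD (γ.getLastD x') = x' := by
        rw [← getLastD_append]
        exact hd.closed
      rw [getLastD_map, h₄, ← List.map_append] at h₃
      rwa [h₁]
    · have h₃ := congrArg List.length h₁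
      have h₄ := congrArg List.length h₂
      simp only [List.length_append, List.length_map] at h₃ h₄ ⊢
      omega
    · rw [getLastD_map, getLastD_map, hpv, hv]
    · rw [getLastD_map, getLastD_map, ← getLastD_append, hrot.closed]
    · simpa using ha.nullWithin
    · rw [getLastD_map]
      simpa using hb.nullWithin
  rcases hd.toIsDiagram.exists_short_walk rfl rfl rfl (hS.trans_lt hn) with
    ⟨u, hu, v, hv, w, hwd⟩ | ⟨u, hu, v, hv, w, hwd⟩
  · obtain ⟨p₁, q₁, rfl, rfl⟩ := exists_split_of_mem hu
    obtain ⟨p₃, q₃, rfl, rfl⟩ := exists_split_of_mem hv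
    simp only [List.length_append] at hs₁ hs₃
    refine main p₁ (q₁ ++ (m₂ ++ ((p₃ ++ q₃) ++ m₄))) (q₁ ++ (m₂ ++ p₃)) (q₃ ++ (m₄ ++ p₁)) _ _ w
      rfl (by simp) (by simp) (by simp only [getLastD_append]) hwd ?_ ?_
    · simp only [List.length_append]
      omega
    · simp only [List.length_append]
      omega
  · obtain ⟨p₂, q₂, rfl, rfl⟩ := exists_split_of_mem hu
    obtain ⟨p₄, q₄, rfl, rfl⟩ := exists_split_of_mem hv
    simp only [List.length_append] at hs₂ hs₄
    refine main (m₁ ++ p₂) (q₂ ++ (m₃ ++ (p₄ ++ q₄))) (q₂ ++ (m₃ ++ p₄)) (q₄ ++ (m₁ ++ p₂)) _ _ w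
      (getLastD_append _ _ _) (by simp) (by simp) (by simp only [getLastD_append]) hwd ?_ ?_
    · simp only [List.length_append]
      omega
    · simp only [List.length_append]
      omega

end ShortCut
end SimplicialFilling

namespace SimplicialFilling

/-! ### Euler characteristic and cohomology modulo two -/

section Cohomology

variable {W : Type*} {K : AbstractSimplicialComplex W}

/-- The first cohomology of `K` with coefficients in the field of two elements vanishes: a function
on edges whose sum over the boundary of every triangle vanishes is a coboundary. -/
def IsExact (K : AbstractSimplicialComplex W) : Prop :=
  ∀ f : Sym2 W → ZMod 2, (∀ t ∈ facesOfDim K 2, ∀ a ∈ t, ∀ b ∈ t, ∀ c ∈ t, a ≠ b → b ≠ c → a ≠ c →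
    f s(a, b) + f s(b, c) + f s(a, c) = 0) →
    ∃ h : W → ZMod 2, ∀ a b, (oneSkeleton K).Adj a b → f s(a, b) = h a + h b

open Classical in
/-- The incidence matrix of triangles and edges. -/
noncomputable def triangleEdge (K : AbstractSimplicialComplex W) :
    Matrix (facesOfDim K 2) (oneSkeleton K).edgeSet (ZMod 2) :=
  fun t e => if ∀ v ∈ (e : Sym2 W), v ∈ (t : Finset W) then 1 else 0

open Classical in
/-- The incidence matrix of edges and vertices. -/
noncomputable def edgeVertex (K : AbstractSimplicialComplex W) :
    Matrix (oneSkeleton K).edgeSet W (ZMod 2) :=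
  fun e v => if v ∈ (e : Sym2 W) then 1 else 0

lemma facesOfDim_zero : facesOfDim K 0 = Set.range fun v => ({v} : Finset W) := by
  ext s
  constructor
  · rintro ⟨-, h⟩
    obtain ⟨v, rfl⟩ := Finset.card_eq_one.1 h
    exact ⟨v, rfl⟩
  · rintro ⟨v, rfl⟩
    exact ⟨K.singleton_mem v, by simp⟩

lemma faceCount_zero : faceCount K 0 = Nat.card W := by
  rw [faceCount, facesOfDim_zero, ← Nat.card_coe_set_eq,
    Nat.card_range_of_injective (fun a b h => by simpa using h)]

lemma mem_facesOfDim_one [DecidableEq W] {a b : W} :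
    ({a, b} : Finset W) ∈ facesOfDim K 1 ↔ (oneSkeleton K).Adj a b := by
  constructor
  · rintro ⟨h, hc⟩
    refine ⟨?_, _, h, by simp, by simp⟩
    rintro rfl
    simp at hc
  · rintro ⟨hne, s, hs, ha, hb⟩
    refine ⟨(K.isRelLowerSet_faces hs).2 ?_ (by simp), Finset.card_pair hne⟩
    intro v hv
    rcases Finset.mem_insert.1 hv with rfl | hv
    · exact ha
    · rwa [Finset.mem_singleton.1 hv]

lemma faceCount_one : faceCount K 1 = Nat.card (oneSkeleton K).edgeSet := by
  classical
  have : facesOfDim K 1 = Sym2.toFinset '' (oneSkeleton K).edgeSet := by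
    ext s
    constructor
    · rintro hs
      obtain ⟨a, b, -, rfl⟩ := Finset.card_eq_two.1 hs.2
      refine ⟨s(a, b), mem_facesOfDim_one.1 hs, ?_⟩
      ext v; simp
    · rintro ⟨e, he, rfl⟩
      induction e with | _ a b
      have : (s(a, b) : Sym2 W).toFinset = {a, b} := by ext v; simp
      rw [this, mem_facesOfDim_one]
      exact he
  rw [faceCount, this, ← Nat.card_coe_set_eq, Nat.card_image_of_injective]
  intro e e' h
  refine Sym2.ext fun v => ?_
  rw [← Sym2.mem_toFinset, ← Sym2.mem_toFinset, h]

/-- The coboundary of a function on vertices, evaluated on an edge. -/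
lemma edgeVertex_mulVec [Fintype W] (h : W → ZMod 2) {a b : W}
    (hab : s(a, b) ∈ (oneSkeleton K).edgeSet) :
    (edgeVertex K).mulVec h ⟨s(a, b), hab⟩ = h a + h b := by
  classical
  have hne : a ≠ b := (show (oneSkeleton K).Adj a b from hab).1
  simp only [Matrix.mulVec, dotProduct, edgeVertex, ite_mul, one_mul, zero_mul]
  rw [← Finset.sum_filter]
  have : (Finset.univ.filter fun v => v ∈ s(a, b)) = {a, b} := by ext v; simp
  rw [this, Finset.sum_pair hne]

lemma adj_of_mem_face {s : Finset W} (hs : s ∈ K.faces) {a b : W} (ha : a ∈ s) (hb : b ∈ s)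
    (hab : a ≠ b) : (oneSkeleton K).Adj a b := ⟨hab, s, hs, ha, hb⟩

/-- The coboundary of a function on edges, evaluated on a triangle. -/
lemma triangleEdge_mulVec [Fintype (oneSkeleton K).edgeSet] (f : Sym2 W → ZMod 2)
    (t : facesOfDim K 2) {a b c : W} (ha : a ∈ t.1) (hb : b ∈ t.1) (hc : c ∈ t.1)
    (hab : a ≠ b) (hbc : b ≠ c) (hac : a ≠ c) :
    (triangleEdge K).mulVec (fun e => f e) t = f s(a, b) + f s(b, c) + f s(a, c) := by
  classical
  have htf := t.2.1
  have ht : t.1 = {a, b, c} := by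
    refine (Finset.eq_of_subset_of_card_le (fun v hv => ?_) ?_).symm
    · simp only [Finset.mem_insert, Finset.mem_singleton] at hv
      rcases hv with rfl | rfl | rfl <;> assumption
    · rw [t.2.2, Finset.card_eq_three.2 ⟨a, b, c, hab, hac, hbc, rfl⟩]
  simp only [Matrix.mulVec, dotProduct, triangleEdge, ite_mul, one_mul, zero_mul]
  rw [← Finset.sum_filter]
  have : (Finset.univ.filter fun e : (oneSkeleton K).edgeSet => ∀ v ∈ e.1, v ∈ t.1) =
      {⟨s(a, b), adj_of_mem_face htf ha hb hab⟩, ⟨s(b, c), adj_of_mem_face htf hb hc hbc⟩,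
        ⟨s(a, c), adj_of_mem_face htf ha hc hac⟩} := by
    ext ⟨e, he⟩
    induction e with | _ u w
    have hne : u ≠ w := (show (oneSkeleton K).Adj u w from he).1
    simp only [Finset.mem_filter, Finset.mem_univ, true_and, Sym2.mem_iff, forall_eq_or_imp,
      forall_eq, ht, Finset.mem_insert, Finset.mem_singleton, Subtype.ext_iff, Sym2.eq_iff]
    constructor
    · grind
    · rintro ((⟨h, h'⟩ | ⟨h, h'⟩) | (⟨h, h'⟩ | ⟨h, h'⟩) | (⟨h, h'⟩ | ⟨h, h'⟩)) <;> simp [h, h']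
  rw [this, Finset.sum_insert, Finset.sum_pair, add_assoc]
  · simp only [ne_eq, Subtype.ext_iff, Sym2.eq_iff]; grind
  · simp only [Finset.mem_insert, Finset.mem_singleton, Subtype.ext_iff, Sym2.eq_iff]; grind

/-- A function on the triangles whose sum vanishes over the triangles at every edge is zero: it is
constant near every vertex, hence constant, and it vanishes at the boundary. -/
lemma triangleEdge_transpose_injective [Fintype (facesOfDim K 2)]
    (hconn : (oneSkeleton K).Connected)
    (hedge : ∀ e ∈ facesOfDim K 1, (trianglesAt K e).ncard = 1 ∨ (trianglesAt K e).ncard = 2)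
    (hlink : ∀ v x y : W, (oneSkeleton K).Adj v x → (oneSkeleton K).Adj v y →
      (linkGraph K v).Reachable x y)
    (hbdry : (boundaryEdges K).Nonempty) (c : facesOfDim K 2 → ZMod 2)
    (hc : (triangleEdge K).transpose.mulVec c = 0) : c = 0 := by
  classical
  have hsum : ∀ a b, (oneSkeleton K).Adj a b →
      ∑ t ∈ Finset.univ.filter (fun t : facesOfDim K 2 => a ∈ t.1 ∧ b ∈ t.1), c t = 0 := by
    intro a b hab
    have := congrFun hc ⟨s(a, b), hab⟩
    simp only [Matrix.mulVec, dotProduct, triangleEdge, Matrix.transpose_apply, ite_mul, one_mul,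
      zero_mul, Sym2.mem_iff, forall_eq_or_imp, forall_eq, Pi.zero_apply] at this
    rwa [← Finset.sum_filter] at this
  have hat : ∀ a b, trianglesAt K {a, b} = ((Finset.univ.filter
      (fun t : facesOfDim K 2 => a ∈ t.1 ∧ b ∈ t.1)).map (Function.Embedding.subtype _) : Finset _) := by
    intro a b
    ext t
    simp only [trianglesAt, Set.mem_ofPred_eq, Finset.insert_subset_iff, Finset.singleton_subset_iff,
      Finset.coe_map, Finset.coe_filter, Finset.mem_univ, true_and, Set.mem_image,
      Function.Embedding.subtype_apply, Subtype.exists, exists_and_right, exists_eq_right]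
    tauto
  have hcard : ∀ a b, (trianglesAt K {a, b}).ncard = (Finset.univ.filter
      (fun t : facesOfDim K 2 => a ∈ t.1 ∧ b ∈ t.1)).card := by
    intro a b
    rw [hat, Set.ncard_coe_finset, Finset.card_map]
  -- Two triangles with a common edge have the same value.
  have hshare : ∀ a b, (oneSkeleton K).Adj a b → ∀ t t' : facesOfDim K 2,
      a ∈ t.1 → b ∈ t.1 → a ∈ t'.1 → b ∈ t'.1 → c t = 0 → c t' = 0 := by
    intro a b hab t t' hat hbt hat' hbt' h0
    by_cases htt : t = t'
    · rwa [← htt]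
    have hs := hsum a b hab
    have h2 : Finset.univ.filter (fun t : facesOfDim K 2 => a ∈ t.1 ∧ b ∈ t.1) = {t, t'} := by
      refine (Finset.eq_of_subset_of_card_le (fun u hu => ?_) ?_).symm
      · simp only [Finset.mem_insert, Finset.mem_singleton] at hu
        rcases hu with rfl | rfl <;> simp [*]
      · rw [Finset.card_pair htt, ← hcard]
        rcases hedge _ (mem_facesOfDim_one.2 hab) with h | h <;> omega
    rw [h2, Finset.sum_pair htt, h0, zero_add] at hs
    exact hs
  let P : W → W → Prop := fun a b => ∃ t : facesOfDim K 2, a ∈ t.1 ∧ b ∈ t.1 ∧ c t = 0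
  have hP : ∀ a b, (oneSkeleton K).Adj a b → P a b → ∀ t : facesOfDim K 2, a ∈ t.1 → b ∈ t.1 →
      c t = 0 := fun a b hab ⟨t, ha, hb, h0⟩ t' ha' hb' => hshare a b hab t t' ha hb ha' hb' h0
  -- The value zero spreads through the link of a vertex, which is connected.
  have hturn : ∀ v x y, (oneSkeleton K).Adj v x → (linkGraph K v).Reachable x y → P v x → P v y := by
    rintro v x y hvx ⟨w⟩ hx
    induction w with
    | nil => exact hx
    | cons hadj _ ih =>
      rename_i x y _ _
      obtain ⟨hxy, hxv, hyv, s, hs, hv, hxs, hys⟩ := hadj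
      have hface : ({v, x, y} : Finset W) ∈ facesOfDim K 2 := by
        refine ⟨(K.isRelLowerSet_faces hs).2 ?_ (by simp), ?_⟩
        · intro u hu
          simp only [Finset.mem_insert, Finset.mem_singleton] at hu
          rcases hu with rfl | rfl | rfl <;> assumption
        · exact Finset.card_eq_three.2 ⟨v, x, y, hxv.symm, hyv.symm, hxy, rfl⟩
      exact ih ⟨hyv.symm, s, hs, hv, hys⟩ ⟨⟨_, hface⟩, by simp, by simp,
        hP v x hvx hx ⟨_, hface⟩ (by simp) (by simp)⟩
  obtain ⟨e, he, he1⟩ := hbdry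
  obtain ⟨a, b, hne, rfl⟩ := Finset.card_eq_two.1 he.2
  have hab := mem_facesOfDim_one.1 he
  have hPab : P a b := by
    rw [hcard] at he1
    obtain ⟨t, ht⟩ := Finset.card_eq_one.1 he1
    have hs := hsum a b hab
    rw [ht, Finset.sum_singleton] at hs
    have : t ∈ Finset.univ.filter (fun t : facesOfDim K 2 => a ∈ t.1 ∧ b ∈ t.1) := by simp [ht]
    simp only [Finset.mem_filter, Finset.mem_univ, true_and] at this
    exact ⟨t, this.1, this.2, hs⟩
  have hall : ∀ v, ∃ x, (oneSkeleton K).Adj v x ∧ P v x := by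
    intro v
    obtain ⟨w⟩ := hconn.preconnected a v
    have hstart : ∃ x, (oneSkeleton K).Adj a x ∧ P a x := ⟨b, hab, hPab⟩
    clear hPab hab he he1 hne
    induction w with
    | nil => exact hstart
    | cons hadj _ ih =>
      obtain ⟨x, hx, hPx⟩ := hstart
      obtain ⟨t, h1, h2, h3⟩ := hturn _ _ _ hx (hlink _ _ _ hx hadj) hPx
      exact ih ⟨_, hadj.symm, t, h2, h1, h3⟩
  funext t
  obtain ⟨u, v, w, huv, -, -, ht⟩ := Finset.card_eq_three.1 t.2.2
  have hu : u ∈ t.1 := by simp [ht]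
  have hv : v ∈ t.1 := by simp [ht]
  have huv' := adj_of_mem_face t.2.1 hu hv huv
  obtain ⟨x, hx, hPx⟩ := hall u
  exact hP u v huv' (hturn _ _ _ hx (hlink _ _ _ hx huv') hPx) t hu hv

/-- For a connected surface with boundary, the Euler characteristic is `1` if and only if the first
cohomology modulo `2` vanishes: the coboundary of edge functions is surjective, because its
transpose is injective, and the kernel of the coboundary of vertex functions consists of the
constants. -/
lemma euler_iff_isExact [Finite W] (hconn : (oneSkeleton K).Connected)
    (hedge : ∀ e ∈ facesOfDim K 1, (trianglesAt K e).ncard = 1 ∨ (trianglesAt K e).ncard = 2)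
    (hlink : ∀ v x y : W, (oneSkeleton K).Adj v x → (oneSkeleton K).Adj v y →
      (linkGraph K v).Reachable x y)
    (hbdry : (boundaryEdges K).Nonempty) :
    faceCount K 0 + faceCount K 2 = faceCount K 1 + 1 ↔ IsExact K := by
  classical
  have h1 : (1 + 1 : ZMod 2) = 0 := by decide
  have h2 : ∀ p q : ZMod 2, p + q = 0 → p = q := by decide
  have h3 : ∀ p q s : ZMod 2, p + q + (q + s) + (p + s) = 0 := by decide
  have := Fintype.ofFinite W
  have := Fintype.ofFinite (oneSkeleton K).edgeSet
  have := Fintype.ofFinite (facesOfDim K 2)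
  obtain ⟨w₀⟩ := hconn.nonempty
  have : Fact (Nat.Prime 2) := ⟨Nat.prime_two⟩
  rw [faceCount_zero, faceCount_one, faceCount, ← Nat.card_coe_set_eq]
  simp only [Nat.card_eq_fintype_card]
  set M := (triangleEdge K).mulVecLin
  set N := (edgeVertex K).mulVecLin
  have hM : Module.finrank (ZMod 2) M.range = Fintype.card (facesOfDim K 2) := by
    have h1 : Module.finrank (ZMod 2) M.range = (triangleEdge K).rank := rfl
    rw [h1, ← Matrix.rank_transpose, Matrix.rank, LinearMap.finrank_range_of_inj,
      Module.finrank_fintype_fun_eq_card]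
    rw [← LinearMap.ker_eq_bot, LinearMap.ker_eq_bot']
    exact fun c hc => triangleEdge_transpose_injective hconn hedge hlink hbdry c hc
  have hMker := M.finrank_range_add_finrank_ker
  rw [hM, Module.finrank_fintype_fun_eq_card] at hMker
  have hNker := N.finrank_range_add_finrank_ker
  have hconst : Module.finrank (ZMod 2) N.ker = 1 := by
    have : N.ker = Submodule.span (ZMod 2) {fun _ => 1} := by
      refine le_antisymm (fun h hh => ?_) ?_
      · have hadj : ∀ a b, (oneSkeleton K).Adj a b → h a = h b := by
          intro a b hab
          have := congrFun (LinearMap.mem_ker.1 hh) ⟨s(a, b), hab⟩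
          rw [Matrix.mulVecLin_apply, edgeVertex_mulVec h (show s(a, b) ∈ _ from hab)] at this
          exact h2 _ _ this
        refine Submodule.mem_span_singleton.2 ⟨h w₀, ?_⟩
        funext v
        obtain ⟨w⟩ := hconn.preconnected w₀ v
        simp only [Pi.smul_apply, smul_eq_mul, mul_one]
        induction w with
        | nil => rfl
        | cons hab _ ih => rw [hadj _ _ hab, ih]
      · rw [Submodule.span_singleton_le_iff_mem, LinearMap.mem_ker]
        funext ⟨e, he⟩
        induction e with | _ a b
        rw [Matrix.mulVecLin_apply, edgeVertex_mulVec]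
        exact h1
    rw [this, finrank_span_singleton]
    intro h
    exact one_ne_zero (congrFun h w₀)
  rw [hconst, Module.finrank_fintype_fun_eq_card] at hNker
  have hle : N.range ≤ M.ker := by
    rintro _ ⟨h, rfl⟩
    rw [LinearMap.mem_ker]
    funext t
    obtain ⟨a, b, c, hab, hac, hbc, ht⟩ := Finset.card_eq_three.1 t.2.2
    have ha : a ∈ t.1 := by simp [ht]
    have hb : b ∈ t.1 := by simp [ht]
    have hc : c ∈ t.1 := by simp [ht]
    have hN : N h = fun e : (oneSkeleton K).edgeSet =>
        (Sym2.lift ⟨fun a b => h a + h b, fun a b => add_comm _ _⟩ : Sym2 W → ZMod 2) e := by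
      funext ⟨e, he⟩
      induction e with | _ a b
      exact edgeVertex_mulVec h he
    rw [hN, Matrix.mulVecLin_apply, triangleEdge_mulVec _ t ha hb hc hab hbc hac]
    simp only [Sym2.lift_mk]
    exact h3 _ _ _
  have hiff : IsExact K ↔ M.ker ≤ N.range := by
    constructor
    · intro hex f hf
      let F : Sym2 W → ZMod 2 := fun e =>
        if he : e ∈ (oneSkeleton K).edgeSet then f ⟨e, he⟩ else 0
      have hF : (fun e : (oneSkeleton K).edgeSet => F e) = f := by
        funext e
        simp [F]
      obtain ⟨h, hh⟩ := hex F (by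
        intro t ht a ha b hb c hc hab hbc hac
        rw [← triangleEdge_mulVec F ⟨t, ht⟩ ha hb hc hab hbc hac, hF]
        exact congrFun (LinearMap.mem_ker.1 hf) ⟨t, ht⟩)
      refine ⟨h, ?_⟩
      funext ⟨e, he⟩
      induction e with | _ a b
      rw [Matrix.mulVecLin_apply, edgeVertex_mulVec, ← hF]
      exact (hh a b he).symm
    · intro hle' f hf
      obtain ⟨h, hh⟩ := hle' (show (fun e : (oneSkeleton K).edgeSet => f e) ∈ M.ker by
        rw [LinearMap.mem_ker]
        funext t
        obtain ⟨a, b, c, hab, hac, hbc, ht⟩ := Finset.card_eq_three.1 t.2.2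
        rw [Matrix.mulVecLin_apply, triangleEdge_mulVec f t (a := a) (b := b) (c := c) (by simp [ht])
          (by simp [ht]) (by simp [ht]) hab hbc hac]
        exact hf t.1 t.2 a (by simp [ht]) b (by simp [ht]) c (by simp [ht]) hab hbc hac)
      refine ⟨h, fun a b hab => ?_⟩
      have := congrFun hh ⟨s(a, b), hab⟩
      rw [Matrix.mulVecLin_apply, edgeVertex_mulVec h (show s(a, b) ∈ _ from hab)] at this
      exact this.symm
  rw [hiff]
  constructor
  · intro heuler
    exact (Submodule.eq_of_le_of_finrank_eq hle (by omega)).ge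
  · intro hle'
    rw [le_antisymm hle hle'] at hNker
    omega

end Cohomology
end SimplicialFilling

namespace SimplicialFilling

/-! ### Faces of the mapping cylinder -/

section CylinderFaces

variable {r : ℕ} {W : Type*} {D : AbstractSimplicialComplex W} {b : ZMod r → W}

lemma zmod_one_ne_zero (hr : 3 ≤ r) : (1 : ZMod r) ≠ 0 := by
  have := mt (ZMod.natCast_eq_zero_iff 1 r).1 (fun h => by have := Nat.le_of_dvd one_pos h; omega)
  simpa using this

lemma zmod_one_add_one_ne_zero (hr : 3 ≤ r) : (1 + 1 : ZMod r) ≠ 0 := by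
  have := mt (ZMod.natCast_eq_zero_iff 2 r).1 (fun h => by have := Nat.le_of_dvd two_pos h; omega)
  rw [one_add_one_eq_two]
  exact_mod_cast this

lemma isSimplicialMap_cycleComplex : IsSimplicialMap (cycleComplex r) D b ↔
    ∀ i, ∃ s ∈ D.faces, b i ∈ s ∧ b (i + 1) ∈ s := by
  classical
  constructor
  · intro h i
    obtain ⟨t, ht, hst⟩ := h {i, i + 1} ⟨by simp, i, by simp⟩
    refine ⟨t, ht, ?_, ?_⟩
    · rw [← Finset.mem_coe, hst]
      exact ⟨i, by simp⟩
    · rw [← Finset.mem_coe, hst]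
      exact ⟨i + 1, by simp⟩
  · rintro h s ⟨hs, i, hi⟩
    obtain ⟨t, ht, h1, h2⟩ := h i
    refine ⟨s.image b, (D.isRelLowerSet_faces ht).2 ?_ (hs.image b), by simp⟩
    intro v hv
    obtain ⟨j, hj, rfl⟩ := Finset.mem_image.1 hv
    rcases hi hj with rfl | rfl
    · exact h1
    · exact h2

open Classical in
/-- The triangle of the mapping cylinder over the edge `{i, i + 1}` that contains this edge. -/
noncomputable def outerTriangle (b : ZMod r → W) (i : ZMod r) : Finset (ZMod r ⊕ W) :=
  {Sum.inl i, Sum.inl (i + 1), Sum.inr (b (i + 1))}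

open Classical in
/-- The triangle of the mapping cylinder over the edge `{i, i + 1}` that contains the image of this
edge. It degenerates if `b` collapses the edge. -/
noncomputable def innerTriangle (b : ZMod r → W) (i : ZMod r) : Finset (ZMod r ⊕ W) :=
  {Sum.inl i, Sum.inr (b i), Sum.inr (b (i + 1))}

@[simp] lemma mem_outerTriangle {i : ZMod r} {p : ZMod r ⊕ W} : p ∈ outerTriangle b i ↔
    p = Sum.inl i ∨ p = Sum.inl (i + 1) ∨ p = Sum.inr (b (i + 1)) := by
  simp [outerTriangle]

@[simp] lemma mem_innerTriangle {i : ZMod r} {p : ZMod r ⊕ W} : p ∈ innerTriangle b i ↔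
    p = Sum.inl i ∨ p = Sum.inr (b i) ∨ p = Sum.inr (b (i + 1)) := by
  simp [innerTriangle]

lemma mem_cylinder_faces {s : Finset (ZMod r ⊕ W)} : s ∈ (mappingCylinder D b).faces ↔
    s.Nonempty ∧ ((∃ t ∈ D.faces, s ⊆ t.map Function.Embedding.inr) ∨
      ∃ i, s ⊆ outerTriangle b i ∨ s ⊆ innerTriangle b i) := by
  classical
  simp only [mappingCylinder, outerTriangle, innerTriangle, ← Finset.coe_subset, Finset.coe_map,
    Finset.coe_insert, Finset.coe_singleton, Function.Embedding.inr_apply]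
  rfl

lemma outerTriangle_mem (i : ZMod r) : outerTriangle b i ∈ (mappingCylinder D b).faces :=
  mem_cylinder_faces.2 ⟨⟨Sum.inl i, by simp⟩, Or.inr ⟨i, Or.inl subset_rfl⟩⟩

lemma innerTriangle_mem (i : ZMod r) : innerTriangle b i ∈ (mappingCylinder D b).faces :=
  mem_cylinder_faces.2 ⟨⟨Sum.inl i, by simp⟩, Or.inr ⟨i, Or.inr subset_rfl⟩⟩

lemma map_inr_mem {t : Finset W} (ht : t ∈ D.faces) :
    t.map Function.Embedding.inr ∈ (mappingCylinder D b).faces :=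
  mem_cylinder_faces.2 ⟨(D.isRelLowerSet_faces ht).1.map, Or.inl ⟨t, ht, subset_rfl⟩⟩

lemma cylinder_adj_inr_inr (hb : ∀ i, ∃ s ∈ D.faces, b i ∈ s ∧ b (i + 1) ∈ s) {u w : W} :
    (oneSkeleton (mappingCylinder D b)).Adj (Sum.inr u) (Sum.inr w) ↔
      (oneSkeleton D).Adj u w := by
  constructor
  · rintro ⟨hne, s, hs, hu, hw⟩
    refine ⟨fun h => hne (by rw [h]), ?_⟩
    rcases (mem_cylinder_faces.1 hs).2 with ⟨t, ht, hst⟩ | ⟨i, hst | hst⟩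
    · exact ⟨t, ht, by simpa using hst hu, by simpa using hst hw⟩
    · have h1 := hst hu
      have h2 := hst hw
      simp only [mem_outerTriangle, reduceCtorEq, Sum.inr.injEq, false_or] at h1 h2
      exact absurd (by rw [h1, h2]) hne
    · have h1 := hst hu
      have h2 := hst hw
      simp only [mem_innerTriangle, reduceCtorEq, Sum.inr.injEq, false_or] at h1 h2
      obtain ⟨t, ht, h3, h4⟩ := hb i
      refine ⟨t, ht, ?_, ?_⟩
      · rcases h1 with rfl | rfl <;> assumption
      · rcases h2 with rfl | rfl <;> assumption
  · rintro ⟨hne, s, hs, hu, hw⟩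
    exact ⟨by simpa using hne, _, map_inr_mem hs, by simpa using hu, by simpa using hw⟩

lemma cylinder_adj_inl_inr {i : ZMod r} {w : W} :
    (oneSkeleton (mappingCylinder D b)).Adj (Sum.inl i) (Sum.inr w) ↔
      w = b i ∨ w = b (i + 1) := by
  constructor
  · rintro ⟨-, s, hs, hu, hw⟩
    rcases (mem_cylinder_faces.1 hs).2 with ⟨t, ht, hst⟩ | ⟨j, hst | hst⟩
    · exact absurd (hst hu) (by simp)
    · have h1 := hst hu
      have h2 := hst hw
      simp only [mem_outerTriangle, reduceCtorEq, Sum.inl.injEq, Sum.inr.injEq, false_or,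
        or_false] at h1 h2
      rcases h1 with rfl | rfl <;> tauto
    · have h1 := hst hu
      have h2 := hst hw
      simp only [mem_innerTriangle, reduceCtorEq, Sum.inl.injEq, Sum.inr.injEq, false_or,
        or_false] at h1 h2
      subst h1
      exact h2
  · rintro (rfl | rfl)
    · exact ⟨by simp, _, innerTriangle_mem i, by simp, by simp⟩
    · exact ⟨by simp, _, innerTriangle_mem i, by simp, by simp⟩

lemma cylinder_adj_inl_inl (hr : 3 ≤ r) {i j : ZMod r} :
    (oneSkeleton (mappingCylinder D b)).Adj (Sum.inl i) (Sum.inl j) ↔ j = i + 1 ∨ i = j + 1 := by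
  have h1 := zmod_one_ne_zero hr
  constructor
  · rintro ⟨hne, s, hs, hu, hw⟩
    rcases (mem_cylinder_faces.1 hs).2 with ⟨t, ht, hst⟩ | ⟨k, hst | hst⟩
    · exact absurd (hst hu) (by simp)
    · have h1 := hst hu
      have h2 := hst hw
      simp only [mem_outerTriangle, reduceCtorEq, Sum.inl.injEq, or_false] at h1 h2
      rcases h1 with rfl | rfl <;> rcases h2 with rfl | rfl <;> simp_all
    · have h1 := hst hu
      have h2 := hst hw
      simp only [mem_innerTriangle, reduceCtorEq, Sum.inl.injEq, or_false] at h1 h2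
      exact absurd (by rw [h1, h2]) hne
  · rintro (rfl | rfl)
    · exact ⟨by simpa using h1, _, outerTriangle_mem i, by simp, by simp⟩
    · exact ⟨by simpa using h1, _, outerTriangle_mem j, by simp, by simp⟩

lemma card_outerTriangle (hr : 3 ≤ r) (i : ZMod r) : (outerTriangle b i).card = 3 := by
  classical
  exact Finset.card_eq_three.2 ⟨_, _, _, by simpa using zmod_one_ne_zero hr, by simp,
    by simp, rfl⟩

lemma card_innerTriangle {i : ZMod r} (h : b i ≠ b (i + 1)) : (innerTriangle b i).card = 3 := by
  classical
  exact Finset.card_eq_three.2 ⟨_, _, _, by simp, by simp, by simpa using h, rfl⟩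

lemma mem_cylinder_triangles (hr : 3 ≤ r)
    {s : Finset (ZMod r ⊕ W)} : s ∈ facesOfDim (mappingCylinder D b) 2 ↔
      (∃ t ∈ facesOfDim D 2, s = t.map Function.Embedding.inr) ∨ (∃ i, s = outerTriangle b i) ∨
        ∃ i, b i ≠ b (i + 1) ∧ s = innerTriangle b i := by
  classical
  constructor
  · rintro ⟨hs, hcard⟩
    rcases (mem_cylinder_faces.1 hs).2 with ⟨t, ht, hst⟩ | ⟨i, hst | hst⟩
    · obtain ⟨u, hu, rfl⟩ := Finset.subset_map_iff.1 hst
      rw [Finset.card_map] at hcard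
      exact Or.inl ⟨u, ⟨(D.isRelLowerSet_faces ht).2 hu (Finset.card_pos.1 (by omega)), hcard⟩, rfl⟩
    · exact Or.inr (Or.inl ⟨i, Finset.eq_of_subset_of_card_le hst
        (by rw [hcard, card_outerTriangle hr])⟩)
    · have hle := Finset.card_le_card hst
      have hne : b i ≠ b (i + 1) := by
        intro h
        have : (innerTriangle b i).card ≤ 2 := by
          rw [innerTriangle, h, Finset.pair_eq_singleton]
          exact Finset.card_le_two
        omega
      exact Or.inr (Or.inr ⟨i, hne, Finset.eq_of_subset_of_card_le hst
        (by rw [hcard, card_innerTriangle hne])⟩)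
  · rintro (⟨t, ht, rfl⟩ | ⟨i, rfl⟩ | ⟨i, hi, rfl⟩)
    · exact ⟨map_inr_mem ht.1, by rw [Finset.card_map, ht.2]⟩
    · exact ⟨outerTriangle_mem i, card_outerTriangle hr i⟩
    · exact ⟨innerTriangle_mem i, card_innerTriangle hi⟩

lemma outerTriangle_ne_innerTriangle (hr : 3 ≤ r) (i j : ZMod r) :
    outerTriangle b i ≠ innerTriangle b j := by
  intro h
  have h1 : Sum.inl i ∈ innerTriangle b j := by rw [← h]; simp
  have h2 : Sum.inl (i + 1) ∈ innerTriangle b j := by rw [← h]; simp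
  simp only [mem_innerTriangle, reduceCtorEq, Sum.inl.injEq, or_false] at h1 h2
  rw [h1] at h2
  exact zmod_one_ne_zero hr (by simpa using h2)

lemma innerTriangle_injective : Function.Injective (innerTriangle b) := by
  intro i j h
  have h1 : Sum.inl i ∈ innerTriangle b j := by rw [← h]; simp
  simpa using h1

lemma outerTriangle_ne_succ (hr : 3 ≤ r) (i : ZMod r) :
    outerTriangle b i ≠ outerTriangle b (i + 1) := by
  intro h
  have h1 : Sum.inl i ∈ outerTriangle b (i + 1) := by rw [← h]; simp
  simp only [mem_outerTriangle, reduceCtorEq, Sum.inl.injEq, or_false] at h1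
  rcases h1 with h1 | h1
  · exact zmod_one_ne_zero hr (by simpa using h1.symm)
  · rw [add_assoc] at h1
    exact zmod_one_add_one_ne_zero hr (by simpa using h1.symm)

lemma ncard_trianglesAt_inl_inl [DecidableEq (ZMod r ⊕ W)] (hr : 3 ≤ r)
    (i : ZMod r) :
    (trianglesAt (mappingCylinder D b) {Sum.inl i, Sum.inl (i + 1)}).ncard = 1 := by
  have h1 := zmod_one_ne_zero hr
  have h2 := zmod_one_add_one_ne_zero hr
  refine Set.ncard_eq_one.2 ⟨outerTriangle b i, Set.ext fun s => ⟨?_, ?_⟩⟩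
  · rintro ⟨hs, hsub⟩
    have hi : Sum.inl i ∈ s := hsub (by simp)
    have hi' : Sum.inl (i + 1) ∈ s := hsub (by simp)
    rcases (mem_cylinder_triangles hr).1 hs with ⟨t, -, rfl⟩ | ⟨j, rfl⟩ | ⟨j, -, rfl⟩
    · simp at hi
    · simp only [mem_outerTriangle, reduceCtorEq, Sum.inl.injEq, or_false, add_left_inj] at hi hi'
      rcases hi' with rfl | rfl
      · rw [add_assoc] at hi
        rcases hi with hi | hi
        · exact absurd (by simpa using hi) h1
        · exact absurd (by simpa using hi) h2
      · rfl
    · simp only [mem_innerTriangle, reduceCtorEq, Sum.inl.injEq, or_false] at hi hi'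
      rw [hi] at hi'
      exact absurd (by simpa using hi') h1
  · rintro rfl
    refine ⟨⟨outerTriangle_mem i, card_outerTriangle hr i⟩, ?_⟩
    intro p hp
    simp only [Finset.mem_insert, Finset.mem_singleton] at hp
    simp only [mem_outerTriangle]
    tauto

/-- The edges of the collar that are transverse to the boundary lie in two triangles. If `b` collapses
the edge `{i, i + 1}`, then the edge `{i, b i}` lies in the outer triangles on both sides. -/
lemma ncard_trianglesAt_inl_inr [DecidableEq (ZMod r ⊕ W)] (hr : 3 ≤ r)
    {i : ZMod r} {w : W} (hw : w = b i ∨ w = b (i + 1)) :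
    (trianglesAt (mappingCylinder D b) {Sum.inl i, Sum.inr w}).ncard = 2 := by
  obtain ⟨j, rfl⟩ : ∃ j, i = j + 1 := ⟨i - 1, by simp⟩
  have hat : ∀ s, s ∈ trianglesAt (mappingCylinder D b) {Sum.inl (j + 1), Sum.inr w} ↔
      (s = outerTriangle b j ∧ w = b (j + 1)) ∨
      (s = outerTriangle b (j + 1) ∧ w = b (j + 1 + 1)) ∨
      (s = innerTriangle b (j + 1) ∧ b (j + 1) ≠ b (j + 1 + 1)) := by
    intro s
    constructor
    · rintro ⟨hs, hsub⟩
      have hi : Sum.inl (j + 1) ∈ s := hsub (by simp)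
      have hi' : Sum.inr w ∈ s := hsub (by simp)
      rcases (mem_cylinder_triangles hr).1 hs with ⟨t, -, rfl⟩ | ⟨k, rfl⟩ | ⟨k, hk, rfl⟩
      · simp at hi
      · simp only [mem_outerTriangle, reduceCtorEq, Sum.inl.injEq, Sum.inr.injEq, or_false,
          false_or, add_left_inj] at hi hi'
        rcases hi with rfl | rfl
        · exact Or.inr (Or.inl ⟨rfl, hi'⟩)
        · exact Or.inl ⟨rfl, hi'⟩
      · simp only [mem_innerTriangle, reduceCtorEq, Sum.inl.injEq, or_false] at hi
        subst hi
        exact Or.inr (Or.inr ⟨rfl, hk⟩)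
    · intro h
      have hs : s ∈ facesOfDim (mappingCylinder D b) 2 := by
        rw [mem_cylinder_triangles hr]
        rcases h with ⟨h, -⟩ | ⟨h, -⟩ | ⟨h, h'⟩
        · exact Or.inr (Or.inl ⟨_, h⟩)
        · exact Or.inr (Or.inl ⟨_, h⟩)
        · exact Or.inr (Or.inr ⟨_, h', h⟩)
      refine ⟨hs, fun p hp => ?_⟩
      simp only [Finset.mem_insert, Finset.mem_singleton] at hp
      rcases h with ⟨rfl, h⟩ | ⟨rfl, h⟩ | ⟨rfl, h⟩ <;> rcases hp with rfl | rfl <;> simp [h]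
      simpa using hw
  rw [Set.ncard_eq_two]
  by_cases h : b (j + 1) = b (j + 1 + 1)
  · refine ⟨outerTriangle b j, outerTriangle b (j + 1), outerTriangle_ne_succ hr j, Set.ext ?_⟩
    intro s
    rw [hat, Set.mem_insert_iff, Set.mem_singleton_iff]
    rw [← h] at hw ⊢
    tauto
  · by_cases hw' : w = b (j + 1)
    · refine ⟨outerTriangle b j, innerTriangle b (j + 1), outerTriangle_ne_innerTriangle hr _ _,
        Set.ext ?_⟩
      intro s
      rw [hat, Set.mem_insert_iff, Set.mem_singleton_iff]
      have : w ≠ b (j + 1 + 1) := hw' ▸ h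
      tauto
    · refine ⟨outerTriangle b (j + 1), innerTriangle b (j + 1),
        outerTriangle_ne_innerTriangle hr _ _, Set.ext ?_⟩
      intro s
      rw [hat, Set.mem_insert_iff, Set.mem_singleton_iff]
      tauto

/-- The triangles of the mapping cylinder at an edge of `D` are those of `D` and one for each edge of
the cycle that is mapped onto this edge. -/
lemma ncard_trianglesAt_inr_inr [Finite W] [DecidableEq W] [DecidableEq (ZMod r ⊕ W)] (hr : 3 ≤ r) {u w : W} (huw : u ≠ w) :
    (trianglesAt (mappingCylinder D b) {Sum.inr u, Sum.inr w}).ncard =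
      (trianglesAt D {u, w}).ncard + {i | s(b i, b (i + 1)) = s(u, w)}.ncard := by
  have : NeZero r := ⟨by omega⟩
  have hat : trianglesAt (mappingCylinder D b) {Sum.inr u, Sum.inr w} =
      (fun t : Finset W => t.map Function.Embedding.inr) '' trianglesAt D {u, w} ∪
        innerTriangle b '' {i | s(b i, b (i + 1)) = s(u, w)} := by
    ext s
    constructor
    · rintro ⟨hs, hsub⟩
      have hu : Sum.inr u ∈ s := hsub (by simp)
      have hw : Sum.inr w ∈ s := hsub (by simp)
      rcases (mem_cylinder_triangles hr).1 hs with ⟨t, ht, rfl⟩ | ⟨j, rfl⟩ | ⟨j, hj, rfl⟩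
      · refine Or.inl ⟨t, ⟨ht, fun p hp => ?_⟩, rfl⟩
        simp only [Finset.mem_insert, Finset.mem_singleton] at hp
        rcases hp with rfl | rfl
        · simpa using hu
        · simpa using hw
      · simp only [mem_outerTriangle, reduceCtorEq, Sum.inr.injEq, false_or] at hu hw
        exact absurd (hu.trans hw.symm) huw
      · refine Or.inr ⟨j, ?_, rfl⟩
        simp only [mem_innerTriangle, reduceCtorEq, Sum.inr.injEq, false_or] at hu hw
        change s(b j, b (j + 1)) = s(u, w)
        rw [Sym2.eq_iff]
        rcases hu with rfl | rfl <;> rcases hw with rfl | rfl <;> simp_all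
    · rintro (⟨t, ⟨ht, hsub⟩, rfl⟩ | ⟨j, hj, rfl⟩)
      · refine ⟨(mem_cylinder_triangles hr).2 (Or.inl ⟨t, ht, rfl⟩), ?_⟩
        have hu : u ∈ t := hsub (by simp)
        have hw : w ∈ t := hsub (by simp)
        simp [Finset.insert_subset_iff, hu, hw]
      · have hj' : s(b j, b (j + 1)) = s(u, w) := hj
        rw [Sym2.eq_iff] at hj'
        refine ⟨(mem_cylinder_triangles hr).2 (Or.inr (Or.inr ⟨j, ?_, rfl⟩)), ?_⟩
        · rcases hj' with ⟨h1, h2⟩ | ⟨h1, h2⟩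
          · rwa [h1, h2]
          · rw [h1, h2]; exact huw.symm
        · rcases hj' with ⟨h1, h2⟩ | ⟨h1, h2⟩ <;> simp [Finset.insert_subset_iff, h1, h2]
  rw [hat, Set.ncard_union_eq, Set.ncard_image_of_injective _ (Finset.map_injective _),
    Set.ncard_image_of_injective _ innerTriangle_injective]
  · rw [Set.disjoint_left]
    rintro _ ⟨t, -, rfl⟩ ⟨i, -, h⟩
    have : Sum.inl i ∈ innerTriangle b i := by simp
    rw [h] at this
    simp at this

end CylinderFaces
end SimplicialFilling

namespace SimplicialFilling

/-! ### Diagrams of fillings -/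

section LoopWords

variable {r : ℕ} {W V : Type*}

/-- The closed walk `b 1, …, b (r - 1), b 0` traced by a loop, without its first vertex `b 0`. -/
def loopWord (b : ZMod r → W) : List W :=
  (List.range r).map fun i => b ((i + 1 : ℕ) : ZMod r)

@[simp] lemma length_loopWord (b : ZMod r → W) : (loopWord b).length = r := by simp [loopWord]

lemma map_loopWord (b : ZMod r → W) (π : W → V) : (loopWord b).map π = loopWord (π ∘ b) := by
  simp [loopWord]

lemma getLastD_map_range (g : ℕ → W) (n : ℕ) :
    ((List.range n).map fun i => g (i + 1)).getLastD (g 0) = g n := by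
  cases n with
  | zero => rfl
  | succ n => simp [List.range_succ, List.getLastD_eq_getLast?]

lemma steps_map_range (g : ℕ → W) (n : ℕ) :
    steps (g 0) ((List.range n).map fun i => g (i + 1)) =
      (List.range n).map fun i => s(g i, g (i + 1)) := by
  induction n with
  | zero => rfl
  | succ n ih =>
    rw [List.range_succ, List.map_append, steps_append, ih, getLastD_map_range]
    simp [steps]

lemma getLastD_loopWord (b : ZMod r → W) : (loopWord b).getLastD (b 0) = b 0 := by
  have := getLastD_map_range (fun i : ℕ => b i) r
  simpa [loopWord] using this

lemma steps_loopWord (b : ZMod r → W) :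
    steps (b 0) (loopWord b) = (List.range r).map fun i : ℕ => s(b i, b ((i : ZMod r) + 1)) := by
  have := steps_map_range (fun i : ℕ => b i) r
  simpa [loopWord] using this

lemma mem_steps_loopWord [NeZero r] {b : ZMod r → W} {e : Sym2 W} :
    e ∈ steps (b 0) (loopWord b) ↔ ∃ i, s(b i, b (i + 1)) = e := by
  rw [steps_loopWord, List.mem_map]
  constructor
  · rintro ⟨i, -, h⟩
    exact ⟨i, h⟩
  · rintro ⟨i, h⟩
    exact ⟨i.val, List.mem_range.2 i.val_lt, by simpa using h⟩

lemma stepCount_loopWord [NeZero r] (b : ZMod r → W) (e : Sym2 W) :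
    stepCount (b 0) (loopWord b) e = {i | s(b i, b (i + 1)) = e}.ncard := by
  classical
  have h1 : stepCount (b 0) (loopWord b) e =
      ((Finset.range r).filter fun i : ℕ => s(b i, b ((i : ZMod r) + 1)) = e).card := by
    rw [stepCount, steps_loopWord, List.count, List.countP_map, List.countP_eq_length_filter]
    rw [← List.toFinset_card_of_nodup (List.nodup_range.filter _)]
    congr 1
    ext i
    simp
  have h2 : {i | s(b i, b (i + 1)) = e} = ((((Finset.range r).filter
      fun i : ℕ => s(b i, b ((i : ZMod r) + 1)) = e).image (fun i : ℕ => (i : ZMod r)) :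
      Finset (ZMod r)) : Set (ZMod r)) := by
    ext i
    simp only [Set.mem_ofPred_eq, Finset.coe_image, Set.mem_image, Finset.coe_filter,
      Finset.mem_range]
    constructor
    · intro h
      exact ⟨i.val, ⟨i.val_lt, by simpa using h⟩, by simp⟩
    · rintro ⟨j, ⟨-, h⟩, rfl⟩
      exact h
  rw [h1, h2, Set.ncard_coe_finset, Finset.card_image_of_injOn]
  intro i hi j hj hij
  simp only [Finset.coe_filter, Finset.mem_range, Set.mem_ofPred_eq] at hi hj
  have := congrArg ZMod.val hij
  rwa [ZMod.val_cast_of_lt hi.1, ZMod.val_cast_of_lt hj.1] at this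

/-- Every closed walk of positive length is traced by a loop. -/
lemma exists_loopWord_eq [NeZero r] {x : W} {l : List W} (hl : l.length = r)
    (hcl : l.getLastD x = x) : ∃ b : ZMod r → W, b 0 = x ∧ loopWord b = l := by
  refine ⟨fun i => (x :: l).getD i.val x, by simp, ?_⟩
  refine List.ext_getElem (by simp [hl]) fun i hi hi' => ?_
  simp only [loopWord, List.getElem_map, List.getElem_range]
  have hir : i < r := by simpa using hi
  rcases Nat.lt_or_ge (i + 1) r with h | h
  · rw [ZMod.val_cast_of_lt h, List.getD_cons_succ, List.getD_eq_getElem]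
  · obtain rfl : i + 1 = r := by omega
    rw [ZMod.natCast_self, ZMod.val_zero, List.getD_cons_zero]
    rw [List.getLastD_eq_getLast?, List.getLast?_eq_getElem?, hl, Nat.add_sub_cancel,
      List.getElem?_eq_getElem hi', Option.getD_some] at hcl
    exact hcl.symm

end LoopWords

section FillingsToDiagrams

variable {r : ℕ} {W V : Type*} {X : AbstractSimplicialComplex V} {γ : ZMod r → V}
  {D : AbstractSimplicialComplex W} {b : ZMod r → W} {π : W → V}

/-- The retraction of the mapping cylinder onto `D` pulls cocycles back to cocycles. -/
lemma isExact_of_cylinder (hr : 3 ≤ r) (hb : ∀ i, ∃ s ∈ D.faces, b i ∈ s ∧ b (i + 1) ∈ s)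
    (h : IsExact (mappingCylinder D b)) : IsExact D := by
  classical
  intro f hf
  let R : ZMod r ⊕ W → W := Sum.elim b id
  let F : Sym2 W → ZMod 2 := fun e => if e.IsDiag then 0 else f e
  have hdiag : ∀ a, F s(a, a) = 0 := fun a => if_pos (by simp)
  have hF : ∀ a b, a ≠ b → F s(a, b) = f s(a, b) := fun a b h => if_neg (by simpa using h)
  have hdeg : ∀ p q s, p = q ∨ q = s ∨ p = s → F s(p, q) + F s(q, s) + F s(p, s) = 0 := by
    have h2 : ∀ z : ZMod 2, z + z = 0 := by decide
    rintro p q s (rfl | rfl | rfl)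
    · rw [hdiag, zero_add, h2]
    · rw [hdiag, add_zero, h2]
    · rw [hdiag, add_zero, Sym2.eq_swap, h2]
  obtain ⟨h, hh⟩ := h (fun e => F (e.map R)) (by
    intro t ht p hp q hq s hs hpq hqs hps
    simp only [Sym2.map_mk]
    rcases (mem_cylinder_triangles hr).1 ht with ⟨t, ht', rfl⟩ | ⟨i, rfl⟩ | ⟨i, -, rfl⟩
    · obtain ⟨p, hp', rfl⟩ := Finset.mem_map.1 hp
      obtain ⟨q, hq', rfl⟩ := Finset.mem_map.1 hq
      obtain ⟨s, hs', rfl⟩ := Finset.mem_map.1 hs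
      have hpq' : p ≠ q := fun h => hpq (by rw [h])
      have hqs' : q ≠ s := fun h => hqs (by rw [h])
      have hps' : p ≠ s := fun h => hps (by rw [h])
      simp only [Function.Embedding.inr_apply, R, Sum.elim_inr, id]
      rw [hF _ _ hpq', hF _ _ hqs', hF _ _ hps']
      exact hf t ht' p hp' q hq' s hs' hpq' hqs' hps'
    · apply hdeg
      have hR : ∀ p ∈ outerTriangle b i, R p = b i ∨ R p = b (i + 1) := by
        simp [R]
      have h1 := hR p hp
      have h2 := hR q hq
      have h3 := hR s hs
      grind
    · apply hdeg
      have hR : ∀ p ∈ innerTriangle b i, R p = b i ∨ R p = b (i + 1) := by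
        simp [R]
      have h1 := hR p hp
      have h2 := hR q hq
      have h3 := hR s hs
      grind)
  refine ⟨fun w => h (Sum.inr w), fun u w huw => ?_⟩
  rw [← hh _ _ ((cylinder_adj_inr_inr hb).2 huw), Sym2.map_mk]
  exact (hF _ _ huw.1).symm

/-- The complex of a filling is a diagram: its edges are not boundary edges of the mapping cylinder,
so each of them lies in two triangles of the cylinder. -/
lemma IsFilling.exists_isDiagram (hr : 3 ≤ r) (h : IsFilling X γ D b π) :
    ∃ E S, IsDiagram E S (b 0) (loopWord b) ∧ IsLabelling X E S π ∧ S.card = faceCount D 2 := by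
  classical
  have : NeZero r := ⟨by omega⟩
  have hb := isSimplicialMap_cycleComplex.1 h.simplicial_left
  have := h.disk.finite
  have : Finite W := Finite.of_injective (Sum.inr : W → ZMod r ⊕ W) Sum.inr_injective
  have := Fintype.ofFinite W
  have hS : ∀ t, t ∈ (facesOfDim D 2).toFinset ↔ t ∈ facesOfDim D 2 := fun t => Set.mem_toFinset
  have hE : ∀ u w, s(u, w) ∈ (oneSkeleton D).edgeSet.toFinset ↔ (oneSkeleton D).Adj u w :=
    fun u w => by rw [Set.mem_toFinset]; rfl
  have hex : IsExact D := isExact_of_cylinder hr hb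
    ((euler_iff_isExact h.disk.connected h.disk.edge h.disk.link h.disk.boundary).1 h.disk.euler)
  refine ⟨(oneSkeleton D).edgeSet.toFinset, (facesOfDim D 2).toFinset, ⟨?_, ?_, ?_, ?_, ?_, ?_, ?_⟩,
    ⟨?_, ?_⟩, ?_⟩
  · intro e he
    induction e with | _ u w
    simpa using ((hE _ _).1 he).1
  · intro t ht
    exact ((hS t).1 ht).2
  · intro t ht u hu w hw huw
    exact (hE _ _).2 (adj_of_mem_face ((hS t).1 ht).1 hu hw huw)
  · intro e he hdiag
    obtain ⟨i, rfl⟩ := mem_steps_loopWord.1 he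
    obtain ⟨s, hs, h1, h2⟩ := hb i
    exact (hE _ _).2 ⟨by simpa using hdiag, s, hs, h1, h2⟩
  · exact getLastD_loopWord b
  · intro e he
    induction e with | _ u w
    have huw := (hE _ _).1 he
    have hCyl : ({Sum.inr u, Sum.inr w} : Finset (ZMod r ⊕ W)) ∈
        facesOfDim (mappingCylinder D b) 1 :=
      mem_facesOfDim_one.2 ((cylinder_adj_inr_inr hb).2 huw)
    have h2 : (trianglesAt (mappingCylinder D b) {Sum.inr u, Sum.inr w}).ncard = 2 := by
      refine (h.disk.edge _ hCyl).resolve_left fun h1 => ?_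
      have : ({Sum.inr u, Sum.inr w} : Finset (ZMod r ⊕ W)) ∈
        boundaryEdges (mappingCylinder D b) := ⟨hCyl, h1⟩
      rw [h.boundary] at this
      obtain ⟨i, hi⟩ := this
      have : (Sum.inr u : ZMod r ⊕ W) ∈ ({Sum.inl i, Sum.inl (i + 1)} : Set (ZMod r ⊕ W)) := by
        rw [← hi]; simp
      simp at this
    rw [ncard_trianglesAt_inr_inr hr huw.1] at h2
    rw [stepCount_loopWord, triangleDegree, ← Set.ncard_coe_finset]
    refine Eq.trans ?_ h2
    congr 2
    ext t
    simp [trianglesAt, Finset.insert_subset_iff]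
  · intro f hf
    obtain ⟨h, hh⟩ := hex f fun t ht => hf t ((hS t).2 ht)
    exact ⟨h, fun u w huw => hh u w ((hE _ _).1 huw)⟩
  · intro u w huw
    obtain ⟨-, s, hs, hu, hw⟩ := (hE _ _).1 huw
    obtain ⟨t, ht, hst⟩ := h.simplicial_right s hs
    exact ⟨t, ht, by rw [← Finset.mem_coe, hst]; exact ⟨u, hu, rfl⟩,
      by rw [← Finset.mem_coe, hst]; exact ⟨w, hw, rfl⟩⟩
  · intro s hs
    obtain ⟨t, ht, hst⟩ := h.simplicial_right s ((hS s).1 hs).1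
    exact ⟨t, ht, fun u hu => by rw [← Finset.mem_coe, hst]; exact ⟨u, hu, rfl⟩⟩
  · rw [faceCount, Set.ncard_eq_toFinset_card']

lemma IsFilling.nullWithin (hr : 3 ≤ r) (h : IsFilling X γ D b π) :
    NullWithin X (γ 0) (loopWord γ) (faceCount D 2) := by
  obtain ⟨E, S, hd, hπ, hS⟩ := h.exists_isDiagram hr
  obtain ⟨n, hn, hw⟩ := hd.nullWalk hπ
  rw [map_loopWord, h.comp 0, (funext h.comp : π ∘ b = γ)] at hw
  exact ⟨n, hS ▸ hn, hw⟩

end FillingsToDiagrams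
end SimplicialFilling

namespace SimplicialFilling

/-! ### Fillings from disk diagrams -/

section DiagramsToFillings

variable {r : ℕ} {W V : Type*} {X : AbstractSimplicialComplex V} {γ : ZMod r → V}
  {E : Finset (Sym2 W)} {S : Finset (Finset W)} {b : ZMod r → W} {x : W} {l : List W}

/-- The simplicial complex on the vertices of a diagram that consists of its vertices, its edges and
its triangles. -/
def diagramComplex (E : Finset (Sym2 W)) (S : Finset (Finset W)) :
    AbstractSimplicialComplex W where
  faces := {s | s.Nonempty ∧ ((∃ v, s ⊆ {v}) ∨ (∃ e ∈ E, ∀ v ∈ s, v ∈ e) ∨ ∃ t ∈ S, s ⊆ t)}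
  isRelLowerSet_faces := fun _ h => ⟨h.1, fun _ hts ht => ⟨ht, h.2.imp
    (fun ⟨v, hv⟩ => ⟨v, hts.trans hv⟩)
    (Or.imp (fun ⟨e, he, hv⟩ => ⟨e, he, fun v h => hv v (hts h)⟩)
      fun ⟨t, ht, hst⟩ => ⟨t, ht, hts.trans hst⟩)⟩⟩
  singleton_mem := fun v => ⟨Finset.singleton_nonempty v, Or.inl ⟨v, subset_rfl⟩⟩

lemma mem_diagramComplex {s : Finset W} : s ∈ (diagramComplex E S).faces ↔
    s.Nonempty ∧ ((∃ v, s ⊆ {v}) ∨ (∃ e ∈ E, ∀ v ∈ s, v ∈ e) ∨ ∃ t ∈ S, s ⊆ t) := Iff.rfl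

lemma IsDiagram.adj_iff (hd : IsDiagram E S x l) {u w : W} :
    (oneSkeleton (diagramComplex E S)).Adj u w ↔ s(u, w) ∈ E := by
  classical
  constructor
  · rintro ⟨hne, s, ⟨-, ⟨v, hv⟩ | ⟨e, he, hv⟩ | ⟨t, ht, hst⟩⟩, hu, hw⟩
    · exact absurd ((Finset.mem_singleton.1 (hv hu)).trans (Finset.mem_singleton.1 (hv hw)).symm) hne
    · rwa [← (Sym2.mem_and_mem_iff hne).1 ⟨hv u hu, hv w hw⟩]
    · exact hd.edge_mem t ht u (hst hu) w (hst hw) hne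
  · intro h
    refine ⟨by simpa using hd.not_isDiag _ h, {u, w}, ⟨by simp, Or.inr (Or.inl ⟨_, h, ?_⟩)⟩,
      by simp, by simp⟩
    simp

lemma IsDiagram.facesOfDim_two (hd : IsDiagram E S x l) :
    facesOfDim (diagramComplex E S) 2 = S := by
  classical
  ext s
  constructor
  · rintro ⟨⟨-, ⟨v, hv⟩ | ⟨e, he, hv⟩ | ⟨t, ht, hst⟩⟩, hcard⟩
    · have := Finset.card_le_card hv
      rw [Finset.card_singleton] at this
      omega
    · induction e with | _ u w
      have : s.card ≤ ({u, w} : Finset W).card := Finset.card_le_card fun v h => by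
        simpa using hv v h
      have := this.trans Finset.card_le_two
      omega
    · rwa [Finset.mem_coe, Finset.eq_of_subset_of_card_le hst (by rw [hcard, hd.card_eq_three t ht])]
  · intro hs
    have hcard := hd.card_eq_three s hs
    exact ⟨⟨Finset.card_pos.1 (by omega), Or.inr (Or.inr ⟨s, hs, subset_rfl⟩)⟩, hcard⟩

lemma IsDiagram.exists_face_loop [NeZero r] (hd : IsDiagram E S (b 0) (loopWord b)) (i : ZMod r) :
    ∃ s ∈ (diagramComplex E S).faces, b i ∈ s ∧ b (i + 1) ∈ s := by
  by_cases h : b i = b (i + 1)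
  · exact ⟨{b i}, (diagramComplex E S).singleton_mem _, by simp, by simp [h]⟩
  · exact (hd.adj_iff.2 (hd.step_mem s(b i, b (i + 1)) (mem_steps_loopWord.2 ⟨i, rfl⟩)
      (by simpa using h))).2

lemma IsDiagram.ncard_add_ncard [NeZero r] [DecidableEq W]
    (hd : IsDiagram E S (b 0) (loopWord b)) {u w : W} (h : s(u, w) ∈ E) :
    (trianglesAt (diagramComplex E S) {u, w}).ncard +
      {i | s(b i, b (i + 1)) = s(u, w)}.ncard = 2 := by
  rw [← hd.degree _ h, stepCount_loopWord, triangleDegree, ← Set.ncard_coe_finset]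
  congr 2
  ext t
  simp [trianglesAt, Finset.insert_subset_iff, hd.facesOfDim_two]

/-- The collar retracts onto the diagram, so the primitive of a cocycle on the diagram extends to the
vertices of the boundary cycle. -/
lemma IsDiagram.isExact_cylinder [NeZero r] (hr : 3 ≤ r)
    (hd : IsDiagram E S (b 0) (loopWord b)) :
    IsExact (mappingCylinder (diagramComplex E S) b) := by
  classical
  intro f hf
  have hb := hd.exists_face_loop
  obtain ⟨h, hh⟩ := hd.exact (fun e => f (e.map Sum.inr)) (by
    intro t ht u hu v hv w hw huv hvw huw
    simp only [Sym2.map_mk]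
    exact hf (t.map Function.Embedding.inr) ((mem_cylinder_triangles hr).2
      (Or.inl ⟨t, by rwa [hd.facesOfDim_two], rfl⟩)) _ (by simpa using hu) _ (by simpa using hv) _
      (by simpa using hw) (by simpa using huv) (by simpa using hvw) (by simpa using huw))
  simp only [Sym2.map_mk] at hh
  let H : ZMod r ⊕ W → ZMod 2 := Sum.elim (fun i => h (b i) + f s(Sum.inl i, Sum.inr (b i))) h
  have hinner : ∀ i, f s(Sum.inl i, Sum.inr (b (i + 1))) = H (Sum.inl i) + h (b (i + 1)) := by
    intro i
    by_cases hi : b i = b (i + 1)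
    · have h3 : ∀ p q : ZMod 2, p = q + p + q := by decide
      simp only [H, Sum.elim_inl, ← hi]
      exact h3 _ _
    · have h2 := hf _ ((mem_cylinder_triangles hr).2 (Or.inr (Or.inr ⟨i, hi, rfl⟩)))
        (Sum.inl i) (by simp) (Sum.inr (b i)) (by simp) (Sum.inr (b (i + 1))) (by simp) (by simp)
        (by simpa using hi) (by simp)
      have hE : s(b i, b (i + 1)) ∈ E := hd.step_mem s(b i, b (i + 1))
        (mem_steps_loopWord.2 ⟨i, rfl⟩) (by simpa using hi)
      rw [hh _ _ hE] at h2
      have h4 : ∀ p q s t : ZMod 2, p + (q + s) + t = 0 → t = q + p + s := by decide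
      exact h4 _ _ _ _ h2
  have houter : ∀ i, f s(Sum.inl i, Sum.inl (i + 1)) = H (Sum.inl i) + H (Sum.inl (i + 1)) := by
    intro i
    have h2 := hf _ ((mem_cylinder_triangles hr).2 (Or.inr (Or.inl ⟨i, rfl⟩)))
        (Sum.inl i) (by simp) (Sum.inl (i + 1)) (by simp) (Sum.inr (b (i + 1))) (by simp)
        (by simpa using zmod_one_ne_zero hr) (by simp) (by simp)
    rw [hinner i] at h2
    have h4 : ∀ p q s t : ZMod 2, p + q + (s + t) = 0 → p = s + (t + q) := by decide
    exact h4 _ _ _ _ h2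
  have hpair : ∀ i w, (oneSkeleton (mappingCylinder (diagramComplex E S) b)).Adj
      (Sum.inl i) (Sum.inr w) → f s(Sum.inl i, Sum.inr w) = H (Sum.inl i) + H (Sum.inr w) := by
    intro i w hiw
    rcases cylinder_adj_inl_inr.1 hiw with rfl | rfl
    · have h3 : ∀ p q : ZMod 2, p = q + p + q := by decide
      exact h3 _ _
    · exact hinner i
  refine ⟨H, ?_⟩
  rintro (i | u) (j | w) hadj
  · rcases (cylinder_adj_inl_inl hr).1 hadj with rfl | rfl
    · exact houter i
    · rw [Sym2.eq_swap, add_comm (H _)]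
      exact houter j
  · exact hpair i w hadj
  · rw [Sym2.eq_swap, add_comm (H _)]
    exact hpair j u hadj.symm
  · exact hh u w (hd.adj_iff.1 ((cylinder_adj_inr_inr hb).1 hadj))

lemma linkGraph_adj_of_mem {K : AbstractSimplicialComplex W} {s : Finset W} (hs : s ∈ K.faces)
    {v u w : W} (hv : v ∈ s) (hu : u ∈ s) (hw : w ∈ s) (huw : u ≠ w) (huv : u ≠ v) (hwv : w ≠ v) :
    (linkGraph K v).Adj u w := ⟨huw, huv, hwv, s, hs, hv, hu, hw⟩

/-- The link of a vertex `i` of the boundary cycle is the path `i - 1, b i, b (i + 1), i + 1`. -/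
lemma cylinder_link_inl (hr : 3 ≤ r) {D : AbstractSimplicialComplex W} (i : ZMod r)
    (p : ZMod r ⊕ W) (hp : (oneSkeleton (mappingCylinder D b)).Adj (Sum.inl i) p) :
    (linkGraph (mappingCylinder D b) (Sum.inl i)).Reachable (Sum.inr (b i)) p := by
  have h1 := zmod_one_ne_zero hr
  have hinner : (linkGraph (mappingCylinder D b) (Sum.inl i)).Reachable (Sum.inr (b i))
      (Sum.inr (b (i + 1))) := by
    by_cases h : b i = b (i + 1)
    · rw [← h]
    · exact (linkGraph_adj_of_mem (innerTriangle_mem i) (by simp) (by simp) (by simp)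
        (by simpa using h) (by simp) (by simp)).reachable
  rcases p with j | w
  · rcases (cylinder_adj_inl_inl hr).1 hp with rfl | rfl
    · exact hinner.trans (linkGraph_adj_of_mem (outerTriangle_mem i) (by simp) (by simp) (by simp)
        (by simp) (by simp) (by simpa using h1)).reachable
    · exact (linkGraph_adj_of_mem (outerTriangle_mem j) (by simp) (by simp) (by simp)
        (by simp) (by simp) (by simpa using h1)).reachable
  · rcases cylinder_adj_inl_inr.1 hp with rfl | rfl
    · rfl
    · exact hinner

/-- The link of a vertex `w` of the diagram is connected in the mapping cylinder: reachability from a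
neighbour `p` of `w` is a colouring of the link that is compatible with the triangles and with
the corners of the boundary walk, hence it is constant. -/
lemma IsFilled.link_inr [NeZero r] (hr : 3 ≤ r) (hd : IsFilled E S (b 0) (loopWord b)) (w : W)
    (p q : ZMod r ⊕ W)
    (hp : (oneSkeleton (mappingCylinder (diagramComplex E S) b)).Adj (Sum.inr w) p)
    (hq : (oneSkeleton (mappingCylinder (diagramComplex E S) b)).Adj (Sum.inr w) q) :
    (linkGraph (mappingCylinder (diagramComplex E S) b) (Sum.inr w)).Reachable p q := by
  classical
  have h1 := zmod_one_ne_zero hr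
  set G := linkGraph (mappingCylinder (diagramComplex E S) b) (Sum.inr w) with hG
  have hadj : ∀ {u v}, G.Adj u v → G.Reachable p u = G.Reachable p v := fun h =>
    propext ⟨fun h' => h'.trans h.reachable, fun h' => h'.trans h.symm.reachable⟩
  have houter : ∀ i, b (i + 1) = w → G.Reachable p (Sum.inl i) = G.Reachable p (Sum.inl (i + 1)) := by
    rintro i rfl
    exact hadj (linkGraph_adj_of_mem (outerTriangle_mem i) (by simp) (by simp) (by simp)
      (by simpa using h1) (by simp) (by simp))
  have hinner : ∀ i, b i ≠ b (i + 1) → b i = w →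
      G.Reachable p (Sum.inl i) = G.Reachable p (Sum.inr (b (i + 1))) := by
    rintro i hi rfl
    exact hadj (linkGraph_adj_of_mem (innerTriangle_mem i) (by simp) (by simp) (by simp)
      (by simp) (by simp) (by simpa using Ne.symm hi))
  have hinner' : ∀ i, b i ≠ b (i + 1) → b (i + 1) = w →
      G.Reachable p (Sum.inl i) = G.Reachable p (Sum.inr (b i)) := by
    rintro i hi rfl
    exact hadj (linkGraph_adj_of_mem (innerTriangle_mem i) (by simp) (by simp) (by simp)
      (by simp) (by simp) (by simpa using hi))
  -- At a vertex other than `w` all edges and corners have the colour `True`.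
  let g : W → W → Prop := fun u v => u = w → G.Reachable p (Sum.inr v)
  let k : ZMod r → W × Prop := fun i => (b i, b i = w → G.Reachable p (Sum.inl i))
  have hcorner : ∀ i, CornerRel g (k i) (k (i + 1)) := by
    intro i
    refine ⟨fun h => ?_, fun h => ⟨?_, ?_⟩⟩
    · change (b i = w → _) = (b (i + 1) = w → _)
      rw [show b i = b (i + 1) from h]
      exact propext (forall_congr' fun hw => by rw [houter i hw])
    · exact propext (forall_congr' fun hw => by rw [hinner i h hw])
    · exact propext (forall_congr' fun hw => by rw [← houter i hw, hinner' i h hw])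
  have hchain : ∀ n : ℕ, List.IsChain (CornerRel g)
      (k (0 : ℕ) :: (List.range n).map fun i : ℕ => k (i + 1 : ℕ)) := by
    intro n
    induction n with
    | zero => simp
    | succ n ih =>
      rw [List.range_succ, List.map_append, isChain_cons_append]
      refine ⟨ih, ?_⟩
      rw [getLastD_map_range (fun i : ℕ => k i)]
      have := hcorner n
      simpa using this
  obtain ⟨c, hc, hc'⟩ := hd.link g (b 0 = w → G.Reachable p (Sum.inl 0)) (loopWord k)
    (by rw [map_loopWord]; rfl)
    (by have := hchain r; rwa [Nat.cast_zero] at this)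
    (getLastD_loopWord k)
    (by
      intro t ht u hu v hv z hz huv huz hvz
      refine propext (forall_congr' fun hw => ?_)
      subst hw
      have htf : t ∈ facesOfDim (diagramComplex E S) 2 := by rwa [hd.facesOfDim_two]
      exact iff_of_eq (hadj (u := Sum.inr v) (v := Sum.inr z)
        (linkGraph_adj_of_mem (map_inr_mem htf.1) (by simpa using hu) (by simpa using hv) (by simpa using hz) (by simpa using hvz)
        (by simpa using huv.symm) (by simpa using huz.symm))))
  have hkmem : ∀ i, k i ∈ (k 0 :: loopWord k) := by
    intro i
    obtain ⟨j, rfl⟩ : ∃ j, i = j + 1 := ⟨i - 1, by simp⟩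
    refine List.mem_cons_of_mem _ (List.mem_map.2 ⟨j.val, List.mem_range.2 j.val_lt, by simp⟩)
  have hcol : ∀ i, b i = w → G.Reachable p (Sum.inl i) = c w := by
    intro i hi
    have := hc' (k i) (hkmem i)
    simp only [k, hi, forall_const] at this
    exact this
  have hall : ∀ q, (oneSkeleton (mappingCylinder (diagramComplex E S) b)).Adj (Sum.inr w) q →
      G.Reachable p q = c w := by
    rintro (i | u) hq
    · rcases cylinder_adj_inl_inr.1 hq.symm with rfl | rfl
      · exact hcol i rfl
      · rw [houter i rfl, hcol _ rfl]
    · have := hc w u (hd.adj_iff.1 ((cylinder_adj_inr_inr hd.exists_face_loop).1 hq))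
      simp only [g, forall_const] at this
      exact this
  rw [hall q hq, ← hall p hp]

lemma IsFilled.connected_cylinder [NeZero r] (hd : IsFilled E S (b 0) (loopWord b)) :
    (oneSkeleton (mappingCylinder (diagramComplex E S) b)).Connected := by
  have hinl : ∀ i, (oneSkeleton (mappingCylinder (diagramComplex E S) b)).Reachable
      (Sum.inl i) (Sum.inr (b i)) := fun i =>
    (cylinder_adj_inl_inr.2 (Or.inl rfl)).reachable
  have hinr : ∀ w, (oneSkeleton (mappingCylinder (diagramComplex E S) b)).Reachable
      (Sum.inr w) (Sum.inr (b 0)) := by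
    intro w
    rw [hd.connected (fun w => (oneSkeleton (mappingCylinder (diagramComplex E S) b)).Reachable
      (Sum.inr w) (Sum.inr (b 0))) ?_ w (b 0)]
    intro u v huv
    have := ((cylinder_adj_inr_inr hd.exists_face_loop).2 (hd.adj_iff.2 huv)).reachable
    exact propext ⟨this.symm.trans, this.trans⟩
  have hall : ∀ p, (oneSkeleton (mappingCylinder (diagramComplex E S) b)).Reachable p
      (Sum.inr (b 0)) := by
    rintro (i | w)
    · exact (hinl i).trans (hinr _)
    · exact hinr w
  exact SimpleGraph.connected_iff _ |>.2 ⟨fun p q => (hall p).trans (hall q).symm, ⟨Sum.inl 0⟩⟩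

lemma IsFilled.pure_two_cylinder [NeZero r] [Finite W] (hr : 3 ≤ r)
    (hd : IsFilled E S (b 0) (loopWord b)) (s : Finset (ZMod r ⊕ W))
    (hs : s ∈ (mappingCylinder (diagramComplex E S) b).faces) :
    ∃ t ∈ facesOfDim (mappingCylinder (diagramComplex E S) b) 2, s ⊆ t := by
  classical
  have houter : ∀ i, outerTriangle b i ∈ facesOfDim (mappingCylinder (diagramComplex E S) b) 2 :=
    fun i => (mem_cylinder_triangles hr).2 (Or.inr (Or.inl ⟨i, rfl⟩))
  have hedge : ∀ u w, s(u, w) ∈ E →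
      ∃ t ∈ facesOfDim (mappingCylinder (diagramComplex E S) b) 2,
        Sum.inr u ∈ t ∧ Sum.inr w ∈ t := by
    intro u w huw
    have h := hd.ncard_add_ncard huw
    rw [← ncard_trianglesAt_inr_inr hr (by simpa using hd.not_isDiag _ huw)] at h
    obtain ⟨t, ht, hsub⟩ := Set.nonempty_of_ncard_ne_zero (h.trans_ne two_ne_zero)
    exact ⟨t, ht, hsub (by simp), hsub (by simp)⟩
  have hvertex : ∀ v, ∃ t ∈ facesOfDim (mappingCylinder (diagramComplex E S) b) 2,
      Sum.inr v ∈ t := by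
    intro v
    by_cases hv : ∃ w, s(v, w) ∈ E
    · obtain ⟨w, hw⟩ := hv
      obtain ⟨t, ht, h, -⟩ := hedge v w hw
      exact ⟨t, ht, h⟩
    · -- A vertex without neighbours is the only vertex.
      push Not at hv
      have : v = b 0 := by
        have := hd.connected (fun w => w = v) (fun u w huw => propext
          ⟨fun h => absurd (h ▸ huw) (hv _), fun h => absurd (Sym2.eq_swap ▸ h ▸ huw) (hv _)⟩) v (b 0)
        exact (this.mp rfl).symm
      exact ⟨_, houter (-1), by simp [this]⟩
  rcases (mem_cylinder_faces.1 hs).2 with ⟨t, ht, hst⟩ | ⟨i, hst | hst⟩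
  · rcases (mem_diagramComplex.1 ht).2 with ⟨v, hv⟩ | ⟨e, he, hv⟩ | ⟨t', ht', htt⟩
    · obtain ⟨t', ht', hmem⟩ := hvertex v
      refine ⟨t', ht', fun p hp => ?_⟩
      obtain ⟨u, hu, rfl⟩ := Finset.mem_map.1 (hst hp)
      rw [Finset.mem_singleton.1 (hv hu)]
      exact hmem
    · induction e with | _ u w
      obtain ⟨t', ht', hu, hw⟩ := hedge u w he
      refine ⟨t', ht', fun p hp => ?_⟩
      obtain ⟨z, hz, rfl⟩ := Finset.mem_map.1 (hst hp)
      rcases Sym2.mem_iff.1 (hv z hz) with rfl | rfl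
      · exact hu
      · exact hw
    · exact ⟨t'.map Function.Embedding.inr, (mem_cylinder_triangles hr).2
        (Or.inl ⟨t', by rwa [hd.facesOfDim_two], rfl⟩),
        hst.trans (Finset.map_subset_map.2 htt)⟩
  · exact ⟨_, houter i, hst⟩
  · by_cases hi : b i = b (i + 1)
    · refine ⟨_, houter i, fun p hp => ?_⟩
      have := hst hp
      rw [mem_innerTriangle, hi] at this
      rw [mem_outerTriangle]
      tauto
    · exact ⟨_, (mem_cylinder_triangles hr).2 (Or.inr (Or.inr ⟨i, hi, rfl⟩)), hst⟩

/-- The edges of the mapping cylinder that lie in one triangle are those of the boundary cycle. -/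
lemma IsFilled.edges_cylinder [NeZero r] [Finite W] (hr : 3 ≤ r)
    (hd : IsFilled E S (b 0) (loopWord b)) (e : Finset (ZMod r ⊕ W))
    (he : e ∈ facesOfDim (mappingCylinder (diagramComplex E S) b) 1) :
    ((trianglesAt (mappingCylinder (diagramComplex E S) b) e).ncard = 1 ∧
      ∃ i, (e : Set (ZMod r ⊕ W)) = {Sum.inl i, Sum.inl (i + 1)}) ∨
    ((trianglesAt (mappingCylinder (diagramComplex E S) b) e).ncard = 2 ∧
      ∃ w, Sum.inr w ∈ e) := by
  classical
  obtain ⟨p, q, hpq, rfl⟩ := Finset.card_eq_two.1 he.2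
  rw [mem_facesOfDim_one] at he
  rcases p with i | u <;> rcases q with j | w
  · rcases (cylinder_adj_inl_inl hr).1 he with rfl | rfl
    · exact Or.inl ⟨ncard_trianglesAt_inl_inl hr i, i, by simp⟩
    · refine Or.inl ⟨?_, j, by simp [Set.pair_comm]⟩
      rw [Finset.pair_comm]
      exact ncard_trianglesAt_inl_inl hr j
  · exact Or.inr ⟨ncard_trianglesAt_inl_inr hr (cylinder_adj_inl_inr.1 he), w, by simp⟩
  · refine Or.inr ⟨?_, u, by simp⟩
    rw [Finset.pair_comm]
    exact ncard_trianglesAt_inl_inr hr (cylinder_adj_inl_inr.1 he.symm)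
  · refine Or.inr ⟨?_, u, by simp⟩
    have hne : u ≠ w := by simpa using hpq
    rw [ncard_trianglesAt_inr_inr hr hne]
    exact hd.ncard_add_ncard (hd.adj_iff.1 ((cylinder_adj_inr_inr hd.exists_face_loop).1 he))

lemma IsFilled.boundaryEdges_cylinder [NeZero r] [Finite W] (hr : 3 ≤ r)
    (hd : IsFilled E S (b 0) (loopWord b)) :
    boundaryEdges (mappingCylinder (diagramComplex E S) b) =
      {e : Finset (ZMod r ⊕ W) | ∃ i : ZMod r,
        (e : Set (ZMod r ⊕ W)) = {Sum.inl i, Sum.inl (i + 1)}} := by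
  classical
  ext e
  constructor
  · rintro ⟨he, h1⟩
    rcases hd.edges_cylinder hr e he with ⟨-, h⟩ | ⟨h, -⟩
    · exact h
    · omega
  · rintro ⟨i, hi⟩
    obtain rfl : e = {Sum.inl i, Sum.inl (i + 1)} := by
      rw [← Finset.coe_inj, hi]; simp
    exact ⟨mem_facesOfDim_one.2 ((cylinder_adj_inl_inl hr).2 (Or.inl rfl)),
      ncard_trianglesAt_inl_inl hr i⟩

lemma IsFilled.isDisk [NeZero r] [Finite W] (hr : 3 ≤ r)
    (hd : IsFilled E S (b 0) (loopWord b)) :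
    IsDisk (mappingCylinder (diagramComplex E S) b) := by
  classical
  have hedge : ∀ e ∈ facesOfDim (mappingCylinder (diagramComplex E S) b) 1,
      (trianglesAt (mappingCylinder (diagramComplex E S) b) e).ncard = 1 ∨
        (trianglesAt (mappingCylinder (diagramComplex E S) b) e).ncard = 2 := fun e he =>
    (hd.edges_cylinder hr e he).imp And.left And.left
  have hlink : ∀ v p q, (oneSkeleton (mappingCylinder (diagramComplex E S) b)).Adj v p →
      (oneSkeleton (mappingCylinder (diagramComplex E S) b)).Adj v q →
      (linkGraph (mappingCylinder (diagramComplex E S) b) v).Reachable p q := by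
    rintro (i | w) p q hp hq
    · exact (cylinder_link_inl hr i p hp).symm.trans (cylinder_link_inl hr i q hq)
    · exact hd.link_inr hr w p q hp hq
  have hbdry : (boundaryEdges (mappingCylinder (diagramComplex E S) b)).Nonempty := by
    rw [hd.boundaryEdges_cylinder hr]
    exact ⟨{Sum.inl 0, Sum.inl (0 + 1)}, 0, by simp⟩
  exact ⟨inferInstance, hd.connected_cylinder, hd.pure_two_cylinder hr, hedge, hlink, hbdry,
    (euler_iff_isExact hd.connected_cylinder hedge hlink hbdry).2 (hd.isExact_cylinder hr)⟩

/-- A disk diagram whose boundary walk is labelled by a loop is a filling of this loop. -/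
lemma IsFilled.isFilling [NeZero r] [Finite W] (hr : 3 ≤ r)
    (hd : IsFilled E S (b 0) (loopWord b)) {π : W → V} (hπ : IsLabelling X E S π)
    (hγ : ∀ i, π (b i) = γ i) : IsFilling X γ (diagramComplex E S) b π where
  simplicial_left := isSimplicialMap_cycleComplex.2 hd.exists_face_loop
  simplicial_right := by
    classical
    suffices H : ∀ s ∈ (diagramComplex E S).faces, ∃ t ∈ X.faces, ∀ v ∈ s, π v ∈ t by
      intro s hs
      obtain ⟨t, ht, hst⟩ := H s hs
      exact ⟨s.image π, (X.isRelLowerSet_faces ht).2 (Finset.image_subset_iff.2 hst)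
        (hs.1.image π), by simp⟩
    rintro s ⟨-, ⟨v, hv⟩ | ⟨e, he, hv⟩ | ⟨t, ht, hst⟩⟩
    · refine ⟨{π v}, X.singleton_mem _, fun u hu => ?_⟩
      rw [Finset.mem_singleton.1 (hv hu)]
      simp
    · induction e with | _ u w
      obtain ⟨t, ht, h1, h2⟩ := hπ.edge u w he
      refine ⟨t, ht, fun z hz => ?_⟩
      rcases Sym2.mem_iff.1 (hv z hz) with rfl | rfl <;> assumption
    · obtain ⟨t', ht', h⟩ := hπ.triangle t ht
      exact ⟨t', ht', fun v hv => h v (hst hv)⟩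
  comp := hγ
  disk := hd.isDisk hr
  boundary := hd.boundaryEdges_cylinder hr

lemma loopWord_injective [NeZero r] {b b' : ZMod r → W} (h : loopWord b = loopWord b') :
    b = b' := by
  funext i
  obtain ⟨j, rfl⟩ : ∃ j, i = j + 1 := ⟨i - 1, by simp⟩
  have := List.map_inj_left.1 h j.val (List.mem_range.2 j.val_lt)
  simpa using this

/-- The area of a loop is the least number of triangles in a derivation of its word. -/
theorem area_le_iff (hr : 3 ≤ r) {n : ℕ} :
    area X γ ≤ n ↔ NullWithin X (γ 0) (loopWord γ) n := by
  have : NeZero r := ⟨by omega⟩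
  constructor
  · intro h
    have hne : {a | ∃ (W : Type) (D : AbstractSimplicialComplex W) (b : ZMod r → W) (π : W → V),
        IsFilling X γ D b π ∧ a = (faceCount D 2 : ℕ∞)}.Nonempty := by
      by_contra hem
      rw [area, Set.not_nonempty_iff_eq_empty.1 hem, sInf_empty] at h
      exact absurd h (by simp)
    obtain ⟨W, D, b, π, hf, ha⟩ := csInf_mem hne
    have h' : ((faceCount D 2 : ℕ) : ℕ∞) ≤ n := ha ▸ h
    exact (hf.nullWithin hr).mono (by exact_mod_cast h')
  · rintro ⟨m, hm, hw⟩
    obtain ⟨W, _, E, S, x, l, π, hd, hπ, hx, hl, hS⟩ := hw.exists_isFilled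
    obtain ⟨b, rfl, rfl⟩ := exists_loopWord_eq (r := r) (x := x) (l := l)
      (by rw [← length_loopWord γ, ← hl, List.length_map]) hd.closed
    rw [map_loopWord] at hl
    have hf := hd.isFilling (X := X) hr hπ (fun i => congrFun (loopWord_injective hl) i)
    have hle : area X γ ≤ (faceCount (diagramComplex E S) 2 : ℕ∞) :=
      sInf_le ⟨W, _, _, _, hf, rfl⟩
    rw [faceCount, hd.facesOfDim_two, Set.ncard_coe_finset] at hle
    exact hle.trans (by exact_mod_cast hS.trans hm)

end DiagramsToFillings
end SimplicialFilling

namespace SimplicialFilling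

/-! ### The isoperimetric inequality -/

section Subadditivity

/-- A linear bound for the area of a word of length `ℓ`, with a correction of lower order that makes
it superadditive when a word is cut by a short path. -/
noncomputable def areaBound (ρ ℓ : ℝ) : ℝ := ρ * ℓ / 8 - ρ * √(ρ * ℓ) / 2

variable {ρ ℓ ℓ₁ ℓ₂ p : ℝ}

lemma areaBound_le (hρ : 0 < ρ) : areaBound ρ ℓ ≤ ρ * ℓ / 8 := by
  unfold areaBound
  have := Real.sqrt_nonneg (ρ * ℓ)
  have : 0 ≤ ρ * √(ρ * ℓ) := by positivity
  linarith

/-- The correction term is small for words that are long compared with `ρ`. -/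
lemma le_areaBound {k : ℝ} (hρ : 0 < ρ) (hℓ : 0 ≤ ℓ) (hk : 0 ≤ k) (h : ρ ≤ k ^ 2 * ℓ) :
    (1 / 8 - k / 2) * (ρ * ℓ) ≤ areaBound ρ ℓ := by
  have hs : √(ρ * ℓ) ≤ k * ℓ := by
    rw [Real.sqrt_le_left (by positivity)]
    nlinarith
  unfold areaBound
  nlinarith

/-- Cutting a word of length `ℓ` by a path of length `p` into words of length at least `ℓ / 5`. -/
lemma areaBound_add_le (hρ : 0 < ρ) (hℓ : 0 ≤ ℓ) (hp : 0 ≤ p) (h : ℓ₁ + ℓ₂ = ℓ + 2 * p)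
    (h₁ : ℓ / 5 ≤ ℓ₁) (h₂ : ℓ / 5 ≤ ℓ₂) (hp' : p ≤ 2 / 3 * √(ρ * ℓ)) :
    areaBound ρ ℓ₁ + areaBound ρ ℓ₂ ≤ areaBound ρ ℓ := by
  have h₁' : 0 ≤ ℓ₁ := by linarith
  have h₂' : 0 ≤ ℓ₂ := by linarith
  have key : 4 / 3 * √(ρ * ℓ) ≤ √(ρ * ℓ₁) + √(ρ * ℓ₂) := by
    have hprod : 2 / 5 * (ρ * ℓ) ≤ √(ρ * ℓ₁) * √(ρ * ℓ₂) := by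
      rw [← Real.sqrt_mul (by positivity)]
      apply Real.le_sqrt_of_sq_le
      have : 4 / 25 * ℓ ^ 2 ≤ ℓ₁ * ℓ₂ := by nlinarith
      nlinarith [mul_le_mul_of_nonneg_left this (sq_nonneg ρ)]
    refine le_of_sq_le_sq ?_ (by positivity)
    have e := Real.sq_sqrt (show 0 ≤ ρ * ℓ by positivity)
    have e₁ := Real.sq_sqrt (show 0 ≤ ρ * ℓ₁ by positivity)
    have e₂ := Real.sq_sqrt (show 0 ≤ ρ * ℓ₂ by positivity)
    have h3 : ρ * ℓ ≤ ρ * ℓ₁ + ρ * ℓ₂ := by nlinarith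
    have h4 : 0 ≤ ρ * ℓ := by positivity
    rw [mul_pow, e, add_sq, e₁, e₂]
    linarith
  unfold areaBound
  have : ρ * (ℓ₁ + ℓ₂) = ρ * (ℓ + 2 * p) := by rw [h]
  have h5 : ρ * p ≤ ρ * (2 * (√(ρ * ℓ₁) + √(ρ * ℓ₂) - √(ρ * ℓ))) := by
    apply mul_le_mul_of_nonneg_left _ hρ.le
    linarith
  nlinarith

end Subadditivity

section LinearBound

variable {V : Type*} {X : AbstractSimplicialComplex V} {x : V} {l : List V} {n : ℕ} {ρ : ℝ}

lemma NullWithin.exists_isLeast (h : NullWithin X x l n) :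
    ∃ m ≤ n, IsLeast {m | NullWithin X x l m} m := by
  classical
  exact ⟨Nat.find ⟨n, h⟩, Nat.find_min' _ h, Nat.find_spec ⟨n, h⟩, fun m hm => Nat.find_min' _ hm⟩

lemma nullWalk_of_isLeast (h : IsLeast {m | NullWithin X x l m} n) : NullWalk X x l n := by
  obtain ⟨m, hm, hw⟩ := h.1
  rwa [le_antisymm (h.2 hw.nullWithin) hm]

/-- Subdividing a boundary edge by a triangle of a minimal filling gives a word whose length is
greater by one and whose area is smaller by one. -/
lemma exists_peel_of_isLeast (h : IsLeast {m | NullWithin X x l m} (n + 1)) :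
    ∃ l', l'.length = l.length + 1 ∧ IsLeast {m | NullWithin X x l' m} n := by
  obtain ⟨u, y, w, z, rfl, hf, hw⟩ := (nullWalk_of_isLeast h).exists_peel
  refine ⟨u ++ z :: y :: w, by simp [add_assoc], hw.nullWithin, fun m hm => ?_⟩
  have := h.2 (NullWithin.triangle_inside hf hm)
  omega

/-- A minimal filling can be cut along a short path into two minimal fillings. -/
lemma exists_cut_of_isLeast {s d : ℕ} (h : IsLeast {m | NullWithin X x l m} n)
    (hs : 4 * s ≤ l.length) (hn : n < d * d) :
    ∃ (x₁ x₂ : V) (l₁ l₂ : List V) (n₁ n₂ p : ℕ), IsLeast {m | NullWithin X x₁ l₁ m} n₁ ∧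
      IsLeast {m | NullWithin X x₂ l₂ m} n₂ ∧ n₁ + n₂ = n ∧ p < d ∧ s ≤ l₁.length ∧
      s ≤ l₂.length ∧ l₁.length + l₂.length = l.length + 2 * p ∧
      l₁.length + s ≤ l.length + p ∧ l₂.length + s ≤ l.length + p := by
  obtain ⟨u, α, β, p, a, b, hl, hlen, hα, hβ, hp, hpα, hβu, hab, ha, hb⟩ :=
    (nullWalk_of_isLeast h).hasShortCut (s := s) (d := d) (l₁ := l.take s) (l₂ := (l.drop s).take s)
      (l₃ := ((l.drop s).drop s).take s) (l₄ := ((l.drop s).drop s).drop s)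
      (by simp only [List.take_append_drop]) (by simp; omega) (by simp; omega) (by simp; omega)
      (by simp; omega) hn
  obtain ⟨n₁, hn₁, h₁⟩ := ha.exists_isLeast
  obtain ⟨n₂, hn₂, h₂⟩ := hb.exists_isLeast
  have hle := h.2 (hl _ (NullWithin.theta hpα hβu h₁.1 h₂.1))
  refine ⟨_, _, _, _, n₁, n₂, p.length, h₁, h₂, by omega, hp, ?_, ?_, ?_, ?_, ?_⟩ <;>
    simp <;> omega

/-- If there is a gap in the areas of closed words, then the words beyond the gap have area at most
linear in their length. -/
theorem lt_or_le_areaBound (hρ : 0 < ρ) (hρ' : 1 < 44 * ρ ^ 2)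
    (hgap : ∀ x l n, 3 ≤ l.length → IsLeast {m | NullWithin X x l m} n →
      44 * ρ ^ 2 ≤ n ∨ (n : ℝ) ≤ ρ / 44 * l.length)
    (h : IsLeast {m | NullWithin X x l m} n) :
    (n : ℝ) < 44 * ρ ^ 2 ∨ n ≤ areaBound ρ l.length := by
  induction n using Nat.strong_induction_on generalizing x l with | _ n ihn
  induction hk : l.length using Nat.strong_induction_on generalizing n x l with | _ k ihk
  subst hk
  rcases lt_or_ge (n : ℝ) (44 * ρ ^ 2) with hlt | hge
  · exact Or.inl hlt
  right
  have hn1 : 1 < n := by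
    have : (1 : ℝ) < n := hρ'.trans_le hge
    exact_mod_cast this
  obtain ⟨m, rfl⟩ : ∃ m, n = m + 1 := ⟨n - 1, by omega⟩
  have hm1 : (1 : ℝ) ≤ m := by exact_mod_cast (by omega : 1 ≤ m)
  push_cast at hge ⊢
  -- Words of length at most one bound no triangles.
  have hlen : 2 ≤ l.length := by
    by_contra hlt
    have : NullWithin X x l 0 := by
      have hcl := h.1.closed
      rcases l with _ | ⟨y, _ | ⟨z, l⟩⟩
      · exact (NullWalk.nil x).nullWithin
      · obtain rfl : y = x := by simpa using hcl
        exact (NullWalk.nil y).stutter.nullWithin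
      · simp at hlt
    have := h.2 this
    omega
  set ℓ : ℝ := (l.length : ℝ) with hℓ
  have hℓ2 : 2 ≤ ℓ := by rw [hℓ]; exact_mod_cast hlen
  obtain ⟨l', hl', hleast⟩ := exists_peel_of_isLeast h
  have hlen' : (l'.length : ℝ) = ℓ + 1 := by rw [hl']; push_cast; rfl
  by_cases hlt : (m : ℝ) < 44 * ρ ^ 2
  · -- The area of the longer word lies below the gap, which forces the word to be long.
    have hm := (hgap _ l' m (by omega) hleast).resolve_left (not_le.2 hlt)
    rw [hlen'] at hm
    have hlong : 22 * ρ ^ 2 ≤ ρ / 44 * (ℓ + 1) := by linarith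
    have hlong' : 968 * ρ ≤ ℓ + 1 := by
      have : ρ * (968 * ρ) ≤ ρ * (ℓ + 1) := by nlinarith
      exact le_of_mul_le_mul_left this hρ
    refine le_trans ?_ (le_areaBound (k := 5 / 44) hρ (by linarith) (by norm_num) (by linarith))
    nlinarith
  · -- The area is of order `ρ * ℓ` by induction, and this is less than a small multiple of `ℓ ^ 2`,
    -- since `ρ ^ 2` is less than the area. Hence `ℓ` is large, and a cut is short.
    push Not at hlt
    have hm := ((ihn m (by omega) hleast).resolve_left (not_lt.2 hlt)).trans (areaBound_le hρ)
    rw [hlen'] at hm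
    have hm2 : (2 : ℝ) ≤ m := by
      have : (1 : ℝ) < m := hρ'.trans_le hlt
      exact_mod_cast this
    have hlong : 352 * ρ ≤ ℓ + 1 := by
      have : ρ * (352 * ρ) ≤ ρ * (ℓ + 1) := by nlinarith
      exact le_of_mul_le_mul_left this hρ
    have hsq : 2816 * m ≤ (ℓ + 1) ^ 2 := by
      have h1 : (m : ℝ) * (2816 * m) ≤ m * (ℓ + 1) ^ 2 := by
        have h2 : (m : ℝ) * m ≤ (ρ * (ℓ + 1) / 8) * (ρ * (ℓ + 1) / 8) :=
          mul_le_mul hm hm (by linarith) (by positivity)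
        nlinarith [mul_le_mul_of_nonneg_right hlt (sq_nonneg (ℓ + 1))]
      exact le_of_mul_le_mul_left h1 (by linarith)
    have hℓ74 : 74 ≤ ℓ := by nlinarith
    have hlen74 : 74 ≤ l.length := by rw [hℓ] at hℓ74; exact_mod_cast hℓ74
    obtain ⟨x₁, x₂, l₁, l₂, n₁, n₂, p, h₁, h₂, hn, hp, hs₁, hs₂, hsum, hle₁, hle₂⟩ :=
      exists_cut_of_isLeast h (s := l.length / 4) (d := Nat.sqrt (m + 1) + 1) (by omega)
        (Nat.lt_succ_sqrt _)
    have hpsq : (p : ℝ) * p ≤ m + 1 := by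
      have := (Nat.mul_self_le_mul_self (Nat.lt_succ_iff.1 hp)).trans (Nat.sqrt_le (m + 1))
      exact_mod_cast this
    have hp5 : (5 : ℝ) * p ≤ ℓ - 5 := by nlinarith
    have hp5' : 5 * p + 5 ≤ l.length := by
      have : (5 * p + 5 : ℝ) ≤ l.length := by linarith
      exact_mod_cast this
    have hp' : (p : ℝ) ≤ 2 / 3 * √(ρ * ℓ) := by
      have : (3 / 2 * p : ℝ) ≤ √(ρ * ℓ) := Real.le_sqrt_of_sq_le (by nlinarith)
      linarith
    have hfifth : ∀ l' : List V, l.length / 4 ≤ l'.length → ℓ / 5 ≤ (l'.length : ℝ) := by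
      intro l' hl'
      have : l.length ≤ 5 * l'.length := by omega
      have : (l.length : ℝ) ≤ 5 * l'.length := by exact_mod_cast this
      linarith
    have piece : ∀ (y : V) (l' : List V) (n' : ℕ), IsLeast {m | NullWithin X y l' m} n' →
        n' ≤ m + 1 → l.length / 4 ≤ l'.length → l'.length + l.length / 4 ≤ l.length + p →
        (n' : ℝ) ≤ areaBound ρ l'.length := by
      intro y l' n' hl' hn' hs hle
      have hfth := hfifth l' hs
      have hshort : l'.length < l.length := by omega
      -- The pieces have smaller length; their areas may equal the given one.
      have hdich : (n' : ℝ) < 44 * ρ ^ 2 ∨ n' ≤ areaBound ρ l'.length := by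
        rcases Nat.lt_or_eq_of_le hn' with hlt' | rfl
        · exact ihn n' hlt' hl'
        · exact ihk _ hshort (m + 1) ihn hl' rfl
      refine hdich.elim (fun hlt' => ?_) id
      have hsmall := (hgap y l' n' (by omega) hl').resolve_left (not_le.2 hlt')
      refine hsmall.trans (le_trans ?_
        (le_areaBound (k := 9 / 44) hρ (by linarith) (by norm_num) (by linarith)))
      linarith
    have hb₁ := piece _ _ _ h₁ (by omega) hs₁ hle₁
    have hb₂ := piece _ _ _ h₂ (by omega) hs₂ hle₂
    have hnR : (n₁ : ℝ) + n₂ = m + 1 := by exact_mod_cast hn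
    have hadd := areaBound_add_le (ℓ := ℓ) (ℓ₁ := l₁.length) (ℓ₂ := l₂.length) (p := p) hρ
      (by linarith) (Nat.cast_nonneg p) (by rw [hℓ]; exact_mod_cast hsum) (hfifth _ hs₁) (hfifth _ hs₂) hp'
    linarith

variable {r : ℕ} {γ : ZMod r → V}

lemma area_eq_iff (hr : 3 ≤ r) :
    area X γ = n ↔ IsLeast {m | NullWithin X (γ 0) (loopWord γ) m} n := by
  constructor
  · intro h
    exact ⟨(area_le_iff hr).1 h.le, fun m hm => by
      have := (area_le_iff hr).2 hm
      rw [h] at this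
      exact_mod_cast this⟩
  · intro h
    have hle := (area_le_iff hr).2 h.1
    obtain ⟨m, hm⟩ := ENat.ne_top_iff_exists.1 (ne_top_of_le_ne_top (ENat.natCast_ne_top n) hle)
    refine le_antisymm hle ?_
    rw [← hm]
    exact_mod_cast h.2 ((area_le_iff hr).1 hm.ge)

lemma isSimplicialMap_of_nullWithin (hr : 3 ≤ r)
    (h : NullWithin X (γ 0) (loopWord γ) n) : IsSimplicialMap (cycleComplex r) X γ := by
  have hle := (area_le_iff hr).2 h
  have hne : {a | ∃ (W : Type) (D : AbstractSimplicialComplex W) (b : ZMod r → W) (π : W → V),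
      IsFilling X γ D b π ∧ a = (faceCount D 2 : ℕ∞)}.Nonempty := by
    by_contra hem
    rw [area, Set.not_nonempty_iff_eq_empty.1 hem, sInf_empty] at hle
    exact absurd hle (by simp)
  obtain ⟨_, W, D, b, π, hf, -⟩ := hne
  intro s hs
  obtain ⟨t, ht, hst⟩ := hf.simplicial_left s hs
  obtain ⟨t', ht', hst'⟩ := hf.simplicial_right t ht
  refine ⟨t', ht', ?_⟩
  rw [hst', hst, Set.image_image]
  exact Set.image_congr fun i _ => hf.comp i

end LinearBound
end SimplicialFilling

theorem theorem3p9 {V : Type*} [Finite V] (X : AbstractSimplicialComplex V)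
    (ρ : ℝ) (hρ : 0 < ρ) (hρ' : 1 < 44 * ρ ^ 2)
    (hloc : ∀ (r : ℕ), 3 ≤ r → ∀ γ : ZMod r → V,
      SimplicialFilling.IsSimplicialMap (SimplicialFilling.cycleComplex r) X γ →
        ENNReal.ofReal (44 * ρ ^ 2) ≤ (SimplicialFilling.area X γ : ENNReal) ∨
          (SimplicialFilling.area X γ : ENNReal) ≤ ENNReal.ofReal (ρ / 44 * r)) :
    ∀ (r : ℕ), 3 ≤ r → ∀ γ : ZMod r → V,
      SimplicialFilling.IsSimplicialMap (SimplicialFilling.cycleComplex r) X γ →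
        SimplicialFilling.area X γ = ⊤ ∨
          (SimplicialFilling.area X γ : ENNReal) ≤ ENNReal.ofReal (ρ * r) := by
  intro r hr γ hγ
  have hnat : ∀ (n : ℕ) (t : ℝ), 0 ≤ t →
      ((((n : ℕ∞) : ENNReal) ≤ ENNReal.ofReal t) ↔ (n : ℝ) ≤ t) := fun n t ht => by
    rw [ENat.toENNReal_coe, ← ENNReal.ofReal_natCast, ENNReal.ofReal_le_ofReal_iff ht]
  have hgap : ∀ x l n, 3 ≤ l.length →
      IsLeast {m | SimplicialFilling.NullWithin X x l m} n →
        44 * ρ ^ 2 ≤ n ∨ (n : ℝ) ≤ ρ / 44 * l.length := by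
    intro x l n hl h
    have : NeZero l.length := ⟨by omega⟩
    obtain ⟨δ, rfl, hδ⟩ := SimplicialFilling.exists_loopWord_eq (r := l.length) rfl h.1.closed
    generalize l.length = k at *
    subst hδ
    have harea := (SimplicialFilling.area_eq_iff hl).2 h
    have := hloc k hl δ (SimplicialFilling.isSimplicialMap_of_nullWithin hl h.1)
    rw [harea, hnat _ _ (by positivity)] at this
    refine this.imp (fun h' => ?_) id
    rwa [ENat.toENNReal_coe, ← ENNReal.ofReal_natCast,
      ENNReal.ofReal_le_ofReal_iff (Nat.cast_nonneg n)] at h'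
  by_cases htop : SimplicialFilling.area X γ = ⊤
  · exact Or.inl htop
  right
  obtain ⟨n, hn⟩ := ENat.ne_top_iff_exists.1 htop
  have hleast := (SimplicialFilling.area_eq_iff hr).1 hn.symm
  have hlen : (SimplicialFilling.loopWord γ).length = r := SimplicialFilling.length_loopWord γ
  have hpos : 0 ≤ ρ * r := by positivity
  rw [← hn, hnat _ _ hpos]
  rcases SimplicialFilling.lt_or_le_areaBound hρ hρ' hgap hleast with hlt | hle
  · have := (hgap _ _ n (by rw [hlen]; exact hr) hleast).resolve_left (not_le.2 hlt)
    rw [hlen] at this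
    linarith
  · rw [hlen] at hle
    have := hle.trans (SimplicialFilling.areaBound_le hρ)
    linarith
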